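/- Let $X_i=(U_i,V_i)$, $i\ge 1$, be i.i.d. random vectors in $\mathbb R^2$ with law $P_0=P_U\times P_V$, where the marginal distribution functions $F_U,F_V$ are continuous. Consider the null model $\{P_\alpha=Q\times R:\alpha=(Q,R)\}$ of all product laws on $\mathbb R^2$ and put $\alpha_0=(P_U,P_V)$. For $\gamma=(\gamma_1,\gamma_2)\in\mathbb R^2$ and $\alpha=(Q,R)$, with distribution functions $F_Q,F_R$, let $$h_\gamma((u,v),\alpha)=\mathbb 1\{F_Q(u)\le\gamma_1,\ F_R(v)\le\gamma_2\}=\mathbb 1_{Q_\gamma}(F_Q(u),F_R(v)),\qquad Q_\gamma=(-\infty,\gamma_1]\times(-\infty,\gamma_2].$$ Let $P_n$ be the empirical measure of $X_1,\dots,X_n$, and let $\hat\alpha=(P_{nU},P_{nV})$ be the pair of its marginals, so that the NPMLE of $P_0$ is $P_{\hat\alpha}=P_{nU}\times P_{nV}$. Let $\Pi$ be the orthogonal projection in $L_2(P_0)$ onto the tangent space of the null model at $P_0$, that is, onto the closed linear span of the scores at $P_0$ of all regular one-parameter submodels through $P_0$ (continuously Hellinger-differentiable, with nonvanishing information). Write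 $Q(f)=\int f\,dQ$ and $\|\cdot\|_\infty$ for the supremum over $\gamma\in\mathbb R^2$; probabilities and expectations of nonmeasurable objects are outer ones. Then the function $$\Pi h_\gamma(x,y)=\int h_\gamma((x,v),\alpha_0)\,dP_V(v)+\int h_\gamma((u,y),\alpha_0)\,dP_U(u)-2\,P_0\big(h_\gamma(\cdot,\alpha_0)\big)$$ is a version of $\Pi(h_\gamma(\cdot,\alpha_0))$ for every $\gamma$, and with these versions the following hold. (M0) $\{h_\gamma(\cdot,\alpha_0)-\Pi h_\gamma:\gamma\in\mathbb R^2\}$ is a universal Donsker class, that is, a $Q$-Donsker class for every probability measure $Q$ on $\mathbb R^2$. (M3) $\|(P_n-P_0)(h_\gamma(\cdot,\hat\alpha)-h_\gamma(\cdot,\alpha_0))\|_\infty=o_P(n^{-1/2})$. (M4) $\|(P_{\hat\alpha}-P_0)(h_\gamma(\cdot,\hat\alpha)-h_\gamma(\cdot,\alpha_0))\|_\infty=o_P(n^{-1/2})$. (M5) $\|(P_{\hat\alpha}-P_0)h_\gamma(\cdot,\alpha_0)-(P_n-P_0)\Pi h_\gamma\|_\infty=o_P(n^{-1/2})$. Consequently,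 with $Z_n(\gamma)=n^{-1/2}\sum_{i=1}^n\big(h_\gamma(X_i,\alpha_0)-P_0(h_\gamma(\cdot,\alpha_0))-\Pi h_\gamma(X_i)\big)$ and the linear rank score process $\hat Z_n(\gamma)=\sqrt n\,(P_n-P_{\hat\alpha})(h_\gamma(\cdot,\hat\alpha))$, $$Z_n\Rightarrow Z,\qquad \|\hat Z_n-Z_n\|_\infty=o_P(1),\qquad \hat Z_n\Rightarrow Z$$ weakly in $\ell^\infty(\mathbb R^2)$ in the sense of Hoffmann-Jørgensen, where $Z$ is a tight mean-zero Gaussian process with $$\operatorname{cov}(Z(\gamma),Z(\gamma'))=\operatorname{cov}_{P_0}\big(h_\gamma(\cdot,\alpha_0),h_{\gamma'}(\cdot,\alpha_0)\big)-\operatorname{cov}_{P_0}(\Pi h_\gamma,\Pi h_{\gamma'}).$$ -/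

import Mathlib

open MeasureTheory ProbabilityTheory Filter Topology
open scoped ENNReal NNReal

noncomputable section

namespace ScoreTest

/-! ### Weak convergence in `ℓ^∞(T)` in the sense of Hoffmann-Jørgensen -/

/-- The Banach space of bounded real functions on `T` with the supremum norm. -/
abbrev EllInfty (T : Type*) : Type _ := lp (fun _ : T => ℝ) ∞

/-- `ℓ^∞(T)` carries its Borel σ-algebra (for the supremum norm). -/
instance instMeasurableSpaceEllInfty (T : Type*) : MeasurableSpace (EllInfty T) := borel _

instance instBorelSpaceEllInfty (T : Type*) : BorelSpace (EllInfty T) := ⟨rfl⟩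

/-- Outer expectation `E^* Y`: the infimum of `E g` over the integrable measurable `g ≥ Y`. It is
used only for bounded `Y` and a probability measure `μ`. -/
def outerExpectation {Ω : Type*} [MeasurableSpace Ω] (μ : Measure Ω) (Y : Ω → ℝ) : ℝ :=
  sInf {r : ℝ | ∃ g : Ω → ℝ, Measurable g ∧ Integrable g μ ∧ (∀ ω, Y ω ≤ g ω) ∧ r = ∫ ω, g ω ∂μ}

/-- Weak convergence of the (not necessarily measurable) maps `Z n` to the Borel law `L`:
`E^* φ(Z n) → ∫ φ dL` for every bounded continuous `φ`. -/
def WeaklyConvergesTo {Ω E : Type*} [MeasurableSpace Ω] [TopologicalSpace E] [MeasurableSpace E]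
    (μ : Measure Ω) (Z : ℕ → Ω → E) (L : Measure E) : Prop :=
  ∀ φ : BoundedContinuousFunction E ℝ,
    Tendsto (fun n => outerExpectation μ (fun ω => φ (Z n ω))) atTop (𝓝 (∫ z, φ z ∂L))

/-- `L` is a tight Borel law on `ℓ^∞(T)` whose coordinate process is a mean-zero Gaussian process
with covariance function `K`. -/
structure IsTightGaussianLaw {T : Type*} (L : Measure (EllInfty T)) (K : T → T → ℝ) : Prop where
  isProbabilityMeasure : IsProbabilityMeasure L
  tight : IsTightMeasureSet {L}
  gaussian : IsGaussianProcess (fun (t : T) (z : EllInfty T) => (z t : ℝ)) L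
  mean_eq_zero : ∀ t : T, ∫ z : EllInfty T, (z t : ℝ) ∂L = 0
  cov_eq : ∀ s t : T,
    covariance (fun z : EllInfty T => (z s : ℝ)) (fun z : EllInfty T => (z t : ℝ)) L = K s t

/-! ### Empirical measures and Donsker classes -/

/-- The empirical measure `n⁻¹ ∑_{i < n} δ_{x i}` of the first `n ≥ 1` terms of `x` (with the
convention that it is `δ_{x 0}` for `n = 0`, a case without any role in the asymptotics). -/
def empiricalMeasure {S : Type*} [MeasurableSpace S] (x : ℕ → S) (n : ℕ) : Measure S :=
  if n = 0 then Measure.dirac (x 0)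
  else (n : ℝ≥0∞)⁻¹ • ∑ i ∈ Finset.range n, Measure.dirac (x i)

instance instIsProbabilityMeasureEmpiricalMeasure {S : Type*} [MeasurableSpace S] (x : ℕ → S)
    (n : ℕ) : IsProbabilityMeasure (empiricalMeasure x n) := by
  unfold empiricalMeasure
  split_ifs with h
  · infer_instance
  · refine ⟨?_⟩
    simp only [Measure.smul_apply, Measure.finsetSum_apply, measure_univ, Finset.sum_const,
      Finset.card_range, nsmul_eq_mul, mul_one, smul_eq_mul]
    exact ENNReal.inv_mul_cancel (by exact_mod_cast h) (ENNReal.natCast_ne_top n)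

/-- `F` is a `Q`-Donsker class of measurable functions: for an i.i.d. sample from `Q` (the
coordinates of the infinite product space), the empirical process
`f ↦ √n (Q_n f - Q f)`, `f ∈ F`, takes its values in `ℓ^∞(F)` and converges weakly there to a tight
`Q`-Brownian bridge. -/
def IsDonsker {S : Type*} [MeasurableSpace S] (Q : Measure S) (F : Set (S → ℝ)) : Prop :=
  (∀ f ∈ F, Measurable f ∧ MemLp f 2 Q) ∧
  ∃ (G : ℕ → (ℕ → S) → EllInfty F) (L : Measure (EllInfty F)),
    (∀ (n : ℕ) (x : ℕ → S) (f : F),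
      G n x f = √(n : ℝ) * ((∫ s, f.1 s ∂(empiricalMeasure x n)) - ∫ s, f.1 s ∂Q)) ∧
    IsTightGaussianLaw L (fun f g => covariance f.1 g.1 Q) ∧
    WeaklyConvergesTo (Measure.infinitePi fun _ : ℕ => Q) G L

/-- A universal Donsker class: `Q`-Donsker for every probability measure `Q` on the sample space. -/
def IsUniversalDonsker {S : Type*} [MeasurableSpace S] (F : Set (S → ℝ)) : Prop :=
  ∀ Q : Measure S, IsProbabilityMeasure Q → IsDonsker Q F

/-! ### Scores, tangent spaces, projections -/

/-- `g` is the score at `P₀` of a regular one-parameter submodel `(P_t)`, `|t| < δ`, of the model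
`M` with `P_0 = P₀`: the `P_t` are dominated by one σ-finite `ν`, the map `t ↦ s_t = √(dP_t/dν)`
into `L₂(ν)` is continuously differentiable with derivative `s'_t`, the Fisher information
`4 ‖s'_t‖²` does not vanish, and `g = 2 s'_0 / s_0` in `L₂(P₀)`. -/
def IsRegularScore {S : Type*} [MeasurableSpace S] (M : Set (Measure S)) (P₀ : Measure S)
    (g : Lp ℝ 2 P₀) : Prop :=
  ∃ (δ : ℝ) (ν : Measure S) (P : ℝ → Measure S) (s s' : ℝ → Lp ℝ 2 ν),
    0 < δ ∧ SigmaFinite ν ∧ P 0 = P₀ ∧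
    (∀ t ∈ Set.Ioo (-δ) δ,
      P t ∈ M ∧ P t ≪ ν ∧
      (s t : S → ℝ) =ᵐ[ν] (fun x => √((P t).rnDeriv ν x).toReal) ∧
      HasDerivAt s (s' t) t ∧ s' t ≠ 0) ∧
    ContinuousOn s' (Set.Ioo (-δ) δ) ∧
    (g : S → ℝ) =ᵐ[P₀] (fun x => 2 * s' 0 x / s 0 x)

/-- The tangent space of the model `M` at `P₀`: the closed linear span in `L₂(P₀)` of the scores of
all regular one-parameter submodels through `P₀`. -/
def tangentSpace {S : Type*} [MeasurableSpace S] (M : Set (Measure S)) (P₀ : Measure S) :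
    Submodule ℝ (Lp ℝ 2 P₀) :=
  (Submodule.span ℝ {g : Lp ℝ 2 P₀ | IsRegularScore M P₀ g}).topologicalClosure

instance instCompleteSpaceTangentSpace {S : Type*} [MeasurableSpace S] (M : Set (Measure S))
    (P₀ : Measure S) : CompleteSpace (tangentSpace M P₀) :=
  (Submodule.isClosed_topologicalClosure _).completeSpace_coe

/-- The function `k` is a version of the orthogonal projection in `L₂(P₀)` of `h` onto the tangent
space of the model `M` at `P₀`. -/
def IsProjectionVersion {S : Type*} [MeasurableSpace S] (M : Set (Measure S)) (P₀ : Measure S)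
    (h k : S → ℝ) : Prop :=
  Measurable k ∧ ∃ hh : MemLp h 2 P₀,
    k =ᵐ[P₀] ((tangentSpace M P₀).starProjection (hh.toLp h) : S → ℝ)

/-! ### The conditions on a score process

`A` is the parameter space under the null hypothesis, `P α` the law with parameter `α`, `h γ α` the
test functions, `α₀` the true parameter, `Pn` the empirical measure and `αhat` the estimate (both
depend on the sample size and on `ω`), and `proj γ` stands for (a version of) the projection of
`h γ α₀` onto the null tangent space at `α₀`. -/

/-- `sup_γ |D n γ| = o_P(r n)`, in outer probability. -/
def SupLittleOP {Ω Γ : Type*} [MeasurableSpace Ω] (μ : Measure Ω) (D : ℕ → Ω → Γ → ℝ)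
    (r : ℕ → ℝ) : Prop :=
  ∀ ε : ℝ, 0 < ε →
    Tendsto (fun n => μ {ω | ENNReal.ofReal (ε * r n) < ⨆ γ, ‖D n ω γ‖ₑ}) atTop (𝓝 0)

/-- The rate `n^{-1/2}`. -/
def rootRate (n : ℕ) : ℝ := (√(n : ℝ))⁻¹

section Conditions

variable {S Ω Γ A : Type*} [MeasurableSpace S] [MeasurableSpace Ω]

/-- `{h_γ(·, α₀) - Π(h_γ(·, α₀), α₀) : γ}` is a universal Donsker class. -/
def CondM0 (h : Γ → A → S → ℝ) (proj : Γ → S → ℝ) (α₀ : A) : Prop :=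
  IsUniversalDonsker (Set.range fun γ : Γ => fun x : S => h γ α₀ x - proj γ x)

/-- `‖(P_n - P_0)(h_γ(·, α̂) - h_γ(·, α₀))‖_∞ = o_P(n^{-1/2})`. -/
def CondM3 (μ : Measure Ω) (P : A → Measure S) (h : Γ → A → S → ℝ) (α₀ : A)
    (Pn : ℕ → Ω → Measure S) (αhat : ℕ → Ω → A) : Prop :=
  SupLittleOP μ (fun n ω γ =>
    (∫ x, (h γ (αhat n ω) x - h γ α₀ x) ∂(Pn n ω))
      - ∫ x, (h γ (αhat n ω) x - h γ α₀ x) ∂(P α₀)) rootRate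

/-- `‖(P_α̂ - P_0)(h_γ(·, α̂) - h_γ(·, α₀))‖_∞ = o_P(n^{-1/2})`. -/
def CondM4 (μ : Measure Ω) (P : A → Measure S) (h : Γ → A → S → ℝ) (α₀ : A)
    (αhat : ℕ → Ω → A) : Prop :=
  SupLittleOP μ (fun n ω γ =>
    (∫ x, (h γ (αhat n ω) x - h γ α₀ x) ∂(P (αhat n ω)))
      - ∫ x, (h γ (αhat n ω) x - h γ α₀ x) ∂(P α₀)) rootRate

/-- `‖(P_α̂ - P_0) h_γ(·, α₀) - (P_n - P_0) Π(h_γ(·, α₀), α₀)‖_∞ = o_P(n^{-1/2})`. -/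
def CondM5 (μ : Measure Ω) (P : A → Measure S) (h : Γ → A → S → ℝ) (proj : Γ → S → ℝ) (α₀ : A)
    (Pn : ℕ → Ω → Measure S) (αhat : ℕ → Ω → A) : Prop :=
  SupLittleOP μ (fun n ω γ =>
    ((∫ x, h γ α₀ x ∂(P (αhat n ω))) - ∫ x, h γ α₀ x ∂(P α₀))
      - ((∫ x, proj γ x ∂(Pn n ω)) - ∫ x, proj γ x ∂(P α₀))) rootRate

/-- The score process at the true parameter,
`Z_n(γ, α₀) = n^{-1/2} ∑_{i<n} (h_γ - P_0 h_γ - Π h_γ)(X_i)`, where `h_γ = h_γ(·, α₀)`;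
`h_γ - P_0 h_γ - Π h_γ` is the component of the centered `h_γ` orthogonal to the tangent space. -/
def scoreProcess (P : A → Measure S) (h : Γ → A → S → ℝ) (proj : Γ → S → ℝ) (α₀ : A)
    (X : ℕ → Ω → S) (n : ℕ) (ω : Ω) (γ : Γ) : ℝ :=
  (√(n : ℝ))⁻¹ * ∑ i ∈ Finset.range n,
    (h γ α₀ (X i ω) - (∫ y, h γ α₀ y ∂(P α₀)) - proj γ (X i ω))

/-- The estimated score process `√n (P_n - P_α̂)(h_γ(·, α̂))`. -/
def estimatedScoreProcess (P : A → Measure S) (h : Γ → A → S → ℝ)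
    (Pn : ℕ → Ω → Measure S) (αhat : ℕ → Ω → A) (n : ℕ) (ω : Ω) (γ : Γ) : ℝ :=
  √(n : ℝ) * ((∫ x, h γ (αhat n ω) x ∂(Pn n ω)) - ∫ x, h γ (αhat n ω) x ∂(P (αhat n ω)))

/-- The conclusion on score processes: both `Z` (the score process at `α₀`) and `Zhat` (the
estimated one) are `ℓ^∞(Γ)`-valued and converge weakly to the tight mean-zero Gaussian process with
covariance `cov_0(h_γ, h_γ') - cov_0(Π h_γ, Π h_γ')`, and their difference is `o_P(1)` uniformly. -/
def ScoreProcessesConverge (μ : Measure Ω) (P₀ : Measure S) (h₀ proj : Γ → S → ℝ)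
    (Z Zhat : ℕ → Ω → Γ → ℝ) : Prop :=
  ∃ (L : Measure (EllInfty Γ)) (W What : ℕ → Ω → EllInfty Γ),
    IsTightGaussianLaw L
      (fun γ γ' => covariance (h₀ γ) (h₀ γ') P₀ - covariance (proj γ) (proj γ') P₀) ∧
    (∀ n ω γ, W n ω γ = Z n ω γ) ∧ (∀ n ω γ, What n ω γ = Zhat n ω γ) ∧
    WeaklyConvergesTo μ W L ∧
    SupLittleOP μ (fun n ω γ => Zhat n ω γ - Z n ω γ) (fun _ => 1) ∧
    WeaklyConvergesTo μ What L

end Conditions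

/-! ### Independence with rank-based indices -/

/-- Parameters of the independence hypothesis: the pair `(P_U, P_V)` of marginal laws. -/
abbrev Marginals : Type := ProbabilityMeasure ℝ × ProbabilityMeasure ℝ

/-- The law `P_U × P_V`. -/
def productLaw (α : Marginals) : Measure (ℝ × ℝ) := (α.1 : Measure ℝ).prod (α.2 : Measure ℝ)

/-- The null model: all product laws on the plane. -/
def independenceModel : Set (Measure (ℝ × ℝ)) := Set.range productLaw

/-- The quadrant `Q_γ = (-∞, γ₁] × (-∞, γ₂]`. -/
def quadrant (γ : ℝ × ℝ) : Set (ℝ × ℝ) := Set.Iic γ.1 ×ˢ Set.Iic γ.2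

/-- `h_γ((u, v), P_U × P_V) = 1_{Q_γ}(F_U(u), F_V(v))`. -/
def rankIndex (γ : ℝ × ℝ) (α : Marginals) (x : ℝ × ℝ) : ℝ :=
  (quadrant γ).indicator (fun _ => (1 : ℝ))
    (cdf (α.1 : Measure ℝ) x.1, cdf (α.2 : Measure ℝ) x.2)

/-- The explicit version
`∫ h(x, v) dF_V(v) + ∫ h(u, y) dF_U(u) - 2 ∫∫ h(u, v) dF_U(u) dF_V(v)` of `Π(h_γ(·, α), α)`. -/
def rankProj (α : Marginals) (γ : ℝ × ℝ) (x : ℝ × ℝ) : ℝ :=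
  (∫ v, rankIndex γ α (x.1, v) ∂(α.2 : Measure ℝ))
    + (∫ u, rankIndex γ α (u, x.2) ∂(α.1 : Measure ℝ))
    - 2 * ∫ z, rankIndex γ α z ∂(productLaw α)

/-- The NPMLE under independence: the pair `(P_{nU}, P_{nV})` of empirical marginals. -/
def independenceNPMLE (x : ℕ → ℝ × ℝ) (n : ℕ) : Marginals :=
  (⟨empiricalMeasure (fun i => (x i).1) n, inferInstance⟩,
   ⟨empiricalMeasure (fun i => (x i).2) n, inferInstance⟩)

end ScoreTest

end

/-! Every index `h_γ(·, α)` is the indicator of a product of two lower sets of the line. Lower sets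
replace closed half-lines because a sublevel set of an empirical distribution function may be an
open half-line. All the processes are thus read off one empirical process, indexed by all pairs of
lower sets. The probabilistic core is a Donsker theorem for this class under an arbitrary law on the
plane, with asymptotic equicontinuity in the marginal masses of the sides (`emp_equicontinuous`) and
stochastic boundedness (`emp_bounded`). Equicontinuity is proved by chaining: lower sets are
bracketed by their mass, a Bernstein bound controls the links between brackets, and the monotonicity
of counts closes the chain at a level growing with the sample size.

Weak convergence in `ℓ^∞` follows from finite marginals and equicontinuity over nested finite
partitions. The discretized processes have Borel laws concentrated on common compact sets;
Prokhorov's theorem gives a tight limit, which the characteristic functions identify as Gaussian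
(`exists_tightGaussianLaw_weaklyConvergesTo`). A class of bounded combinations of a fixed number of
rectangles is then handled by a continuous linear map of `ℓ^∞` spaces, which yields (M0) and the
limit of `Z_n`.

For the remainders let `p`, `q` be the true masses of the sides of a rectangle and `E`, `F` the
empirical process at the two strips. The fitted mass is `(p + E/√n)(q + F/√n)`, and the projection
accounts for exactly the terms `pF + qE`, so (M5) leaves `EF/n`. Continuity of the marginal
distribution functions turns the uniform error of the empirical ones into closeness of the true and
estimated sides in mass (`abs_real_cdfLower_sub_le`); equicontinuity then gives (M3) and, after
expanding products, (M4). The difference of the two score processes is an exact combination of these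
three remainders (`estimatedScoreProcess_sub_eq`).

For the projection, let `φ`, `ψ` be the centered indicators of the sides. Then `Πh = qφ(x) + pψ(y)`
and `h - Πh = φ(x)ψ(y) + pq`. Bounded centered functions of one coordinate are limits of scores, or
zero, through linear tilts of one marginal (`toLp_mem_tangentSpace`). Conversely, differentiating
`P_t(φψ) = P_t φ · P_t ψ` at a point where both factors vanish shows that every score is orthogonal
to `φψ`, and differentiating `P_t 1 = 1` shows that it is centered (`integral_mul_score_eq_zero`).
-/

set_option linter.unusedSectionVars false

noncomputable section

namespace ScoreTest

/-! ### Outer expectations through measurable majorants -/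

section OuterExpectation

variable {Ω : Type*} [MeasurableSpace Ω] {μ : Measure Ω} [IsProbabilityMeasure μ]

lemma outerExpectation_le {Y g : Ω → ℝ} {c : ℝ} (hc : ∀ ω, c ≤ Y ω) (hg : Measurable g)
    (hgi : Integrable g μ) (hY : ∀ ω, Y ω ≤ g ω) : outerExpectation μ Y ≤ ∫ ω, g ω ∂μ := by
  -- The lower bound `c` on `Y` bounds the set of integrals below, so that `sInf` is a genuine
  -- infimum.
  refine csInf_le ⟨c, ?_⟩ ⟨g, hg, hgi, hY, rfl⟩
  rintro r ⟨g', -, hgi', hY', rfl⟩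
  calc c = ∫ _, c ∂μ := by simp
    _ ≤ ∫ ω, g' ω ∂μ := integral_mono (integrable_const c) hgi' fun ω => (hc ω).trans (hY' ω)

lemma le_outerExpectation {Y : Ω → ℝ} {c C : ℝ} (hC : ∀ ω, Y ω ≤ C)
    (h : ∀ g : Ω → ℝ, Measurable g → Integrable g μ → (∀ ω, Y ω ≤ g ω) → c ≤ ∫ ω, g ω ∂μ) :
    c ≤ outerExpectation μ Y := by
  refine le_csInf ⟨_, fun _ => C, measurable_const, integrable_const C, hC, rfl⟩ ?_
  rintro r ⟨g, hg, hgi, hY, rfl⟩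
  exact h g hg hgi hY

end OuterExpectation

/-! ### Lipschitz approximation of bounded continuous functions from above -/

section Lipschitz

variable {E : Type*} [PseudoMetricSpace E]

lemma bcf_abs_le (φ : BoundedContinuousFunction E ℝ) (x : E) : |φ x| ≤ ‖φ‖ := by
  simpa using φ.norm_coe_le_norm x

/-- The upper Lipschitz envelope `x ↦ sup_y (φ y - k d(x, y))`. -/
def lipEnvelope (φ : BoundedContinuousFunction E ℝ) (k : ℝ≥0) (x : E) : ℝ :=
  ⨆ y, (φ y - k * dist x y)

lemma lipEnvelope_bdd (φ : BoundedContinuousFunction E ℝ) (k : ℝ≥0) (x : E) :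
    BddAbove (Set.range fun y => φ y - k * dist x y) := by
  refine ⟨‖φ‖, ?_⟩
  rintro _ ⟨y, rfl⟩
  have h1 := le_of_abs_le (bcf_abs_le φ y)
  have h2 : (0 : ℝ) ≤ k * dist x y := by positivity
  simp only
  linarith

lemma le_lipEnvelope (φ : BoundedContinuousFunction E ℝ) (k : ℝ≥0) (x : E) :
    φ x ≤ lipEnvelope φ k x := by
  have h := le_ciSup (lipEnvelope_bdd φ k x) x
  simp only [dist_self, mul_zero, sub_zero] at h
  exact h

lemma lipEnvelope_le (φ : BoundedContinuousFunction E ℝ) (k : ℝ≥0) (x : E) :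
    lipEnvelope φ k x ≤ ‖φ‖ := by
  have : Nonempty E := ⟨x⟩
  refine ciSup_le fun y => ?_
  have h1 := le_of_abs_le (bcf_abs_le φ y)
  have h2 : (0 : ℝ) ≤ k * dist x y := by positivity
  linarith

lemma abs_lipEnvelope_le (φ : BoundedContinuousFunction E ℝ) (k : ℝ≥0) (x : E) :
    |lipEnvelope φ k x| ≤ ‖φ‖ :=
  abs_le.2 ⟨(neg_le_of_abs_le (bcf_abs_le φ x)).trans (le_lipEnvelope φ k x),
    lipEnvelope_le φ k x⟩

lemma lipschitzWith_lipEnvelope (φ : BoundedContinuousFunction E ℝ) (k : ℝ≥0) :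
    LipschitzWith k (lipEnvelope φ k) := by
  refine LipschitzWith.of_le_add_mul k fun x y => ?_
  have : Nonempty E := ⟨x⟩
  refine ciSup_le fun z => ?_
  have h1 := le_ciSup (lipEnvelope_bdd φ k y) z
  have h2 : (k : ℝ) * dist y z ≤ k * (dist x y + dist x z) := by
    gcongr
    rw [dist_comm x y]
    exact dist_triangle y x z
  unfold lipEnvelope
  linarith

/-- Points near `x` contribute at most about `φ x` by continuity, and far points are eliminated by
the penalty once `k` is large. -/
lemma tendsto_lipEnvelope (φ : BoundedContinuousFunction E ℝ) (x : E) :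
    Tendsto (fun k : ℕ => lipEnvelope φ k x) atTop (𝓝 (φ x)) := by
  have : Nonempty E := ⟨x⟩
  rw [Metric.tendsto_atTop]
  intro ε hε
  obtain ⟨δ, hδ, hball⟩ := Metric.continuous_iff.1 φ.continuous x (ε / 2) (by positivity)
  -- Beyond distance `δ` the penalty `k δ` then exceeds the total oscillation `2 ‖φ‖`.
  obtain ⟨N, hN⟩ := exists_nat_gt (2 * ‖φ‖ / δ)
  refine ⟨N, fun k hk => ?_⟩
  have hle : lipEnvelope φ k x ≤ φ x + ε / 2 := by
    refine ciSup_le fun y => ?_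
    rcases lt_or_ge (dist y x) δ with h | h
    · have h1 := hball y h
      rw [Real.dist_eq] at h1
      have h2 := (abs_lt.1 h1).2
      have h3 : (0 : ℝ) ≤ ((k : ℝ≥0) : ℝ) * dist x y := by positivity
      linarith
    · have h1 := le_of_abs_le (bcf_abs_le φ y)
      have h2 := neg_le_of_abs_le (bcf_abs_le φ x)
      have h3 : 2 * ‖φ‖ < k * δ := by
        rw [div_lt_iff₀ hδ] at hN
        refine hN.trans_le ?_
        gcongr
      have h4 : (k : ℝ) * δ ≤ ((k : ℝ≥0) : ℝ) * dist x y := by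
        rw [dist_comm x y]
        simp only [NNReal.coe_natCast]
        gcongr
      linarith
  have hge := le_lipEnvelope φ k x
  rw [Real.dist_eq, abs_lt]
  constructor <;> linarith

/-- The upper Lipschitz envelope as a bounded continuous function. -/
def lipEnvelopeBCF (φ : BoundedContinuousFunction E ℝ) (k : ℝ≥0) :
    BoundedContinuousFunction E ℝ :=
  BoundedContinuousFunction.ofNormedAddCommGroup (lipEnvelope φ k)
    (lipschitzWith_lipEnvelope φ k).continuous ‖φ‖ (abs_lipEnvelope_le φ k)

end Lipschitz

/-! ### Portmanteau and Slutsky arguments without measurability -/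

section WeakConvergence

variable {Ω E : Type*} [MeasurableSpace Ω] {μ : Measure Ω} [IsProbabilityMeasure μ]
  [PseudoMetricSpace E] [MeasurableSpace E] [BorelSpace E] {L : Measure E}
  [IsProbabilityMeasure L]

/-- `E^* φ(Z_n) ≤ ∫ φ dL + ε` eventually, witnessed by measurable majorants. -/
def UpperBound (μ : Measure Ω) (Z : ℕ → Ω → E) (L : Measure E)
    (φ : BoundedContinuousFunction E ℝ) : Prop :=
  ∀ ε : ℝ, 0 < ε → ∀ᶠ n in atTop, ∃ g : Ω → ℝ, Measurable g ∧ Integrable g μ ∧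
    (∀ ω, φ (Z n ω) ≤ g ω) ∧ ∫ ω, g ω ∂μ ≤ (∫ z, φ z ∂L) + ε

lemma bcf_integrable (φ : BoundedContinuousFunction E ℝ) : Integrable (fun z => φ z) L :=
  φ.integrable L

/-- A majorant of a Lipschitz envelope is a majorant of `φ`, and the `L`-integrals of the envelopes
converge to that of `φ` by dominated convergence. -/
lemma upperBound_of_lipschitz {Z : ℕ → Ω → E}
    (h : ∀ (φ : BoundedContinuousFunction E ℝ) (K : ℝ≥0), LipschitzWith K φ → UpperBound μ Z L φ)
    (φ : BoundedContinuousFunction E ℝ) : UpperBound μ Z L φ := by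
  intro ε hε
  have hlim : Tendsto (fun k : ℕ => ∫ z, lipEnvelopeBCF φ k z ∂L) atTop (𝓝 (∫ z, φ z ∂L)) := by
    refine tendsto_integral_of_dominated_convergence (fun _ => ‖φ‖) ?_ (integrable_const _) ?_ ?_
    · intro k
      exact (bcf_integrable (lipEnvelopeBCF φ k)).aestronglyMeasurable
    · intro k
      exact Eventually.of_forall fun z => abs_lipEnvelope_le φ k z
    · exact Eventually.of_forall fun z => tendsto_lipEnvelope φ z
  obtain ⟨k, hk⟩ := (hlim.eventually (gt_mem_nhds (lt_add_of_pos_right _ (half_pos hε)))).exists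
  filter_upwards [h (lipEnvelopeBCF φ k) k (lipschitzWith_lipEnvelope φ k) (ε / 2) (half_pos hε)]
    with n hn
  obtain ⟨g, hg, hgi, hle, hint⟩ := hn
  exact ⟨g, hg, hgi, fun ω => (le_lipEnvelope φ k _).trans (hle ω), by linarith⟩

/-- One-sided bounds suffice because `-φ` is also admissible: if `f` majorizes `φ` and `g'`
majorizes `-φ`, then `f + g' ≥ 0`, which bounds the outer expectation from below. -/
lemma weaklyConvergesTo_of_upperBound {Z : ℕ → Ω → E}
    (h : ∀ φ : BoundedContinuousFunction E ℝ, UpperBound μ Z L φ) :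
    WeaklyConvergesTo μ Z L := by
  intro φ
  rw [Metric.tendsto_atTop]
  intro ε hε
  obtain ⟨N, hN⟩ := eventually_atTop.1
    ((h φ (ε / 2) (half_pos hε)).and (h (-φ) (ε / 2) (half_pos hε)))
  refine ⟨N, fun n hn => ?_⟩
  obtain ⟨⟨g, hg, hgi, hle, hint⟩, ⟨g', hg', hgi', hle', hint'⟩⟩ := hN n hn
  have h1 : outerExpectation μ (fun ω => φ (Z n ω)) ≤ (∫ z, φ z ∂L) + ε / 2 :=
    (outerExpectation_le (fun ω => neg_le_of_abs_le (bcf_abs_le φ _)) hg hgi hle).trans hint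
  have h2 : (∫ z, φ z ∂L) - ε / 2 ≤ outerExpectation μ (fun ω => φ (Z n ω)) := by
    refine le_outerExpectation (fun ω => le_of_abs_le (bcf_abs_le φ _)) fun f hf hfi hfle => ?_
    have h3 : (0 : ℝ) ≤ ∫ ω, (f ω + g' ω) ∂μ := by
      refine integral_nonneg fun ω => ?_
      have := hfle ω
      have h4 := hle' ω
      simp only [BoundedContinuousFunction.coe_neg, Pi.neg_apply] at h4
      simp only [Pi.zero_apply]
      linarith
    rw [integral_add hfi hgi'] at h3
    simp only [BoundedContinuousFunction.coe_neg, Pi.neg_apply, integral_neg] at hint'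
    linarith
  rw [Real.dist_eq, abs_lt]
  constructor <;> linarith

lemma upperBound_of_weaklyConvergesTo {Z : ℕ → Ω → E} (h : WeaklyConvergesTo μ Z L)
    (φ : BoundedContinuousFunction E ℝ) : UpperBound μ Z L φ := by
  intro ε hε
  filter_upwards [(h φ).eventually (gt_mem_nhds (lt_add_of_pos_right _ hε))] with n hn
  have hne : {r : ℝ | ∃ g : Ω → ℝ, Measurable g ∧ Integrable g μ ∧
      (∀ ω, φ (Z n ω) ≤ g ω) ∧ r = ∫ ω, g ω ∂μ}.Nonempty :=
    ⟨_, fun _ => ‖φ‖, measurable_const, integrable_const _,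
      fun ω => le_of_abs_le (bcf_abs_le φ _), rfl⟩
  obtain ⟨r, ⟨g, hg, hgi, hle, rfl⟩, hlt⟩ := exists_lt_of_csInf_lt hne hn
  exact ⟨g, hg, hgi, hle, hlt.le⟩

/-- Outer-probability Slutsky lemma: a uniformly small perturbation keeps the weak limit. -/
lemma UpperBound.perturb {Z Z' : ℕ → Ω → E} {φ : BoundedContinuousFunction E ℝ} {K : ℝ≥0}
    (hφ : LipschitzWith K φ) (h : UpperBound μ Z L φ)
    (hd : ∀ ε : ℝ, 0 < ε → ∀ᶠ n in atTop, μ {ω | ε < dist (Z' n ω) (Z n ω)} ≤ ENNReal.ofReal ε) :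
    UpperBound μ Z' L φ := by
  intro ε hε
  -- The perturbation costs `K δ` off the exceptional set and `2 ‖φ‖ δ` on it; together at most `ε /
  -- 2`.
  set δ : ℝ := ε / (2 * (K + 2 * ‖φ‖ + 1)) with hδ
  have hpos : (0 : ℝ) < K + 2 * ‖φ‖ + 1 := by positivity
  have hδpos : 0 < δ := by positivity
  filter_upwards [h (ε / 2) (half_pos hε), hd δ hδpos] with n hn hdn
  obtain ⟨g, hg, hgi, hle, hint⟩ := hn
  -- The exceptional set need not be measurable; its measurable hull has the same outer measure.
  set B := toMeasurable μ {ω | δ < dist (Z' n ω) (Z n ω)} with hB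
  have hBm : MeasurableSet B := measurableSet_toMeasurable _ _
  have hBμ : μ.real B ≤ δ := by
    rw [measureReal_def, hB, measure_toMeasurable]
    exact ENNReal.toReal_le_of_le_ofReal hδpos.le hdn
  refine ⟨fun ω => g ω + K * δ + B.indicator (fun _ => 2 * ‖φ‖) ω, ?_, ?_, ?_, ?_⟩
  · exact (hg.add_const _).add (measurable_const.indicator hBm)
  · exact (hgi.add (integrable_const _)).add ((integrable_const _).indicator hBm)
  · intro ω
    beta_reduce
    by_cases hω : ω ∈ B
    · rw [Set.indicator_of_mem hω]
      have h1 := le_of_abs_le (bcf_abs_le φ (Z' n ω))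
      have h2 := neg_le_of_abs_le (bcf_abs_le φ (Z n ω))
      have h3 := hle ω
      have h4 : 0 ≤ (K : ℝ) * δ := by positivity
      linarith
    · rw [Set.indicator_of_notMem hω]
      have h1 : dist (Z' n ω) (Z n ω) ≤ δ := by
        by_contra hcon
        exact hω (subset_toMeasurable _ _ (not_le.1 hcon))
      have h2 := hφ.dist_le_mul (Z' n ω) (Z n ω)
      rw [Real.dist_eq] at h2
      have h3 := le_of_abs_le h2
      have h4 : (K : ℝ) * dist (Z' n ω) (Z n ω) ≤ K * δ := by gcongr
      have h5 := hle ω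
      linarith
  · have e1 : ∫ ω, (g ω + K * δ + B.indicator (fun _ => 2 * ‖φ‖) ω) ∂μ =
        (∫ ω, (g ω + K * δ) ∂μ) + ∫ ω, B.indicator (fun _ => 2 * ‖φ‖) ω ∂μ :=
      integral_add (hgi.add (integrable_const _)) ((integrable_const _).indicator hBm)
    rw [e1, integral_add hgi (integrable_const _), integral_indicator_const _ hBm]
    simp only [integral_const, probReal_univ, smul_eq_mul, one_mul]
    have h1 : μ.real B * (2 * ‖φ‖) ≤ δ * (2 * ‖φ‖) := by gcongr
    have h2 : δ * (K + 2 * ‖φ‖ + 1) = ε / 2 := by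
      rw [hδ]; field_simp
    nlinarith [hδpos]

lemma WeaklyConvergesTo.perturb {Z Z' : ℕ → Ω → E} (h : WeaklyConvergesTo μ Z L)
    (hd : ∀ ε : ℝ, 0 < ε → ∀ᶠ n in atTop, μ {ω | ε < dist (Z' n ω) (Z n ω)} ≤ ENNReal.ofReal ε) :
    WeaklyConvergesTo μ Z' L :=
  weaklyConvergesTo_of_upperBound <| upperBound_of_lipschitz fun φ _ hK =>
    (upperBound_of_weaklyConvergesTo h φ).perturb hK hd

end WeakConvergence

lemma WeaklyConvergesTo.map {Ω E F : Type*} [MeasurableSpace Ω] {μ : Measure Ω}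
    [TopologicalSpace E] [MeasurableSpace E] [BorelSpace E] [TopologicalSpace F]
    [MeasurableSpace F] [BorelSpace F] {Z : ℕ → Ω → E} {L : Measure E}
    (h : WeaklyConvergesTo μ Z L) {f : E → F} (hf : Continuous f) :
    WeaklyConvergesTo μ (fun n ω => f (Z n ω)) (L.map f) := by
  intro φ
  have h1 := h (φ.compContinuous ⟨f, hf⟩)
  have h2 : ∫ z, φ z ∂(L.map f) = ∫ z, φ (f z) ∂L :=
    integral_map_of_stronglyMeasurable hf.measurable φ.continuous.stronglyMeasurable
  rw [h2]
  exact h1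

/-- A supremum exceeds a level only if one of its terms does, so the event for the supremum lies in
the event for a single index. -/
lemma supLittleOP_of_eventually {Ω Γ : Type*} [MeasurableSpace Ω] {μ : Measure Ω}
    {D : ℕ → Ω → Γ → ℝ} {r : ℕ → ℝ}
    (h : ∀ ε : ℝ, 0 < ε → ∀ η : ℝ, 0 < η →
      ∀ᶠ n in atTop, μ {ω | ∃ γ, ε * r n < |D n ω γ|} ≤ ENNReal.ofReal η) :
    SupLittleOP μ D r := by
  intro ε hε
  rw [ENNReal.tendsto_atTop_zero]
  intro η hη
  obtain ⟨η', hη', hle⟩ : ∃ η' : ℝ, 0 < η' ∧ ENNReal.ofReal η' ≤ η := by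
    rcases eq_or_ne η ∞ with rfl | hne
    · exact ⟨1, one_pos, le_top⟩
    · exact ⟨η.toReal, ENNReal.toReal_pos hη.ne' hne, by rw [ENNReal.ofReal_toReal hne]⟩
  obtain ⟨N, hN⟩ := eventually_atTop.1 (h ε hε η' hη')
  refine ⟨N, fun n hn => (measure_mono ?_).trans ((hN n hn).trans hle)⟩
  intro ω hω
  obtain ⟨γ, hγ⟩ := lt_iSup_iff.1 (show ENNReal.ofReal (ε * r n) < ⨆ γ, ‖D n ω γ‖ₑ from hω)
  refine ⟨γ, ?_⟩
  rw [Real.enorm_eq_ofReal_abs] at hγ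
  by_contra hcon
  exact absurd hγ (not_lt.2 (ENNReal.ofReal_le_ofReal (not_lt.1 hcon)))

/-! ### Linear maps and compact sets in `ℓ^∞` -/

section EllInftyTools

variable {T : Type*}

/-- A bounded function as an element of `ℓ^∞(T)`. -/
def mkEll (g : T → ℝ) (C : ℝ) (h : ∀ t, |g t| ≤ C) : EllInfty T :=
  ⟨g, memℓp_infty ⟨C, by rintro _ ⟨t, rfl⟩; exact h t⟩⟩

@[simp] lemma mkEll_apply (g : T → ℝ) (C : ℝ) (h : ∀ t, |g t| ≤ C) (t : T) :
    mkEll g C h t = g t := rfl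

lemma ell_abs_le (z : EllInfty T) (t : T) : |z t| ≤ ‖z‖ :=
  lp.norm_apply_le_norm ENNReal.top_ne_zero z t

lemma ell_norm_le {z : EllInfty T} {C : ℝ} (hC : 0 ≤ C) (h : ∀ t, |z t| ≤ C) : ‖z‖ ≤ C :=
  lp.norm_le_of_forall_le hC h

lemma ell_dist_le {z w : EllInfty T} {C : ℝ} (hC : 0 ≤ C) (h : ∀ t, |z t - w t| ≤ C) :
    dist z w ≤ C := by
  rw [dist_eq_norm]
  exact ell_norm_le hC h

lemma ell_continuous_eval (t : T) : Continuous fun z : EllInfty T => (z t : ℝ) := by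
  refine (LipschitzWith.of_dist_le_mul (K := 1) fun z w => ?_).continuous
  rw [NNReal.coe_one, one_mul, dist_eq_norm, dist_eq_norm]
  exact lp.norm_apply_le_norm ENNReal.top_ne_zero (z - w) t

lemma ell_measurable_eval (t : T) : Measurable fun z : EllInfty T => (z t : ℝ) :=
  (ell_continuous_eval t).measurable

/-- The bounded linear map of `ℓ^∞` spaces given by combinations of coordinates. -/
def ellComb {Γ ι : Type*} [Fintype ι] (σ : ι → Γ → T) (c : ι → Γ → ℝ) (C : ℝ)
    (hc : ∀ i γ, |c i γ| ≤ C) : EllInfty T →L[ℝ] EllInfty Γ :=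
  have key : ∀ (z : EllInfty T) (γ : Γ),
      |∑ i, c i γ * z (σ i γ)| ≤ (Fintype.card ι * C) * ‖z‖ := fun z γ => by
    calc |∑ i, c i γ * z (σ i γ)| ≤ ∑ i, |c i γ * z (σ i γ)| := Finset.abs_sum_le_sum_abs _ _
      _ ≤ ∑ _i : ι, C * ‖z‖ := by
          refine Finset.sum_le_sum fun i _ => ?_
          rw [abs_mul]
          exact mul_le_mul (hc i γ) (ell_abs_le z _) (abs_nonneg _)
            ((abs_nonneg _).trans (hc i γ))
      _ = (Fintype.card ι * C) * ‖z‖ := by simp [mul_assoc]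
  LinearMap.mkContinuousOfExistsBound
    { toFun := fun z => mkEll (fun γ => ∑ i, c i γ * z (σ i γ)) _ (key z)
      map_add' := fun z w => by
        ext γ
        simp only [mkEll_apply, lp.coeFn_add, Pi.add_apply, mul_add, Finset.sum_add_distrib]
      map_smul' := fun r z => by
        ext γ
        simp only [mkEll_apply, lp.coeFn_smul, Pi.smul_apply, smul_eq_mul, RingHom.id_apply,
          Finset.mul_sum]
        exact Finset.sum_congr rfl fun i _ => by ring }
    ⟨max (Fintype.card ι * C) 0, fun z => ell_norm_le (by positivity) fun γ =>
      (key z γ).trans (mul_le_mul_of_nonneg_right (le_max_left _ _) (norm_nonneg _))⟩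

lemma ellComb_apply {Γ ι : Type*} [Fintype ι] (σ : ι → Γ → T) (c : ι → Γ → ℝ) (C : ℝ)
    (hc : ∀ i γ, |c i γ| ≤ C) (z : EllInfty T) (γ : Γ) :
    ellComb σ c C hc z γ = ∑ i, c i γ * z (σ i γ) := rfl

/-- The step function with values `x` along `f : T → I`, `I` finite. -/
def ellStep (I : Finset T) (f : T → I) : (I → ℝ) →L[ℝ] EllInfty T :=
  LinearMap.mkContinuous
    { toFun := fun x => mkEll (fun t => x (f t)) ‖x‖ fun t => norm_le_pi_norm x (f t)
      map_add' := fun x y => by ext; rfl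
      map_smul' := fun r x => by ext; rfl } 1 fun x => by
    rw [one_mul]
    exact ell_norm_le (norm_nonneg _) fun t => norm_le_pi_norm x (f t)

/-- The functions whose oscillation over the cells of `κ` is at most `δ`. -/
def oscSet {ι : Type*} (κ : T → ι) (δ : ℝ) : Set (EllInfty T) :=
  {z | ∀ s t, κ s = κ t → |z s - z t| ≤ δ}

lemma isClosed_oscSet {ι : Type*} (κ : T → ι) (δ : ℝ) : IsClosed (oscSet κ δ) := by
  simp only [oscSet, Set.ofPred_forall]
  refine isClosed_iInter fun s => isClosed_iInter fun t => isClosed_iInter fun _ => ?_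
  exact isClosed_le ((ell_continuous_eval s).sub (ell_continuous_eval t)).abs continuous_const

/-- Equibounded functions with small oscillations over finite partitions form a compact set. -/
lemma isCompact_osc {ι : Type*} (κ : ℕ → T → ι) (hfin : ∀ i, (Set.range (κ i)).Finite) (a : ℕ)
    (R : ℝ) :
    IsCompact {z : EllInfty T | (∀ t, |z t| ≤ R) ∧ ∀ i, a ≤ i → z ∈ oscSet (κ i) ((1 / 2) ^ i)} := by
  rcases isEmpty_or_nonempty T with hT | hT
  · have : Subsingleton (EllInfty T) := ⟨fun z w => by ext t; exact hT.elim t⟩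
    exact Set.Subsingleton.isCompact (Set.subsingleton_of_subsingleton)
  refine TotallyBounded.isCompact_of_isClosed ?_ ?_
  · rw [Metric.totallyBounded_iff]
    intro ε hε
    obtain ⟨i0, hi0⟩ := exists_pow_lt_of_lt_one (half_pos hε) (by norm_num : (1 / 2 : ℝ) < 1)
    set i := max a i0
    have hi : (1 / 2 : ℝ) ^ i < ε / 2 :=
      (pow_le_pow_of_le_one (by norm_num) (by norm_num) (le_max_right a i0)).trans_lt hi0
    -- Freezing a function at the cell representatives moves it by at most `(1/2)^i < ε / 2` and
    -- puts it in the image of a finite-dimensional cube, which is compact.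
    let ρ : T → T := fun t => Function.invFun (κ i) (κ i t)
    have hρ : ∀ t, κ i (ρ t) = κ i t := fun t => Function.invFun_eq ⟨t, rfl⟩
    have hρfin : (Set.range ρ).Finite := by
      refine ((hfin i).image (Function.invFun (κ i))).subset ?_
      rintro _ ⟨t, rfl⟩
      exact ⟨κ i t, ⟨t, rfl⟩, rfl⟩
    let f : T → hρfin.toFinset := fun t => ⟨ρ t, by simp⟩
    have hc : IsCompact (ellStep hρfin.toFinset f '' Set.Icc (fun _ => -R) (fun _ => R)) :=
      isCompact_Icc.image (ellStep _ f).continuous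
    obtain ⟨F, hF, hcov⟩ := Metric.totallyBounded_iff.1 hc.totallyBounded (ε / 2) (half_pos hε)
    refine ⟨F, hF, fun z hz => ?_⟩
    have hmem : ellStep hρfin.toFinset f (fun r => z r) ∈
        ellStep hρfin.toFinset f '' Set.Icc (fun _ => -R) (fun _ => R) :=
      ⟨_, ⟨fun r => (abs_le.1 (hz.1 _)).1, fun r => (abs_le.1 (hz.1 _)).2⟩, rfl⟩
    obtain ⟨y, hy, hyd⟩ := Set.mem_iUnion₂.1 (hcov hmem)
    refine Set.mem_iUnion₂.2 ⟨y, hy, ?_⟩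
    have h1 : dist z (ellStep hρfin.toFinset f (fun r => z r)) ≤ (1 / 2) ^ i :=
      ell_dist_le (by positivity) fun t => hz.2 i (le_max_left _ _) t (ρ t) (hρ t).symm
    have h2 := Metric.mem_ball.1 hyd
    rw [Metric.mem_ball]
    linarith [dist_triangle z (ellStep hρfin.toFinset f (fun r => z r)) y]
  · simp only [Set.ofPred_and, Set.ofPred_forall]
    refine IsClosed.inter ?_ ?_
    · exact isClosed_iInter fun t =>
        isClosed_le (ell_continuous_eval t).abs continuous_const
    · exact isClosed_iInter fun i => isClosed_iInter fun _ => isClosed_oscSet _ _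

end EllInftyTools

/-! ### Gaussian laws from characteristic functions -/

section Gaussian

variable {T : Type*}

/-- The quadratic form of the covariance function `K`. -/
def quadForm (K : T → T → ℝ) (I : Finset T) (a : T → ℝ) : ℝ :=
  ∑ s ∈ I, ∑ t ∈ I, a s * a t * K s t

lemma quadForm_smul (K : T → T → ℝ) (I : Finset T) (a : T → ℝ) (r : ℝ) :
    quadForm K I (fun t => r * a t) = r ^ 2 * quadForm K I a := by
  simp only [quadForm, Finset.mul_sum]
  exact Finset.sum_congr rfl fun s _ => Finset.sum_congr rfl fun t _ => by ring

variable {L : Measure (EllInfty T)} [IsProbabilityMeasure L] {K : T → T → ℝ}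

lemma ell_measurable_sum (I : Finset T) (a : T → ℝ) :
    Measurable fun z : EllInfty T => ∑ t ∈ I, a t * z t :=
  Finset.measurable_fun_sum _ fun t _ => (ell_measurable_eval t).const_mul _

/-- Replacing `a` by `r • a` in the hypothesis gives the characteristic function of the combination
at every `r`. The quadratic form is nonnegative since a characteristic function has modulus at most
one. -/
lemma map_sum_eq_gaussianReal
    (hchar : ∀ (I : Finset T) (a : T → ℝ),
      ∫ z : EllInfty T, Complex.exp (((∑ t ∈ I, a t * z t : ℝ) : ℂ) * Complex.I) ∂L =
        ((Real.exp (-(quadForm K I a / 2)) : ℝ) : ℂ))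
    (I : Finset T) (a : T → ℝ) :
    0 ≤ quadForm K I a ∧
      L.map (fun z => ∑ t ∈ I, a t * z t) = gaussianReal 0 (quadForm K I a).toNNReal := by
  have hnn : 0 ≤ quadForm K I a := by
    have h1 : ‖∫ z : EllInfty T, Complex.exp (((∑ t ∈ I, a t * z t : ℝ) : ℂ) * Complex.I) ∂L‖
        ≤ 1 := by
      refine (norm_integral_le_of_norm_le_const (C := 1) ?_).trans (by simp)
      exact Eventually.of_forall fun z => by rw [Complex.norm_exp_ofReal_mul_I]
    rw [hchar, Complex.norm_real, Real.norm_eq_abs, Real.abs_exp, Real.exp_le_one_iff] at h1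
    linarith
  refine ⟨hnn, ?_⟩
  have : IsProbabilityMeasure (L.map (fun z => ∑ t ∈ I, a t * z t)) :=
    Measure.isProbabilityMeasure_map (ell_measurable_sum I a).aemeasurable
  refine Measure.ext_of_charFun ?_
  ext r
  rw [charFun_gaussianReal, charFun_apply_real,
    integral_map (ell_measurable_sum I a).aemeasurable (by fun_prop)]
  have h2 := hchar I (fun t => r * a t)
  rw [quadForm_smul] at h2
  have h3 : ∀ z : EllInfty T, ((∑ t ∈ I, r * a t * z t : ℝ) : ℂ) * Complex.I =
      (r : ℂ) * ((∑ t ∈ I, a t * z t : ℝ) : ℂ) * Complex.I := fun z => by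
    rw [← Complex.ofReal_mul, Finset.mul_sum]
    simp only [mul_assoc]
  simp only [h3] at h2
  rw [h2, Complex.ofReal_exp, Real.coe_toNNReal _ hnn]
  congr 1
  push_cast
  ring

/-- Linear forms determine Gaussianity of the finite marginals; variances of one-point combinations
give the diagonal of the covariance, and those of two-point combinations the rest by polarization.
-/
lemma isTightGaussianLaw_of_charFun (hK : ∀ s t, K s t = K t s)
    (htight : IsTightMeasureSet {L})
    (hchar : ∀ (I : Finset T) (a : T → ℝ),
      ∫ z : EllInfty T, Complex.exp (((∑ t ∈ I, a t * z t : ℝ) : ℂ) * Complex.I) ∂L =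
        ((Real.exp (-(quadForm K I a / 2)) : ℝ) : ℂ)) :
    IsTightGaussianLaw L K := by
  classical
  have hmap := map_sum_eq_gaussianReal hchar
  have hproc : IsGaussianProcess (fun (t : T) (z : EllInfty T) => (z t : ℝ)) L := by
    refine ⟨fun I => ⟨?_⟩⟩
    have hm : Measurable fun z : EllInfty T => I.restrict (fun t => (z t : ℝ)) :=
      measurable_pi_lambda _ fun t => ell_measurable_eval t.1
    refine isGaussian_of_map_eq_gaussianReal fun l => ?_
    -- The coefficients of the linear form `l` in the standard basis, extended by zero outside `I`.
    let a : T → ℝ := fun t => if h : t ∈ I then l (Pi.single ⟨t, h⟩ 1) else 0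
    refine ⟨0, (quadForm K I a).toNNReal, ?_⟩
    rw [Measure.map_map l.continuous.measurable hm, ← (hmap I a).2]
    congr 1
    ext z
    simp only [Function.comp_apply]
    rw [← Finset.sum_coe_sort I (fun t => a t * z t)]
    conv_lhs => rw [pi_eq_sum_univ' (I.restrict (fun t => (z t : ℝ)))]
    rw [map_sum]
    refine Finset.sum_congr rfl fun t _ => ?_
    rw [map_smul, smul_eq_mul, mul_comm]
    simp only [a, t.2, dif_pos, Finset.restrict]
  have hL2 : ∀ t, MemLp (fun z : EllInfty T => (z t : ℝ)) 2 L := fun t =>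
    (hproc.hasGaussianLaw_eval t).memLp_two
  have hmean : ∀ t, ∫ z : EllInfty T, (z t : ℝ) ∂L = 0 := fun t => by
    have h := (hmap {t} (fun _ => 1)).2
    simp only [Finset.sum_singleton, one_mul] at h
    have h2 : ∫ x, x ∂(L.map fun z : EllInfty T => (z t : ℝ)) = ∫ z : EllInfty T, (z t : ℝ) ∂L :=
      integral_map (ell_measurable_eval t).aemeasurable (by fun_prop)
    rw [← h2, h, integral_id_gaussianReal]
  have hvar : ∀ I a, Var[fun z : EllInfty T => ∑ t ∈ I, a t * z t; L] = quadForm K I a :=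
    fun I a => by
    have h := variance_map (X := id) (Y := fun z : EllInfty T => ∑ t ∈ I, a t * z t) (μ := L)
      (by fun_prop) (ell_measurable_sum I a).aemeasurable
    rw [(hmap I a).2, variance_id_gaussianReal, Real.coe_toNNReal _ (hmap I a).1] at h
    exact h.symm
  have hvar1 : ∀ t, Var[fun z : EllInfty T => (z t : ℝ); L] = K t t := fun t => by
    have h := hvar {t} (fun _ => 1)
    simpa [quadForm] using h
  refine ⟨inferInstance, htight, hproc, hmean, fun s t => ?_⟩
  by_cases hst : s = t
  · subst hst
    rw [covariance_self (ell_measurable_eval s).aemeasurable, hvar1]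
  -- Polarization: the variance of `z s + z t` isolates the covariance, the symmetry of `K` merging
  -- the two mixed terms.
  · have h := hvar {s, t} (fun _ => 1)
    simp only [quadForm, Finset.sum_pair hst, one_mul] at h
    have h2 := variance_add (hL2 s) (hL2 t)
    have h3 : (fun z : EllInfty T => (z s : ℝ) + z t) =
        (fun z : EllInfty T => (z s : ℝ)) + fun z : EllInfty T => (z t : ℝ) := rfl
    rw [h3, h2, hvar1, hvar1, hK t s] at h
    linarith

end Gaussian

/-! ### Discretization along finite partitions -/

section CellProjection

variable {T ι : Type*} [Nonempty T]

/-- A representative of the cell of `t` in the partition of `T` into the fibres of `κ`. -/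
def cellRep (κ : T → ι) (t : T) : T := Function.invFun κ (κ t)

lemma cellRep_spec (κ : T → ι) (t : T) : κ (cellRep κ t) = κ t := Function.invFun_eq ⟨t, rfl⟩

lemma cellRep_eq {κ : T → ι} {s t : T} (h : κ s = κ t) : cellRep κ s = cellRep κ t := by
  simp only [cellRep, h]

lemma finite_range_cellRep {κ : T → ι} (hfin : (Set.range κ).Finite) :
    (Set.range (cellRep κ)).Finite := by
  refine (hfin.image (Function.invFun κ)).subset ?_
  rintro _ ⟨t, rfl⟩
  exact ⟨κ t, ⟨t, rfl⟩, rfl⟩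

/-- The finitely many cell representatives. -/
def cellReps {κ : T → ι} (hfin : (Set.range κ).Finite) : Finset T :=
  (finite_range_cellRep hfin).toFinset

lemma cellRep_mem {κ : T → ι} (hfin : (Set.range κ).Finite) (t : T) :
    cellRep κ t ∈ cellReps hfin := by simp [cellReps]

/-- The step function on `I → ℝ` along the cells, `I` the set of representatives. -/
def cellStep {κ : T → ι} (hfin : (Set.range κ).Finite) :
    (cellReps hfin → ℝ) →L[ℝ] EllInfty T :=
  ellStep (cellReps hfin) fun t => ⟨cellRep κ t, cellRep_mem hfin t⟩

/-- The step function with the values of `z` at the cell representatives. -/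
def cellProj {κ : T → ι} (hfin : (Set.range κ).Finite) (z : EllInfty T) : EllInfty T :=
  cellStep hfin fun r => z r

@[simp] lemma cellProj_apply {κ : T → ι} (hfin : (Set.range κ).Finite) (z : EllInfty T) (t : T) :
    cellProj hfin z t = z (cellRep κ t) := rfl

/-- The discretization factors through a finite-dimensional space. It is therefore Borel in the
supremum norm, although `Z` is only assumed measurable coordinate by coordinate. -/
lemma measurable_cellProj {Ω : Type*} [MeasurableSpace Ω] {κ : T → ι}
    (hfin : (Set.range κ).Finite) {Z : Ω → EllInfty T}
    (hZ : ∀ t, Measurable fun ω => (Z ω t : ℝ)) : Measurable fun ω => cellProj hfin (Z ω) :=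
  (cellStep hfin).continuous.measurable.comp (measurable_pi_lambda _ fun r => hZ r)

lemma dist_cellProj_le {κ : T → ι} (hfin : (Set.range κ).Finite) {z : EllInfty T} {δ : ℝ}
    (hδ : 0 ≤ δ) (hz : z ∈ oscSet κ δ) : dist z (cellProj hfin z) ≤ δ :=
  ell_dist_le hδ fun t => hz t _ (cellRep_spec κ t).symm

end CellProjection

lemma norm_cexp_sub_le (x y : ℝ) :
    ‖Complex.exp ((x : ℂ) * Complex.I) - Complex.exp ((y : ℂ) * Complex.I)‖ ≤ |x - y| := by
  have h : Complex.exp ((x : ℂ) * Complex.I) - Complex.exp ((y : ℂ) * Complex.I) =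
      Complex.exp ((y : ℂ) * Complex.I) *
        (Complex.exp (Complex.I * ((x - y : ℝ) : ℂ)) - 1) := by
    rw [mul_sub, ← Complex.exp_add, mul_one]
    congr 2
    push_cast
    ring
  rw [h, norm_mul, Complex.norm_exp_ofReal_mul_I, one_mul]
  exact Real.norm_exp_I_mul_ofReal_sub_one_le

lemma norm_integral_cexp_sub_le {Ω : Type*} [MeasurableSpace Ω] {μ : Measure Ω}
    [IsProbabilityMeasure μ] {X Y : Ω → ℝ} (hX : Measurable X) (hY : Measurable Y) {B : Set Ω}
    (hB : MeasurableSet B) {δ : ℝ} (hδ : 0 ≤ δ) (h : ∀ ω, ω ∉ B → |X ω - Y ω| ≤ δ) :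
    ‖(∫ ω, Complex.exp ((X ω : ℂ) * Complex.I) ∂μ) - ∫ ω, Complex.exp ((Y ω : ℂ) * Complex.I) ∂μ‖
      ≤ δ + 2 * μ.real B := by
  have hi : ∀ {W : Ω → ℝ}, Measurable W →
      Integrable (fun ω => Complex.exp ((W ω : ℂ) * Complex.I)) μ := fun {W} hW => by
    refine Integrable.of_bound (C := 1) (by fun_prop) (Eventually.of_forall fun ω => ?_)
    rw [Complex.norm_exp_ofReal_mul_I]
  rw [← integral_sub (hi hX) (hi hY)]
  have hg : Integrable (fun ω => δ + B.indicator (fun _ => (2 : ℝ)) ω) μ :=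
    (integrable_const _).add ((integrable_const _).indicator hB)
  refine (norm_integral_le_of_norm_le hg (Eventually.of_forall fun ω => ?_)).trans ?_
  · by_cases hω : ω ∈ B
    · rw [Set.indicator_of_mem hω]
      refine (norm_sub_le _ _).trans ?_
      rw [Complex.norm_exp_ofReal_mul_I, Complex.norm_exp_ofReal_mul_I]
      linarith
    · rw [Set.indicator_of_notMem hω, add_zero]
      exact (norm_cexp_sub_le _ _).trans (h ω hω)
  · rw [integral_add (integrable_const _) ((integrable_const _).indicator hB),
      integral_indicator_const _ hB]
    simp [mul_comm]

/-! ### Convergence of finite marginals -/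

section FiniteMarginals

variable {T Ω : Type*} [MeasurableSpace Ω] {μ : Measure Ω} [IsProbabilityMeasure μ]

/-- Convergence of characteristic functions gives convergence of finite marginals. -/
lemma tendsto_integral_marginal {Z : ℕ → Ω → EllInfty T} {L : Measure (EllInfty T)}
    [IsProbabilityMeasure L] (hmeas : ∀ n t, Measurable fun ω => (Z n ω t : ℝ))
    (I : Finset T)
    (hchar : ∀ a : T → ℝ, Tendsto
      (fun n => ∫ ω, Complex.exp (((∑ t ∈ I, a t * Z n ω t : ℝ) : ℂ) * Complex.I) ∂μ) atTop
      (𝓝 (∫ z : EllInfty T, Complex.exp (((∑ t ∈ I, a t * z t : ℝ) : ℂ) * Complex.I) ∂L)))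
    (ψ : BoundedContinuousFunction (I → ℝ) ℝ) :
    Tendsto (fun n => ∫ ω, ψ (fun t => Z n ω t) ∂μ) atTop
      (𝓝 (∫ z : EllInfty T, ψ (fun t => z t) ∂L)) := by
  classical
  -- Lévy's continuity theorem is applied in an inner product space, hence the detour through the
  -- Euclidean norm.
  let e : (I → ℝ) → EuclideanSpace ℝ I := WithLp.toLp 2
  have he : Continuous e := PiLp.continuous_toLp 2 _
  have hm : ∀ n, Measurable fun ω => e (fun t => Z n ω t) := fun n =>
    he.measurable.comp (measurable_pi_lambda _ fun t => hmeas n t)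
  have hmL : Measurable fun z : EllInfty T => e (fun t => z t) :=
    he.measurable.comp (measurable_pi_lambda _ fun t => ell_measurable_eval t.1)
  let ν : ℕ → ProbabilityMeasure (EuclideanSpace ℝ I) := fun n =>
    ⟨μ.map fun ω => e (fun t => Z n ω t), Measure.isProbabilityMeasure_map (hm n).aemeasurable⟩
  let ν0 : ProbabilityMeasure (EuclideanSpace ℝ I) :=
    ⟨L.map fun z : EllInfty T => e (fun t => z t),
      Measure.isProbabilityMeasure_map hmL.aemeasurable⟩
  have hinner : ∀ (x : I → ℝ) (b : EuclideanSpace ℝ I),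
      (inner ℝ (e x) b : ℝ) = ∑ t : I, b t * x t := fun x b => by
    simp [e, PiLp.inner_apply]
  have hconv : Tendsto ν atTop (𝓝 ν0) := by
    rw [ProbabilityMeasure.tendsto_iff_tendsto_charFun]
    intro b
    have h := hchar fun t => if ht : t ∈ I then b ⟨t, ht⟩ else 0
    have hs : ∀ x : T → ℝ, ∑ t ∈ I, (if ht : t ∈ I then b ⟨t, ht⟩ else 0) * x t =
        ∑ t : I, b t * x t := fun x => by
      rw [← Finset.sum_coe_sort I]
      refine Finset.sum_congr rfl fun t _ => ?_
      simp [t.2]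
    simp only [hs] at h
    simp only [charFun_apply, ν, ν0, ProbabilityMeasure.coe_mk]
    have e1 : ∀ n, ∫ x, Complex.exp (((inner ℝ x b : ℝ) : ℂ) * Complex.I)
        ∂(μ.map fun ω => e (fun t => Z n ω t)) =
        ∫ ω, Complex.exp (((∑ t : I, b t * Z n ω t : ℝ) : ℂ) * Complex.I) ∂μ := fun n => by
      rw [integral_map (hm n).aemeasurable (by fun_prop)]
      simp only [hinner]
    have e2 : ∫ x, Complex.exp (((inner ℝ x b : ℝ) : ℂ) * Complex.I)
        ∂(L.map fun z : EllInfty T => e (fun t => z t)) =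
        ∫ z : EllInfty T, Complex.exp (((∑ t : I, b t * z t : ℝ) : ℂ) * Complex.I) ∂L := by
      rw [integral_map hmL.aemeasurable (by fun_prop)]
      simp only [hinner]
    simp only [e1, e2]
    exact h
  have hc : Continuous (WithLp.ofLp : EuclideanSpace ℝ I → I → ℝ) := PiLp.continuous_ofLp 2 _
  have h := (ProbabilityMeasure.tendsto_iff_forall_integral_tendsto.1 hconv)
    (ψ.compContinuous ⟨_, hc⟩)
  have e1 : ∀ n, ∫ x, (ψ.compContinuous ⟨_, hc⟩) x ∂(ν n : Measure (EuclideanSpace ℝ I)) =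
      ∫ ω, ψ (fun t => Z n ω t) ∂μ := fun n => by
    simp only [ν, ProbabilityMeasure.coe_mk]
    rw [integral_map (hm n).aemeasurable
      (BoundedContinuousFunction.continuous _).aestronglyMeasurable]
    rfl
  have e2 : ∫ x, (ψ.compContinuous ⟨_, hc⟩) x ∂(ν0 : Measure (EuclideanSpace ℝ I)) =
      ∫ z : EllInfty T, ψ (fun t => z t) ∂L := by
    simp only [ν0, ProbabilityMeasure.coe_mk]
    rw [integral_map hmL.aemeasurable
      (BoundedContinuousFunction.continuous _).aestronglyMeasurable]
    rfl
  simpa only [e1, e2] using h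

end FiniteMarginals

/-! ### Existence and identification of the tight Gaussian limit -/

section TightLimit

variable {T Ω ι : Type*} [Nonempty T] [MeasurableSpace Ω] {μ : Measure Ω} [IsProbabilityMeasure μ]
  {Z : ℕ → Ω → EllInfty T} {K : T → T → ℝ} {κ : ℕ → T → ι} {N : ℕ → ℕ}

/-- The compact sets carrying the discretized laws. -/
lemma exists_cellProj_compact (hfin : ∀ i, (Set.range (κ i)).Finite)
    (hnest : ∀ i j, i ≤ j → ∀ s t, κ j s = κ j t → κ i s = κ i t) {C : ℝ} (hC : 0 ≤ C)
    (htail : ∀ n t (R : ℝ), 0 < R → μ {ω | R < |Z n ω t|} ≤ ENNReal.ofReal (C / R ^ 2))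
    (hN : Monotone N)
    (hosc : ∀ i n, N i ≤ n →
      μ {ω | Z n ω ∉ oscSet (κ i) ((1 / 2) ^ i)} ≤ ENNReal.ofReal ((1 / 2) ^ i)) (a : ℕ) :
    ∃ R : ℝ, ∀ j, μ {ω | cellProj (hfin j) (Z (N j) ω) ∉ {z : EllInfty T | (∀ t, |z t| ≤ R) ∧
        ∀ i, a ≤ i → z ∈ oscSet (κ i) ((1 / 2) ^ i)}} ≤ ENNReal.ofReal (3 * (1 / 2) ^ a) := by
  classical
  -- Finitely many points control the size of every discretization. For `j ≤ a` its values are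
  -- values at points of `G`; for `j > a` the oscillation bound at level `a` leads to a point of `G`
  -- at a cost of at most `1`, whence the radius `R + 1`.
  let G : Finset T := (Finset.range (a + 1)).biUnion fun l => cellReps (hfin l)
  set e : ℝ := (1 / 2) ^ a with he
  have hepos : 0 < e := by positivity
  obtain ⟨R, hRpos, hR⟩ : ∃ R : ℝ, 0 < R ∧ G.card * (C / R ^ 2) ≤ e := by
    refine ⟨√(G.card * C / e) + 1, by positivity, ?_⟩
    have h1 : G.card * C / e ≤ (√(G.card * C / e) + 1) ^ 2 := by
      have h2 := Real.sq_sqrt (show 0 ≤ G.card * C / e by positivity)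
      nlinarith [Real.sqrt_nonneg (G.card * C / e)]
    rw [← mul_div_assoc, div_le_iff₀ (by positivity)]
    rwa [div_le_iff₀ hepos, mul_comm _ e] at h1
  refine ⟨R + 1, fun j => ?_⟩
  have hsub : {ω | cellProj (hfin j) (Z (N j) ω) ∉ {z : EllInfty T | (∀ t, |z t| ≤ R + 1) ∧
        ∀ i, a ≤ i → z ∈ oscSet (κ i) ((1 / 2) ^ i)}} ⊆
      (⋃ i ∈ Finset.Ico a (j + 1), {ω | Z (N j) ω ∉ oscSet (κ i) ((1 / 2) ^ i)}) ∪
        ⋃ r ∈ G, {ω | R < |Z (N j) ω r|} := by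
    intro ω hω
    by_contra hcon
    simp only [Set.mem_union, Set.mem_iUnion, Set.mem_ofPred_eq, not_or, not_exists, not_not,
      Finset.mem_Ico, not_lt] at hcon
    obtain ⟨h1, h2⟩ := hcon
    refine hω ⟨fun t => ?_, fun i hi s t hst => ?_⟩
    · rw [cellProj_apply]
      rcases le_or_gt j a with hja | hja
      · have : cellRep (κ j) t ∈ G :=
          Finset.mem_biUnion.2 ⟨j, Finset.mem_range.2 (by omega), cellRep_mem _ _⟩
        linarith [h2 _ this]
      · have h3 := h1 a ⟨le_rfl, by omega⟩ (cellRep (κ j) t)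
          (cellRep (κ a) (cellRep (κ j) t)) (cellRep_spec _ _).symm
        have h4 := h2 (cellRep (κ a) (cellRep (κ j) t))
          (Finset.mem_biUnion.2 ⟨a, Finset.mem_range.2 (by omega), cellRep_mem _ _⟩)
        have h5 : ((1 : ℝ) / 2) ^ a ≤ 1 := pow_le_one₀ (by norm_num) (by norm_num)
        have h6 := abs_sub_abs_le_abs_sub (Z (N j) ω (cellRep (κ j) t))
          (Z (N j) ω (cellRep (κ a) (cellRep (κ j) t)))
        linarith
    · rw [cellProj_apply, cellProj_apply]
      -- For `i ≤ j` nestedness keeps the representatives in the same cell of level `i`; for `i > j`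
      -- the discretization is constant on the cells of level `i`.
      rcases le_or_gt i j with hij | hij
      · refine h1 i ⟨hi, by omega⟩ _ _ ?_
        rw [hnest i j hij _ _ (cellRep_spec (κ j) s), hnest i j hij _ _ (cellRep_spec (κ j) t), hst]
      · rw [cellRep_eq (hnest j i hij.le s t hst), sub_self, abs_zero]
        positivity
  refine (measure_mono hsub).trans ((measure_union_le _ _).trans ?_)
  have hA : μ (⋃ i ∈ Finset.Ico a (j + 1), {ω | Z (N j) ω ∉ oscSet (κ i) ((1 / 2) ^ i)}) ≤
      ENNReal.ofReal (2 * e) := by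
    refine (measure_biUnion_finset_le _ _).trans ?_
    calc ∑ i ∈ Finset.Ico a (j + 1), μ {ω | Z (N j) ω ∉ oscSet (κ i) ((1 / 2) ^ i)}
        ≤ ∑ i ∈ Finset.Ico a (j + 1), ENNReal.ofReal ((1 / 2) ^ i) := by
          refine Finset.sum_le_sum fun i hi => hosc i _ (hN ?_)
          have := (Finset.mem_Ico.1 hi).2
          omega
      _ = ENNReal.ofReal (∑ i ∈ Finset.Ico a (j + 1), (1 / 2) ^ i) :=
          (ENNReal.ofReal_sum_of_nonneg fun i _ => by positivity).symm
      _ ≤ ENNReal.ofReal (2 * e) := by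
          refine ENNReal.ofReal_le_ofReal ?_
          refine (geom_sum_Ico_le_of_lt_one (by norm_num) (by norm_num)).trans (le_of_eq ?_)
          rw [he]; ring
  have hB : μ (⋃ r ∈ G, {ω | R < |Z (N j) ω r|}) ≤ ENNReal.ofReal e := by
    refine (measure_biUnion_finset_le _ _).trans ?_
    calc ∑ r ∈ G, μ {ω | R < |Z (N j) ω r|} ≤ ∑ _r ∈ G, ENNReal.ofReal (C / R ^ 2) :=
          Finset.sum_le_sum fun r _ => htail _ _ _ hRpos
      _ = ENNReal.ofReal (G.card * (C / R ^ 2)) := by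
          rw [Finset.sum_const, nsmul_eq_mul, ENNReal.ofReal_mul (by positivity),
            ENNReal.ofReal_natCast]
      _ ≤ ENNReal.ofReal e := ENNReal.ofReal_le_ofReal hR
  refine (add_le_add hA hB).trans ?_
  rw [← ENNReal.ofReal_add (by positivity) (by positivity)]
  exact ENNReal.ofReal_le_ofReal (by linarith)

/-- Prokhorov's theorem for the discretized processes: the probability measures with prescribed
small mass outside given compact sets form a compact set, so the laws converge along an ultrafilter.
Discretization changes each characteristic function by a vanishing amount, which identifies the
limit. -/
lemma exists_limit_law (hfin : ∀ i, (Set.range (κ i)).Finite)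
    (hmeas : ∀ n t, Measurable fun ω => (Z n ω t : ℝ))
    (hnest : ∀ i j, i ≤ j → ∀ s t, κ j s = κ j t → κ i s = κ i t) {C : ℝ} (hC : 0 ≤ C)
    (htail : ∀ n t (R : ℝ), 0 < R → μ {ω | R < |Z n ω t|} ≤ ENNReal.ofReal (C / R ^ 2))
    (hN : StrictMono N)
    (hosc : ∀ i n, N i ≤ n →
      μ {ω | Z n ω ∉ oscSet (κ i) ((1 / 2) ^ i)} ≤ ENNReal.ofReal ((1 / 2) ^ i))
    (hchar : ∀ (I : Finset T) (a : T → ℝ), Tendsto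
      (fun n => ∫ ω, Complex.exp (((∑ t ∈ I, a t * Z n ω t : ℝ) : ℂ) * Complex.I) ∂μ) atTop
      (𝓝 ((Real.exp (-(quadForm K I a / 2)) : ℝ) : ℂ))) :
    ∃ L : Measure (EllInfty T), IsProbabilityMeasure L ∧ IsTightMeasureSet {L} ∧
      (∀ a, L (oscSet (κ a) ((1 / 2) ^ a))ᶜ ≤ ENNReal.ofReal (3 * (1 / 2) ^ a)) ∧
      ∀ (I : Finset T) (a : T → ℝ),
      ∫ z : EllInfty T, Complex.exp (((∑ t ∈ I, a t * z t : ℝ) : ℂ) * Complex.I) ∂L =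
        ((Real.exp (-(quadForm K I a / 2)) : ℝ) : ℂ) := by
  choose R hR using exists_cellProj_compact hfin hnest hC htail hN.monotone hosc
  let Kc : ℕ → Set (EllInfty T) := fun a => {z : EllInfty T | (∀ t, |z t| ≤ R a) ∧
        ∀ i, a ≤ i → z ∈ oscSet (κ i) ((1 / 2) ^ i)}
  have hKc : ∀ a, IsCompact (Kc a) := fun a => isCompact_osc κ hfin a (R a)
  let u : ℕ → ℝ≥0 := fun a => 3 * (1 / 2) ^ a
  have hu : Tendsto u atTop (𝓝 0) := by
    have h := (tendsto_pow_atTop_nhds_zero_of_lt_one (r := (1 / 2 : ℝ≥0)) (by positivity)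
      (by rw [div_lt_one (by positivity)]; norm_num)).const_mul 3
    simpa [u] using h
  have huR : ∀ a, ENNReal.ofReal (3 * (1 / 2) ^ a) = (u a : ℝ≥0∞) := fun a => by
    rw [ENNReal.ofReal, ENNReal.coe_inj]
    ext
    rw [Real.coe_toNNReal _ (by positivity)]
    simp [u]
  have hpm : ∀ j, Measurable fun ω => cellProj (hfin j) (Z (N j) ω) := fun j =>
    measurable_cellProj (hfin j) (hmeas _)
  let ν : ℕ → ProbabilityMeasure (EllInfty T) := fun j =>
    ⟨μ.map fun ω => cellProj (hfin j) (Z (N j) ω),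
      Measure.isProbabilityMeasure_map (hpm j).aemeasurable⟩
  have hνK : ∀ j a, ν j (Kc a)ᶜ ≤ u a := fun j a => by
    rw [← ENNReal.coe_le_coe, ProbabilityMeasure.ennreal_coeFn_eq_coeFn_toMeasure, ← huR]
    simp only [ν, ProbabilityMeasure.coe_mk]
    rw [Measure.map_apply (hpm j) (hKc a).isClosed.measurableSet.compl]
    exact hR a j
  have hcpt := isCompact_setOfPred_probabilityMeasure_mass_eq_compl_isCompact_le
    (E := EllInfty T) hu hKc (Or.inl inferInstance)
  -- An ultrafilter finer than `atTop` replaces the extraction of a subsequence; only compactness of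
  -- the set of laws is needed.
  let U : Ultrafilter ℕ := hyperfilter ℕ
  obtain ⟨L, hLmem, hL⟩ := hcpt.ultrafilter_le_nhds (U.map ν) (by
    rw [le_principal_iff]
    exact Filter.mem_map.2 (Filter.univ_mem' fun j a => hνK j a))
  have hLt : Tendsto ν U (𝓝 L) := hL
  have hUle : (U : Filter ℕ) ≤ atTop := by
    rw [← Nat.cofinite_eq_atTop]
    exact hyperfilter_le_cofinite
  have hLK : ∀ a, (L : Measure (EllInfty T)) (Kc a)ᶜ ≤ u a := fun a => by
    rw [← ProbabilityMeasure.ennreal_coeFn_eq_coeFn_toMeasure, ENNReal.coe_le_coe]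
    exact hLmem a
  refine ⟨L, inferInstance, ?_, fun a => ?_, fun I a => ?_⟩
  · rw [isTightMeasureSet_iff_exists_isCompact_measure_compl_le]
    intro ε hε
    have h0 : Tendsto (fun a => (u a : ℝ≥0∞)) atTop (𝓝 0) := ENNReal.tendsto_coe.2 hu
    obtain ⟨a, ha⟩ := (h0.eventually (gt_mem_nhds hε)).exists
    refine ⟨Kc a, hKc a, ?_⟩
    rintro _ rfl
    exact (hLK a).trans ha.le
  · rw [huR]
    refine (measure_mono ?_).trans (hLK a)
    exact Set.compl_subset_compl.2 fun z hz => hz.2 a le_rfl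
  · have hcont : Continuous fun z : EllInfty T =>
        Complex.exp (((∑ t ∈ I, a t * z t : ℝ) : ℂ) * Complex.I) := by
      refine Complex.continuous_exp.comp ((Complex.continuous_ofReal.comp ?_).mul continuous_const)
      exact continuous_finsetSum _ fun t _ => continuous_const.mul (ell_continuous_eval t)
    let g : BoundedContinuousFunction (EllInfty T) ℂ :=
      BoundedContinuousFunction.ofNormedAddCommGroup _ hcont 1 fun z => by
        rw [Complex.norm_exp_ofReal_mul_I]
    have h1 := (ProbabilityMeasure.tendsto_iff_forall_integral_rclike_tendsto ℂ).1 hLt g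
    have h2 : ∀ j, ∫ z, g z ∂(ν j : Measure (EllInfty T)) =
        ∫ ω, Complex.exp (((∑ t ∈ I, a t * Z (N j) ω (cellRep (κ j) t) : ℝ) : ℂ) * Complex.I)
          ∂μ := fun j => by
      simp only [ν, ProbabilityMeasure.coe_mk]
      rw [integral_map (hpm j).aemeasurable g.continuous.aestronglyMeasurable]
      rfl
    simp only [h2] at h1
    have h3 := (hchar I a).comp hN.tendsto_atTop
    have h4 : Tendsto (fun j =>
        (∫ ω, Complex.exp (((∑ t ∈ I, a t * Z (N j) ω (cellRep (κ j) t) : ℝ) : ℂ) * Complex.I) ∂μ)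
        - ∫ ω, Complex.exp (((∑ t ∈ I, a t * Z (N j) ω t : ℝ) : ℂ) * Complex.I) ∂μ)
        atTop (𝓝 0) := by
      refine squeeze_zero_norm (a := fun j => (∑ t ∈ I, |a t|) * (1 / 2) ^ j + 2 * (1 / 2) ^ j)
        (fun j => ?_) ?_
      -- Only the finitely many coordinates in `I` enter, so this exceptional set is measurable; it
      -- is contained in the oscillation event of level `j`.
      · let B : Set Ω := ⋃ t ∈ I,
          {ω | (1 / 2) ^ j < |Z (N j) ω (cellRep (κ j) t) - Z (N j) ω t|}
        have hd : ∀ t, Measurable fun ω =>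
            ((Z (N j) ω (cellRep (κ j) t) : ℝ) - (Z (N j) ω t : ℝ)) := fun t =>
          Measurable.sub (G := ℝ) (hmeas (N j) _) (hmeas (N j) t)
        have hB : MeasurableSet B := Finset.measurableSet_biUnion _ fun t _ =>
          measurableSet_lt measurable_const (hd t).norm
        have hBμ : μ.real B ≤ (1 / 2) ^ j := by
          rw [measureReal_def]
          refine ENNReal.toReal_le_of_le_ofReal (by positivity) ?_
          refine (measure_mono ?_).trans (hosc j (N j) le_rfl)
          intro ω hω hcon
          simp only [B, Set.mem_iUnion, Set.mem_ofPred_eq] at hω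
          obtain ⟨t, _, ht⟩ := hω
          exact absurd (hcon _ t (cellRep_spec (κ j) t)) (not_le.2 ht)
        refine (norm_integral_cexp_sub_le (B := B) ?_ ?_ hB
          (δ := (∑ t ∈ I, |a t|) * (1 / 2) ^ j) (by positivity) ?_).trans (by linarith)
        · exact Finset.measurable_fun_sum _ fun t _ => (hmeas _ _).const_mul _
        · exact Finset.measurable_fun_sum _ fun t _ => (hmeas _ _).const_mul _
        · intro ω hω
          simp only [B, Set.mem_iUnion, Set.mem_ofPred_eq, not_exists, not_lt] at hω
          rw [← Finset.sum_sub_distrib, Finset.sum_mul]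
          refine (Finset.abs_sum_le_sum_abs _ _).trans (Finset.sum_le_sum fun t ht => ?_)
          rw [← mul_sub, abs_mul]
          exact mul_le_mul_of_nonneg_left (hω t ht) (abs_nonneg _)
      · have h5 := tendsto_pow_atTop_nhds_zero_of_lt_one (r := (1 / 2 : ℝ)) (by norm_num)
          (by norm_num)
        simpa using (h5.const_mul (∑ t ∈ I, |a t|)).add (h5.const_mul 2)
    have h6 := (h4.add h3).mono_left hUle
    simp only [Function.comp_def, sub_add_cancel, zero_add] at h6
    exact tendsto_nhds_unique h1 h6

/-- At a fixed level both the processes and the limit are close to their discretizations outside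
sets of small mass, and a continuous function of the discretization depends on finitely many
coordinates only. -/
lemma weaklyConvergesTo_of_limit_law (hfin : ∀ i, (Set.range (κ i)).Finite)
    (hmeas : ∀ n t, Measurable fun ω => (Z n ω t : ℝ))
    (hosc : ∀ i n, N i ≤ n →
      μ {ω | Z n ω ∉ oscSet (κ i) ((1 / 2) ^ i)} ≤ ENNReal.ofReal ((1 / 2) ^ i))
    {L : Measure (EllInfty T)} [IsProbabilityMeasure L]
    (hL : ∀ a, L (oscSet (κ a) ((1 / 2) ^ a))ᶜ ≤ ENNReal.ofReal (3 * (1 / 2) ^ a))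
    (hchar : ∀ (I : Finset T) (a : T → ℝ), Tendsto
      (fun n => ∫ ω, Complex.exp (((∑ t ∈ I, a t * Z n ω t : ℝ) : ℂ) * Complex.I) ∂μ) atTop
      (𝓝 (∫ z : EllInfty T, Complex.exp (((∑ t ∈ I, a t * z t : ℝ) : ℂ) * Complex.I) ∂L))) :
    WeaklyConvergesTo μ Z L := by
  refine weaklyConvergesTo_of_upperBound (upperBound_of_lipschitz fun φ k hk ε hε => ?_)
  have hM : (0 : ℝ) < 2 * k + 8 * ‖φ‖ + 1 := by positivity
  -- With `e = (1/2)^i` the errors are `k e` twice (limit and process), `6 ‖φ‖ e` from the set of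
  -- `L`-mass at most `3 e`, and `2 ‖φ‖ e` from the exceptional event for the process.
  obtain ⟨i, hi⟩ := exists_pow_lt_of_lt_one (show 0 < ε / 2 / (2 * k + 8 * ‖φ‖ + 1) by positivity)
    (by norm_num : (1 / 2 : ℝ) < 1)
  set e : ℝ := (1 / 2) ^ i with he
  have hepos : 0 < e := by positivity
  rw [lt_div_iff₀ hM] at hi
  let ψ : BoundedContinuousFunction (cellReps (hfin i) → ℝ) ℝ :=
    φ.compContinuous ⟨cellStep (hfin i), (cellStep (hfin i)).continuous⟩
  have hψ := tendsto_integral_marginal hmeas (cellReps (hfin i)) (hchar _) ψ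
  have hlip : ∀ z ∈ oscSet (κ i) e, |φ z - φ (cellProj (hfin i) z)| ≤ k * e := fun z hz => by
    have h1 := hk.dist_le_mul z (cellProj (hfin i) z)
    rw [Real.dist_eq] at h1
    exact h1.trans (mul_le_mul_of_nonneg_left (dist_cellProj_le _ hepos.le hz) k.2)
  have hLφ : ∫ z, ψ (fun t => z t) ∂L ≤ (∫ z, φ z ∂L) + k * e + 6 * ‖φ‖ * e := by
    set B := (oscSet (T := T) (κ i) e)ᶜ with hB
    have hBm : MeasurableSet B := (isClosed_oscSet _ _).measurableSet.compl
    have hBL : L.real B ≤ 3 * e := by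
      rw [measureReal_def]
      exact ENNReal.toReal_le_of_le_ofReal (by positivity) (hL i)
    have hi1 : Integrable (fun z => φ z + k * e) L := (bcf_integrable φ).add (integrable_const _)
    have hi2 : Integrable (B.indicator fun _ => 2 * ‖φ‖) L := (integrable_const _).indicator hBm
    calc ∫ z, ψ (fun t => z t) ∂L
        ≤ ∫ z, ((φ z + k * e) + B.indicator (fun _ => 2 * ‖φ‖) z) ∂L := by
          refine integral_mono ?_ (hi1.add hi2) fun z => ?_
          · refine Integrable.of_bound (C := ‖ψ‖) ?_ (Eventually.of_forall fun z =>
              ψ.norm_coe_le_norm _)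
            exact (ψ.continuous.comp
              (continuous_pi fun t => ell_continuous_eval t.1)).aestronglyMeasurable
          · change φ (cellProj (hfin i) z) ≤ _
            by_cases hz : z ∈ B
            · rw [Set.indicator_of_mem hz]
              have h1 := le_of_abs_le (bcf_abs_le φ (cellProj (hfin i) z))
              have h2 := neg_le_of_abs_le (bcf_abs_le φ z)
              have h3 : 0 ≤ (k : ℝ) * e := by positivity
              linarith
            · rw [Set.indicator_of_notMem hz]
              have h1 := neg_le_of_abs_le (hlip z (not_not.1 hz))
              linarith
      _ = (∫ z, φ z ∂L) + k * e + L.real B * (2 * ‖φ‖) := by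
          rw [integral_add hi1 hi2, integral_add (bcf_integrable φ) (integrable_const _),
            integral_indicator_const _ hBm]
          simp
      _ ≤ _ := by
          have h1 : L.real B * (2 * ‖φ‖) ≤ 3 * e * (2 * ‖φ‖) := by gcongr
          linarith
  filter_upwards [hψ.eventually (gt_mem_nhds (lt_add_of_pos_right _ (half_pos hε))),
    eventually_ge_atTop (N i)] with n hn hNn
  set B := toMeasurable μ {ω | Z n ω ∉ oscSet (κ i) e} with hB
  have hBm : MeasurableSet B := measurableSet_toMeasurable _ _
  have hBμ : μ.real B ≤ e := by
    rw [measureReal_def, hB, measure_toMeasurable]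
    exact ENNReal.toReal_le_of_le_ofReal hepos.le (hosc i n hNn)
  have hgm : Measurable fun ω => ψ (fun t => Z n ω t) :=
    ψ.continuous.measurable.comp (measurable_pi_lambda _ fun t => hmeas n t)
  have hgi : Integrable (fun ω => ψ (fun t => Z n ω t)) μ :=
    Integrable.of_bound (C := ‖ψ‖) hgm.aestronglyMeasurable
      (Eventually.of_forall fun z => ψ.norm_coe_le_norm _)
  have hi2 : Integrable (B.indicator fun _ => 2 * ‖φ‖) μ := (integrable_const _).indicator hBm
  have hi1 : Integrable (fun ω => ψ (fun t => Z n ω t) + k * e) μ := hgi.add (integrable_const _)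
  refine ⟨fun ω => (ψ (fun t => Z n ω t) + k * e) + B.indicator (fun _ => 2 * ‖φ‖) ω,
    (hgm.add_const _).add (measurable_const.indicator hBm), hi1.add hi2, fun ω => ?_, ?_⟩
  · beta_reduce
    change φ (Z n ω) ≤ φ (cellProj (hfin i) (Z n ω)) + _ + _
    by_cases hω : ω ∈ B
    · rw [Set.indicator_of_mem hω]
      have h1 := neg_le_of_abs_le (bcf_abs_le φ (cellProj (hfin i) (Z n ω)))
      have h2 := le_of_abs_le (bcf_abs_le φ (Z n ω))
      have h3 : 0 ≤ (k : ℝ) * e := by positivity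
      linarith
    · rw [Set.indicator_of_notMem hω]
      have h0 : Z n ω ∈ oscSet (κ i) e := by
        by_contra hcon
        exact hω (subset_toMeasurable _ _ hcon)
      have h1 := le_of_abs_le (hlip _ h0)
      linarith
  · rw [integral_add hi1 hi2, integral_add hgi (integrable_const _),
      integral_indicator_const _ hBm]
    simp only [integral_const, probReal_univ, smul_eq_mul, one_mul]
    have h1 : μ.real B * (2 * ‖φ‖) ≤ e * (2 * ‖φ‖) := by gcongr
    nlinarith

/-- Convergence of finite marginals to Gaussian ones together with asymptotic equicontinuity over
nested finite partitions yields weak convergence to a tight Gaussian law. -/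
theorem exists_tightGaussianLaw_weaklyConvergesTo (hK : ∀ s t, K s t = K t s)
    (hmeas : ∀ n t, Measurable fun ω => (Z n ω t : ℝ))
    {C : ℝ} (hC : 0 ≤ C)
    (htail : ∀ n t (R : ℝ), 0 < R → μ {ω | R < |Z n ω t|} ≤ ENNReal.ofReal (C / R ^ 2))
    (hchar : ∀ (I : Finset T) (a : T → ℝ), Tendsto
      (fun n => ∫ ω, Complex.exp (((∑ t ∈ I, a t * Z n ω t : ℝ) : ℂ) * Complex.I) ∂μ) atTop
      (𝓝 ((Real.exp (-(quadForm K I a / 2)) : ℝ) : ℂ)))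
    (hfin : ∀ i, (Set.range (κ i)).Finite)
    (hnest : ∀ i j, i ≤ j → ∀ s t, κ j s = κ j t → κ i s = κ i t)
    (hosc : ∀ ε : ℝ, 0 < ε → ∃ m, ∀ᶠ n in atTop,
      μ {ω | Z n ω ∉ oscSet (κ m) ε} ≤ ENNReal.ofReal ε) :
    ∃ L : Measure (EllInfty T), IsTightGaussianLaw L K ∧ WeaklyConvergesTo μ Z L := by
  have h1 : ∀ i : ℕ, ∃ m N, ∀ n, N ≤ n →
      μ {ω | Z n ω ∉ oscSet (κ m) ((1 / 2) ^ i)} ≤ ENNReal.ofReal ((1 / 2) ^ i) := fun i => by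
    obtain ⟨m, hm⟩ := hosc ((1 / 2) ^ i) (by positivity)
    obtain ⟨N, hN⟩ := eventually_atTop.1 hm
    exact ⟨m, N, hN⟩
  choose m N0 hN0 using h1
  -- Partial sums make the levels monotone, so that the partitions are refined, and the thresholds
  -- strictly monotone; they dominate the original choices.
  let m' : ℕ → ℕ := fun i => ∑ k ∈ Finset.range (i + 1), m k
  let N : ℕ → ℕ := fun i => ∑ k ∈ Finset.range (i + 1), (N0 k + 1)
  have hm' : Monotone m' := fun i j hij =>
    Finset.sum_le_sum_of_subset (Finset.range_subset_range.2 (by omega))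
  have hmm : ∀ i, m i ≤ m' i := fun i =>
    Finset.single_le_sum (f := m) (fun _ _ => Nat.zero_le _) (Finset.self_mem_range_succ i)
  have hN : StrictMono N := strictMono_nat_of_lt_succ fun i => by
    simp only [N]
    rw [Finset.sum_range_succ _ (i + 1)]
    omega
  have hNN : ∀ i, N0 i ≤ N i := fun i =>
    (Nat.le_succ _).trans (Finset.single_le_sum (f := fun k => N0 k + 1)
      (fun _ _ => Nat.zero_le _) (Finset.self_mem_range_succ i))
  have hosc' : ∀ i n, N i ≤ n → μ {ω | Z n ω ∉ oscSet (κ (m' i)) ((1 / 2) ^ i)} ≤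
      ENNReal.ofReal ((1 / 2) ^ i) := fun i n hn => by
    refine (measure_mono ?_).trans (hN0 i n ((hNN i).trans hn))
    intro ω hω hcon
    exact hω fun s t hst => hcon s t (hnest _ _ (hmm i) s t hst)
  obtain ⟨L, hLp, hLt, hLosc, hLchar⟩ := exists_limit_law (κ := fun i => κ (m' i)) (K := K)
    (fun i => hfin _) hmeas (fun i j hij s t h => hnest _ _ (hm' hij) s t h) hC htail hN hosc' hchar
  refine ⟨L, isTightGaussianLaw_of_charFun hK hLt hLchar, ?_⟩
  refine weaklyConvergesTo_of_limit_law (κ := fun i => κ (m' i)) (fun i => hfin _) hmeas hosc'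
    hLosc fun I a => ?_
  rw [hLchar]
  exact hchar I a

end TightLimit

/-! ### Exponential and variance bounds and the central limit theorem -/

section EmpiricalProcess

variable {S Ω : Type*} [MeasurableSpace S] [MeasurableSpace Ω] {μ : Measure Ω}
  [IsProbabilityMeasure μ] {Q : Measure S} [IsProbabilityMeasure Q] {X : ℕ → Ω → S}

/-- The set-indexed empirical process `√n (Q_n(A) - Q(A))`. -/
def emp (Q : Measure S) (X : ℕ → Ω → S) (n : ℕ) (ω : Ω) (A : Set S) : ℝ :=
  (√(n : ℝ))⁻¹ * ∑ i ∈ Finset.range n, (A.indicator (fun _ => (1 : ℝ)) (X i ω) - Q.real A)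

lemma measurable_emp (hX : ∀ i, Measurable (X i)) (n : ℕ) {A : Set S} (hA : MeasurableSet A) :
    Measurable fun ω => emp Q X n ω A :=
  (Finset.measurable_fun_sum _ fun i _ =>
    ((measurable_const.indicator hA).comp (hX i)).sub_const _).const_mul _

lemma indicator_one_mem (A : Set S) (s : S) :
    0 ≤ A.indicator (fun _ => (1 : ℝ)) s ∧ A.indicator (fun _ => (1 : ℝ)) s ≤ 1 := by
  by_cases h : s ∈ A <;> simp [h]

lemma abs_indicator_sub_le (A : Set S) (s : S) :
    |A.indicator (fun _ => (1 : ℝ)) s - Q.real A| ≤ 1 := by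
  have h1 := indicator_one_mem A s
  have h2 : 0 ≤ Q.real A := measureReal_nonneg
  have h3 : Q.real A ≤ 1 := measureReal_le_one
  rw [abs_le]
  constructor <;> linarith [h1.1, h1.2]

lemma abs_emp_le (n : ℕ) (ω : Ω) (A : Set S) : |emp Q X n ω A| ≤ √(n : ℝ) := by
  rw [emp, abs_mul, abs_of_nonneg (by positivity : 0 ≤ (√(n : ℝ))⁻¹)]
  have h : |∑ i ∈ Finset.range n, (A.indicator (fun _ => (1 : ℝ)) (X i ω) - Q.real A)| ≤ n := by
    refine (Finset.abs_sum_le_sum_abs _ _).trans ?_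
    refine (Finset.sum_le_sum fun i _ => abs_indicator_sub_le A _).trans (by simp)
  rcases Nat.eq_zero_or_pos n with rfl | hn
  · simp
  · have hs : 0 < √(n : ℝ) := Real.sqrt_pos.2 (by exact_mod_cast hn)
    rw [inv_mul_le_iff₀ hs, Real.mul_self_sqrt (Nat.cast_nonneg n)]
    exact h

/-- A Bernstein type exponential inequality for normalized sums. -/
lemma bernstein_tail (hX : ∀ i, Measurable (X i)) (hind : iIndepFun X μ)
    (hlaw : ∀ i, μ.map (X i) = Q) {f : S → ℝ} (hf : Measurable f) (hf2 : ∀ s, |f s| ≤ 2)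
    (hf0 : ∫ s, f s ∂Q = 0) {p : ℝ} (hp : ∫ s, f s ^ 2 ∂Q ≤ p) {n : ℕ} (hn : 0 < n) {θ : ℝ}
    (hθ : 0 ≤ θ) (hθn : 2 * θ ≤ √(n : ℝ)) (η : ℝ) :
    μ {ω | η ≤ (√(n : ℝ))⁻¹ * ∑ i ∈ Finset.range n, f (X i ω)} ≤
      ENNReal.ofReal (Real.exp (θ ^ 2 * p - θ * η)) := by
  have hs : 0 < √(n : ℝ) := Real.sqrt_pos.2 (by exact_mod_cast hn)
  have hsq : √(n : ℝ) ^ 2 = n := Real.sq_sqrt (Nat.cast_nonneg n)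
  -- The condition `2 θ ≤ √n` gives `|t f| ≤ 1`, the range in which `exp y ≤ 1 + y + y²` is used;
  -- the linear term has mean zero.
  set t : ℝ := θ / √(n : ℝ) with ht
  have ht0 : 0 ≤ t := by positivity
  have ht1 : 2 * t ≤ 1 := by
    rw [ht, ← mul_div_assoc, div_le_one hs]
    exact hθn
  have hfi : Integrable f Q := Integrable.of_bound hf.aestronglyMeasurable 2
    (Eventually.of_forall hf2)
  have hf2i : Integrable (fun s => f s ^ 2) Q := by
    refine Integrable.of_bound (hf.pow_const 2).aestronglyMeasurable 4
      (Eventually.of_forall fun s => ?_)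
    rw [Real.norm_eq_abs, abs_pow]
    nlinarith [hf2 s, abs_nonneg (f s)]
  have hexpi : Integrable (fun s => Real.exp (t * f s)) Q := by
    refine Integrable.of_bound (by fun_prop) (Real.exp 1) (Eventually.of_forall fun s => ?_)
    rw [Real.norm_eq_abs, Real.abs_exp, Real.exp_le_exp]
    have := (abs_le.1 (hf2 s)).2
    nlinarith
  have hmgf : ∀ i, mgf (fun ω => f (X i ω)) μ t ≤ Real.exp (t ^ 2 * p) := fun i => by
    have h1 : mgf (fun ω => f (X i ω)) μ t = ∫ s, Real.exp (t * f s) ∂Q := by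
      rw [mgf, ← hlaw i, integral_map (hX i).aemeasurable (by fun_prop)]
    rw [h1]
    calc ∫ s, Real.exp (t * f s) ∂Q ≤ ∫ s, (1 + t * f s + t ^ 2 * f s ^ 2) ∂Q := by
          refine integral_mono hexpi (((integrable_const _).add (hfi.const_mul _)).add
            (hf2i.const_mul _)) fun s => ?_
          have h2 : |t * f s| ≤ 1 := by
            rw [abs_mul, abs_of_nonneg ht0]
            nlinarith [hf2 s, abs_nonneg (f s)]
          have h3 := (abs_le.1 (Real.abs_exp_sub_one_sub_id_le h2)).2
          beta_reduce
          rw [mul_pow] at h3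
          linarith
      _ = 1 + t ^ 2 * ∫ s, f s ^ 2 ∂Q := by
          have hj : Integrable (fun s => 1 + t * f s) Q :=
            (integrable_const _).add (hfi.const_mul _)
          rw [integral_add hj (hf2i.const_mul _), integral_add (integrable_const _) (hfi.const_mul _), integral_const_mul,
            integral_const_mul, hf0]
          simp
      _ ≤ t ^ 2 * p + 1 := by nlinarith [sq_nonneg t]
      _ ≤ Real.exp (t ^ 2 * p) := Real.add_one_le_exp _
  have hindf : iIndepFun (fun i ω => f (X i ω)) μ := hind.comp (fun _ => f) fun _ => hf
  have hmf : ∀ i, Measurable fun ω => f (X i ω) := fun i => hf.comp (hX i)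
  have hsum : mgf (∑ i ∈ Finset.range n, fun ω => f (X i ω)) μ t ≤ Real.exp (θ ^ 2 * p) := by
    rw [hindf.mgf_sum hmf]
    calc ∏ i ∈ Finset.range n, mgf (fun ω => f (X i ω)) μ t
        ≤ ∏ _i ∈ Finset.range n, Real.exp (t ^ 2 * p) :=
          Finset.prod_le_prod (fun i _ => mgf_nonneg) fun i _ => hmgf i
      _ = Real.exp (θ ^ 2 * p) := by
          rw [Finset.prod_const, Finset.card_range, ← Real.exp_nat_mul]
          congr 1
          rw [ht, div_pow, hsq]
          field_simp
  have hint : Integrable (fun ω => Real.exp (t * (∑ i ∈ Finset.range n, fun ω => f (X i ω)) ω))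
      μ := by
    refine Integrable.of_bound (C := Real.exp (t * (n * 2))) ?_ (Eventually.of_forall fun ω => ?_)
    · simp only [Finset.sum_apply]
      have : Measurable fun ω => ∑ i ∈ Finset.range n, f (X i ω) :=
        Finset.measurable_fun_sum _ fun i _ => hmf i
      exact (Real.measurable_exp.comp (this.const_mul t)).aestronglyMeasurable
    · rw [Real.norm_eq_abs, Real.abs_exp, Real.exp_le_exp, Finset.sum_apply]
      refine mul_le_mul_of_nonneg_left ?_ ht0
      refine (Finset.sum_le_sum fun i _ => (abs_le.1 (hf2 _)).2).trans (by simp)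
  have hmain := measure_ge_le_exp_mul_mgf (μ := μ) (√(n : ℝ) * η) ht0 hint
  have hset : {ω | η ≤ (√(n : ℝ))⁻¹ * ∑ i ∈ Finset.range n, f (X i ω)} =
      {ω | √(n : ℝ) * η ≤ (∑ i ∈ Finset.range n, fun ω => f (X i ω)) ω} := by
    ext ω
    simp only [Set.mem_ofPred_eq, Finset.sum_apply]
    rw [le_inv_mul_iff₀ hs]
  rw [hset, ← ofReal_measureReal]
  refine ENNReal.ofReal_le_ofReal (hmain.trans ?_)
  calc Real.exp (-t * (√(n : ℝ) * η)) * mgf (∑ i ∈ Finset.range n, fun ω => f (X i ω)) μ t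
      ≤ Real.exp (-t * (√(n : ℝ) * η)) * Real.exp (θ ^ 2 * p) := by gcongr
    _ = Real.exp (θ ^ 2 * p - θ * η) := by
        rw [← Real.exp_add]
        congr 1
        rw [ht]
        field_simp
        ring

/-- Exponential tail of an increment of the empirical process. -/
lemma emp_sub_tail (hX : ∀ i, Measurable (X i)) (hind : iIndepFun X μ)
    (hlaw : ∀ i, μ.map (X i) = Q) {A B : Set S} (hA : MeasurableSet A) (hB : MeasurableSet B)
    {p : ℝ} (hp : Q.real (A \ B) + Q.real (B \ A) ≤ p) {n : ℕ} (hn : 0 < n) {θ : ℝ}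
    (hθ : 0 ≤ θ) (hθn : 2 * θ ≤ √(n : ℝ)) (η : ℝ) :
    μ {ω | η ≤ emp Q X n ω A - emp Q X n ω B} ≤
      ENNReal.ofReal (Real.exp (θ ^ 2 * p - θ * η)) := by
  let iA : S → ℝ := A.indicator fun _ => 1
  let iB : S → ℝ := B.indicator fun _ => 1
  have hiA : Integrable iA Q := (integrable_const _).indicator hA
  have hiB : Integrable iB Q := (integrable_const _).indicator hB
  have eA : ∫ s, iA s ∂Q = Q.real A := by simp [iA, integral_indicator_const, hA]
  have eB : ∫ s, iB s ∂Q = Q.real B := by simp [iB, integral_indicator_const, hB]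
  let f : S → ℝ := fun s => (iA s - Q.real A) - (iB s - Q.real B)
  have hf : Measurable f := ((measurable_const.indicator hA).sub_const _).sub
    ((measurable_const.indicator hB).sub_const _)
  have hi1 : Integrable (fun s => (iA s - iB s) ^ 2) Q := by
    refine Integrable.of_bound (C := 1) (((measurable_const.indicator hA).sub
      (measurable_const.indicator hB)).pow_const 2).aestronglyMeasurable
      (Eventually.of_forall fun s => ?_)
    rw [Real.norm_eq_abs, abs_pow]
    refine pow_le_one₀ (abs_nonneg _) ?_
    have h1 := indicator_one_mem A s
    have h2 := indicator_one_mem B s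
    rw [abs_le]
    constructor <;> simp only [iA, iB] <;> linarith [h1.1, h1.2, h2.1, h2.2]
  have hint : ∫ s, (iA s - iB s) ^ 2 ∂Q = Q.real (A \ B) + Q.real (B \ A) := by
    have h1 : (fun s => (iA s - iB s) ^ 2) = fun s =>
        (A \ B).indicator (fun _ => (1 : ℝ)) s + (B \ A).indicator (fun _ => (1 : ℝ)) s := by
      ext s
      by_cases h1 : s ∈ A <;> by_cases h2 : s ∈ B <;> simp [iA, iB, h1, h2]
    rw [h1, integral_add ((integrable_const _).indicator (hA.diff hB))
      ((integrable_const _).indicator (hB.diff hA)), integral_indicator_const _ (hA.diff hB),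
      integral_indicator_const _ (hB.diff hA)]
    simp
  have h := bernstein_tail (f := f) (p := p) hX hind hlaw hf (fun s => ?_) ?_ ?_ hn hθ hθn η
  · convert h using 4 with ω
    rw [emp, emp, ← mul_sub, ← Finset.sum_sub_distrib]
  · have h1 := abs_indicator_sub_le (Q := Q) A s
    have h2 := abs_indicator_sub_le (Q := Q) B s
    exact (abs_sub _ _).trans (by linarith)
  · have hjA : Integrable (fun s => iA s - Q.real A) Q := hiA.sub (integrable_const _)
    have hjB : Integrable (fun s => iB s - Q.real B) Q := hiB.sub (integrable_const _)
    simp only [f]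
    rw [integral_sub hjA hjB, integral_sub hiA (integrable_const _), integral_sub hiB (integrable_const _), eA, eB]
    simp
  -- The second moment of `f` is that of the difference of the indicators, the mass of the symmetric
  -- difference, minus `c²`.
  · set c := Q.real A - Q.real B with hc
    have h1 : ∀ s, f s ^ 2 = (iA s - iB s) ^ 2 - 2 * c * (iA s - iB s) + c ^ 2 := fun s => by
      simp only [f, hc]; ring
    simp only [h1]
    have hj1 : Integrable (fun s => 2 * c * (iA s - iB s)) Q := (hiA.sub hiB).const_mul _
    have hj2 : Integrable (fun s => (iA s - iB s) ^ 2 - 2 * c * (iA s - iB s)) Q := hi1.sub hj1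
    rw [integral_add hj2 (integrable_const _), integral_sub hi1 hj1, integral_const_mul, hint,
      integral_sub hiA hiB, eA, eB]
    simp only [integral_const, probReal_univ, smul_eq_mul, one_mul]
    rw [← hc]
    nlinarith [sq_nonneg c]

lemma emp_abs_sub_tail (hX : ∀ i, Measurable (X i)) (hind : iIndepFun X μ)
    (hlaw : ∀ i, μ.map (X i) = Q) {A B : Set S} (hA : MeasurableSet A) (hB : MeasurableSet B)
    {p : ℝ} (hp : Q.real (A \ B) + Q.real (B \ A) ≤ p) {n : ℕ} (hn : 0 < n) {θ : ℝ}
    (hθ : 0 ≤ θ) (hθn : 2 * θ ≤ √(n : ℝ)) (η : ℝ) :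
    μ {ω | η < |emp Q X n ω A - emp Q X n ω B|} ≤
      ENNReal.ofReal (2 * Real.exp (θ ^ 2 * p - θ * η)) := by
  have h1 := emp_sub_tail hX hind hlaw hA hB hp hn hθ hθn η
  have h2 := emp_sub_tail hX hind hlaw hB hA
    (show _ ≤ p by rwa [add_comm]) hn hθ hθn η
  refine (measure_mono (t := {ω | η ≤ emp Q X n ω A - emp Q X n ω B} ∪
    {ω | η ≤ emp Q X n ω B - emp Q X n ω A}) ?_).trans ((measure_union_le _ _).trans ?_)
  · intro ω hω
    rcases lt_abs.1 (show η < |_| from hω) with h | h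
    · exact Or.inl h.le
    · exact Or.inr (show η ≤ _ by linarith)
  · refine (add_le_add h1 h2).trans ?_
    rw [← ENNReal.ofReal_add (Real.exp_nonneg _) (Real.exp_nonneg _), ← two_mul]

/-- Simultaneous control of the increments over pairs of close sets in a finite family. -/
lemma emp_family_tail (hX : ∀ i, Measurable (X i)) (hind : iIndepFun X μ)
    (hlaw : ∀ i, μ.map (X i) = Q) {ι : Type*} (J : Finset ι) {A B : ι → Set S}
    (hA : ∀ j, MeasurableSet (A j)) (hB : ∀ j, MeasurableSet (B j))
    {p : ℝ} {n : ℕ} (hn : 0 < n) {θ : ℝ}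
    (hθ : 0 ≤ θ) (hθn : 2 * θ ≤ √(n : ℝ)) (η : ℝ) :
    μ {ω | ∃ j ∈ J, Q.real (A j \ B j) + Q.real (B j \ A j) ≤ p ∧
        η < |emp Q X n ω (A j) - emp Q X n ω (B j)|} ≤
      ENNReal.ofReal (J.card * (2 * Real.exp (θ ^ 2 * p - θ * η))) := by
  classical
  have hsub : {ω | ∃ j ∈ J, Q.real (A j \ B j) + Q.real (B j \ A j) ≤ p ∧
        η < |emp Q X n ω (A j) - emp Q X n ω (B j)|} ⊆
      ⋃ j ∈ J.filter (fun j => Q.real (A j \ B j) + Q.real (B j \ A j) ≤ p),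
        {ω | η < |emp Q X n ω (A j) - emp Q X n ω (B j)|} := by
    rintro ω ⟨j, hj, hjp, hω⟩
    exact Set.mem_iUnion₂.2 ⟨j, Finset.mem_filter.2 ⟨hj, hjp⟩, hω⟩
  refine (measure_mono hsub).trans ((measure_biUnion_finset_le _ _).trans ?_)
  refine (Finset.sum_le_sum fun j hj => emp_abs_sub_tail hX hind hlaw (hA j) (hB j)
    (Finset.mem_filter.1 hj).2 hn hθ hθn η).trans ?_
  rw [Finset.sum_const, nsmul_eq_mul, ENNReal.ofReal_mul (p := (J.card : ℝ)) (by positivity),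
    ENNReal.ofReal_natCast]
  gcongr
  exact Finset.filter_subset _ _

/-- The variance of the normalized sum is at most one for every set and every sample size, the
process being zero for `n = 0`. -/
lemma emp_chebyshev (hX : ∀ i, Measurable (X i)) (hind : iIndepFun X μ) (n : ℕ) {A : Set S}
    (hlaw : ∀ i, μ.map (X i) = Q) (hA : MeasurableSet A) {R : ℝ} (hR : 0 < R) :
    μ {ω | R < |emp Q X n ω A|} ≤ ENNReal.ofReal (1 / R ^ 2) := by
  let f : S → ℝ := fun s => A.indicator (fun _ => (1 : ℝ)) s - Q.real A
  have hf : Measurable f := (measurable_const.indicator hA).sub_const _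
  have hfb : ∀ s, |f s| ≤ 1 := abs_indicator_sub_le A
  have hfX : ∀ i, Measurable fun ω => f (X i ω) := fun i => hf.comp (hX i)
  have hL2 : ∀ i, MemLp (fun ω => f (X i ω)) 2 μ := fun i =>
    MemLp.of_bound (hfX i).aestronglyMeasurable 1 (Eventually.of_forall fun ω => hfb _)
  have hmean : ∀ i, ∫ ω, f (X i ω) ∂μ = 0 := fun i => by
    rw [← integral_map (φ := X i) (hX i).aemeasurable hf.aestronglyMeasurable, hlaw i]
    simp only [f]
    rw [integral_sub ((integrable_const _).indicator hA) (integrable_const _),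
      integral_indicator_const _ hA]
    simp
  have hvar : ∀ i, Var[fun ω => f (X i ω); μ] ≤ 1 := fun i => by
    refine (variance_le_expectation_sq (hfX i).aestronglyMeasurable).trans ?_
    calc ∫ ω, ((fun ω => f (X i ω)) ^ 2) ω ∂μ ≤ ∫ _, (1 : ℝ) ∂μ := by
          refine integral_mono (hL2 i).integrable_sq (integrable_const _) fun ω => ?_
          simp only [Pi.pow_apply]
          rw [← sq_abs]
          exact pow_le_one₀ (abs_nonneg _) (hfb _)
      _ = 1 := by simp
  have hindf : iIndepFun (fun i ω => f (X i ω)) μ := hind.comp (fun _ => f) fun _ => hf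
  have hV : Var[∑ i ∈ Finset.range n, fun ω => f (X i ω); μ] ≤ n := by
    rw [IndepFun.variance_sum (fun i _ => hL2 i) fun i _ j _ hij => hindf.indepFun hij]
    exact (Finset.sum_le_sum fun i _ => hvar i).trans (by simp)
  have hM : MemLp (fun ω => emp Q X n ω A) 2 μ :=
    MemLp.of_bound (measurable_emp hX n hA).aestronglyMeasurable _
      (Eventually.of_forall fun ω => abs_emp_le n ω A)
  have hE : ∫ ω, emp Q X n ω A ∂μ = 0 := by
    simp only [emp]
    rw [integral_const_mul, integral_finsetSum _ fun i _ => (hL2 i).integrable (by norm_num)]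
    rw [Finset.sum_eq_zero fun i _ => hmean i, mul_zero]
  have hVe : Var[fun ω => emp Q X n ω A; μ] ≤ 1 := by
    have h1 : (fun ω => emp Q X n ω A) =
        fun ω => (√(n : ℝ))⁻¹ * (∑ i ∈ Finset.range n, fun ω => f (X i ω)) ω := by
      ext ω
      simp only [emp, f, Finset.sum_apply]
    rw [h1, variance_const_mul, inv_pow, Real.sq_sqrt (Nat.cast_nonneg n)]
    rcases Nat.eq_zero_or_pos n with rfl | hn
    · simp
    · rw [inv_mul_le_iff₀ (by exact_mod_cast hn), mul_one]
      exact hV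
  refine (measure_mono ?_).trans ((meas_ge_le_variance_div_sq hM hR).trans
    (ENNReal.ofReal_le_ofReal (by gcongr)))
  intro ω hω
  simp only [Set.mem_ofPred_eq, hE, sub_zero]
  exact le_of_lt hω

/-- The central limit theorem for finite combinations, as convergence of characteristic
functions. -/
lemma tendsto_cexp_emp (hX : ∀ i, Measurable (X i)) (hind : iIndepFun X μ)
    (hlaw : ∀ i, μ.map (X i) = Q) {T : Type*} (A : T → Set S) (hA : ∀ t, MeasurableSet (A t))
    (I : Finset T) (a : T → ℝ) :
    Tendsto (fun n => ∫ ω, Complex.exp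
      (((∑ t ∈ I, a t * emp Q X n ω (A t) : ℝ) : ℂ) * Complex.I) ∂μ) atTop
      (𝓝 ((Real.exp (-(quadForm (fun s t => covariance ((A s).indicator fun _ => (1 : ℝ))
        ((A t).indicator fun _ => (1 : ℝ)) Q) I a / 2)) : ℝ) : ℂ)) := by
  let ind : T → S → ℝ := fun t => (A t).indicator fun _ => (1 : ℝ)
  have hindm : ∀ t, Measurable (ind t) := fun t => measurable_const.indicator (hA t)
  have hindL : ∀ t, MemLp (ind t) 2 Q := fun t =>
    MemLp.of_bound (hindm t).aestronglyMeasurable 1 (Eventually.of_forall fun s => by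
      rw [Real.norm_eq_abs, abs_of_nonneg (indicator_one_mem _ _).1]
      exact (indicator_one_mem _ _).2)
  let g : S → ℝ := fun s => ∑ t ∈ I, a t * ind t s
  have hg : Measurable g := Finset.measurable_fun_sum _ fun t _ => (hindm t).const_mul _
  have hgL : MemLp g 2 Q := memLp_finsetSum _ fun t _ => (hindL t).const_mul _
  have hvar : Var[g; Q] = quadForm (fun s t => covariance (ind s) (ind t) Q) I a := by
    simp only [g]
    rw [variance_fun_sum' fun t _ => (hindL t).const_mul _]
    refine Finset.sum_congr rfl fun s _ => Finset.sum_congr rfl fun t _ => ?_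
    rw [covariance_const_mul_left, covariance_const_mul_right]
    ring
  have hident : ∀ i, IdentDistrib (fun ω => g (X i ω)) (fun ω => g (X 0 ω)) μ μ := fun i =>
    IdentDistrib.comp (u := g) ⟨(hX i).aemeasurable, (hX 0).aemeasurable, by rw [hlaw, hlaw]⟩ hg
  have hvX : Var[fun ω => g (X 0 ω); μ] = Var[g; Q] := by
    rw [← hlaw 0, variance_map hg.aemeasurable (hX 0).aemeasurable]
    rfl
  have hmX : ∫ ω, g (X 0 ω) ∂μ = ∑ t ∈ I, a t * Q.real (A t) := by
    rw [← integral_map (φ := X 0) (hX 0).aemeasurable hg.aestronglyMeasurable, hlaw 0]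
    simp only [g]
    rw [integral_finsetSum _ fun t _ => ((hindL t).integrable (by norm_num)).const_mul _]
    refine Finset.sum_congr rfl fun t _ => ?_
    rw [integral_const_mul, integral_indicator_const _ (hA t)]
    simp
  have hL2X : MemLp (fun ω => g (X 0 ω)) 2 μ := by
    have h := hgL
    rw [← hlaw 0] at h
    exact (memLp_map_measure_iff hg.aestronglyMeasurable (hX 0).aemeasurable).1 h
  have hclt := tendstoInDistribution_inv_sqrt_mul_sum_sub (P := μ)
    (X := fun i ω => g (X i ω)) (Y := id) (P' := gaussianReal 0 Var[fun ω => g (X 0 ω); μ].toNNReal)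
    ⟨aemeasurable_id, Measure.map_id⟩ hL2X (hind.comp (fun _ => g) fun _ => hg) hident
  have hsum : ∀ (n : ℕ) ω, (√(n : ℝ))⁻¹ *
      (∑ k ∈ Finset.range n, g (X k ω) - n * ∫ ω, g (X 0 ω) ∂μ) =
      ∑ t ∈ I, a t * emp Q X n ω (A t) := fun n ω => by
    rw [hmX]
    simp only [emp, g, Finset.sum_sub_distrib, Finset.sum_const, Finset.card_range, nsmul_eq_mul]
    rw [Finset.sum_comm, Finset.mul_sum, ← Finset.sum_sub_distrib, Finset.mul_sum]
    refine Finset.sum_congr rfl fun t _ => ?_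
    rw [← Finset.mul_sum]
    simp only [ind]
    ring
  -- The coefficients are already absorbed in `g`, so the argument `1` is enough.
  have hcf := ProbabilityMeasure.tendsto_iff_tendsto_charFun.1 hclt.tendsto 1
  have hm : ∀ n : ℕ, Measurable fun ω => (√(n : ℝ))⁻¹ *
      (∑ k ∈ Finset.range n, g (X k ω) - n * ∫ ω, g (X 0 ω) ∂μ) := fun n =>
    ((Finset.measurable_fun_sum _ fun i _ => hg.comp (hX i)).sub_const _).const_mul _
  have e1 : ∀ n : ℕ, charFun (μ.map fun ω => (√(n : ℝ))⁻¹ *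
      (∑ k ∈ Finset.range n, g (X k ω) - n * ∫ ω, g (X 0 ω) ∂μ)) 1 =
      ∫ ω, Complex.exp (((∑ t ∈ I, a t * emp Q X n ω (A t) : ℝ) : ℂ) * Complex.I) ∂μ := fun n => by
    rw [charFun_apply_real, integral_map (hm n).aemeasurable (by fun_prop)]
    simp only [hsum, Complex.ofReal_one, one_mul]
  have e2 : charFun ((gaussianReal 0 Var[fun ω => g (X 0 ω); μ].toNNReal).map id) 1 =
      ((Real.exp (-(quadForm (fun s t => covariance (ind s) (ind t) Q) I a / 2)) : ℝ) : ℂ) := by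
    rw [Measure.map_id, charFun_gaussianReal, hvX, hvar.symm, Complex.ofReal_exp,
      Real.coe_toNNReal _ (variance_nonneg _ _)]
    congr 1
    push_cast
    ring
  simp only [ProbabilityMeasure.coe_mk] at hcf
  rw [← e2]
  refine Tendsto.congr (fun n => e1 n) ?_
  exact hcf

end EmpiricalProcess

/-! ### Bracketing lower sets of the line by their mass -/

section LowerBrackets

variable (P : Measure ℝ) [IsProbabilityMeasure P]

lemma measurableSet_lowerSet (D : LowerSet ℝ) : MeasurableSet (D : Set ℝ) :=
  D.lower.ordConnected.measurableSet

/-- The intersection of the lower sets of measure at least `w`. -/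
def loBracket (w : ℝ) : LowerSet ℝ := sInf {D | w ≤ P.real (D : Set ℝ)}

/-- The union of the lower sets of measure less than `w`. -/
def hiBracket (w : ℝ) : LowerSet ℝ := sSup {D | P.real (D : Set ℝ) < w}

lemma exists_isCompact_lt {A : Set ℝ} (hA : MeasurableSet A) {r : ℝ} (hr : 0 ≤ r)
    (h : r < P.real A) : ∃ K ⊆ A, IsCompact K ∧ r < P.real K := by
  have h1 : ENNReal.ofReal r < P A := by
    rw [← ofReal_measureReal]
    exact (ENNReal.ofReal_lt_ofReal_iff_of_nonneg hr).2 h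
  obtain ⟨K, hKA, hK, hlt⟩ := hA.exists_lt_isCompact h1
  refine ⟨K, hKA, hK, ?_⟩
  rw [← ofReal_measureReal] at hlt
  exact (ENNReal.ofReal_lt_ofReal_iff_of_nonneg hr).1 hlt

/-- The union may be uncountable, but a nonempty compact subset has a greatest element, which lies
in one member of the family; that member, being lower, contains the whole compact set. Inner
regularity concludes. -/
lemma real_hiBracket_le {w : ℝ} (hw : 0 ≤ w) : P.real (hiBracket P w : Set ℝ) ≤ w := by
  by_contra! hcon
  obtain ⟨K, hKA, hK, hlt⟩ := exists_isCompact_lt P (measurableSet_lowerSet _) hw hcon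
  have hne : K.Nonempty := by
    rw [Set.nonempty_iff_ne_empty]
    rintro rfl
    rw [measureReal_empty] at hlt
    linarith
  obtain ⟨x, hxK, hx⟩ := hK.exists_isGreatest hne
  have hmem := hKA hxK
  simp only [hiBracket, LowerSet.coe_sSup, Set.mem_iUnion₂] at hmem
  obtain ⟨D, hD, hxD⟩ := hmem
  have hsub : K ⊆ (D : Set ℝ) := fun y hy => D.lower (hx hy) hxD
  exact absurd (hlt.trans_le (measureReal_mono hsub)) (not_lt.2 (le_of_lt hD))

/-- The dual argument on complements: the least element of a compact subset of the complement avoids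
one member of the family, hence so does the compact set. -/
lemma le_real_loBracket {w : ℝ} (hw : w ≤ 1) : w ≤ P.real (loBracket P w : Set ℝ) := by
  by_contra! hcon
  have hm := measurableSet_lowerSet (loBracket P w)
  have h1 : 1 - w < P.real (loBracket P w : Set ℝ)ᶜ := by
    rw [probReal_compl_eq_one_sub hm]
    linarith
  obtain ⟨K, hKA, hK, hlt⟩ := exists_isCompact_lt P hm.compl (by linarith) h1
  have hne : K.Nonempty := by
    rw [Set.nonempty_iff_ne_empty]
    rintro rfl
    rw [measureReal_empty] at hlt
    linarith
  obtain ⟨x, hxK, hx⟩ := hK.exists_isLeast hne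
  have hmem := hKA hxK
  simp only [loBracket, LowerSet.coe_sInf, Set.mem_compl_iff, Set.mem_iInter₂, not_forall] at hmem
  obtain ⟨D, hD, hxD⟩ := hmem
  have hsub : K ⊆ (D : Set ℝ)ᶜ := fun y hy hyD => hxD (D.lower (hx hy) hyD)
  have h2 := hlt.trans_le (measureReal_mono (μ := P) hsub)
  rw [probReal_compl_eq_one_sub (measurableSet_lowerSet D)] at h2
  have h3 : w ≤ P.real (D : Set ℝ) := hD
  linarith

/-- The index of the cell of a lower set at mesh `δ`. -/
def cellIndex (δ : ℝ) (D : LowerSet ℝ) : ℕ := ⌊P.real (D : Set ℝ) / δ⌋₊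

variable {P}

lemma cellIndex_bounds {δ : ℝ} (hδ : 0 < δ) (D : LowerSet ℝ) :
    cellIndex P δ D * δ ≤ P.real (D : Set ℝ) ∧
      P.real (D : Set ℝ) < (cellIndex P δ D + 1) * δ := by
  have h0 : 0 ≤ P.real (D : Set ℝ) / δ := by positivity
  constructor
  · rw [← le_div_iff₀ hδ]
    exact Nat.floor_le h0
  · rw [← div_lt_iff₀ hδ]
    exact Nat.lt_floor_add_one _

/-- The lower bracket of a lower set at mesh `δ`. -/
lemma loBracket_bounds {δ : ℝ} (hδ : 0 < δ) (D : LowerSet ℝ) :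
    loBracket P (cellIndex P δ D * δ) ≤ D ∧
      P.real (D : Set ℝ) - δ ≤ P.real (loBracket P (cellIndex P δ D * δ) : Set ℝ) ∧
      P.real (loBracket P (cellIndex P δ D * δ) : Set ℝ) ≤ P.real (D : Set ℝ) := by
  obtain ⟨h1, h2⟩ := cellIndex_bounds (P := P) hδ D
  have h3 : loBracket P (cellIndex P δ D * δ) ≤ D := sInf_le h1
  refine ⟨h3, ?_, measureReal_mono h3⟩
  have h4 := le_real_loBracket P (h1.trans measureReal_le_one)
  linarith

/-- The upper bracket of a lower set at mesh `δ`. -/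
lemma hiBracket_bounds {δ : ℝ} (hδ : 0 < δ) (D : LowerSet ℝ) :
    D ≤ hiBracket P ((cellIndex P δ D + 1) * δ) ∧
      P.real (hiBracket P ((cellIndex P δ D + 1) * δ) : Set ℝ) ≤
        P.real (loBracket P (cellIndex P δ D * δ) : Set ℝ) + δ := by
  obtain ⟨h1, h2⟩ := cellIndex_bounds (P := P) hδ D
  refine ⟨le_sSup h2, ?_⟩
  have h3 := real_hiBracket_le P (w := (cellIndex P δ D + 1) * δ) (by positivity)
  have h4 := le_real_loBracket P (h1.trans measureReal_le_one)
  linarith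

/-- Lower sets of the line are totally ordered by inclusion, so one of the two differences is empty.
-/
lemma real_diff_lowerSet (D D' : LowerSet ℝ) :
    P.real ((D : Set ℝ) \ D') + P.real ((D' : Set ℝ) \ D) =
      |P.real (D : Set ℝ) - P.real (D' : Set ℝ)| := by
  have key : ∀ A B : LowerSet ℝ, (A : Set ℝ) ⊆ B →
      P.real ((A : Set ℝ) \ B) + P.real ((B : Set ℝ) \ A) =
      |P.real (A : Set ℝ) - P.real (B : Set ℝ)| := fun A B h => by
    rw [Set.sdiff_eq_empty.2 h, measureReal_empty, zero_add,
      measureReal_sdiff h (measurableSet_lowerSet A), abs_sub_comm, abs_of_nonneg]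
    exact sub_nonneg.2 (measureReal_mono h)
  rcases D.lower.total D'.lower with h | h
  · exact key D D' h
  · rw [add_comm, abs_sub_comm]
    exact key D' D h

end LowerBrackets

/-! ### Rectangles with lower sides and their brackets -/

section Rectangles

/-- Pairs of lower sets of the line. -/
abbrev LowerPair : Type := LowerSet ℝ × LowerSet ℝ

/-- The rectangle with lower sets as sides. -/
def rect (t : LowerPair) : Set (ℝ × ℝ) := (t.1 : Set ℝ) ×ˢ (t.2 : Set ℝ)

lemma measurableSet_rect (t : LowerPair) : MeasurableSet (rect t) :=
  (measurableSet_lowerSet t.1).prod (measurableSet_lowerSet t.2)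

lemma rect_mono {s t : LowerPair} (h1 : s.1 ≤ t.1) (h2 : s.2 ≤ t.2) : rect s ⊆ rect t :=
  Set.prod_mono h1 h2

variable (Q : Measure (ℝ × ℝ)) [IsProbabilityMeasure Q]

/-- A point of one rectangle outside the other fails in at least one coordinate, so its marginal
lies in a difference of sides. No product structure of `Q` is used. -/
lemma real_rect_diff_le (s t : LowerPair) :
    Q.real (rect s \ rect t) + Q.real (rect t \ rect s) ≤
      |(Q.map Prod.fst).real (s.1 : Set ℝ) - (Q.map Prod.fst).real (t.1 : Set ℝ)| +
      |(Q.map Prod.snd).real (s.2 : Set ℝ) - (Q.map Prod.snd).real (t.2 : Set ℝ)| := by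
  have : IsProbabilityMeasure (Q.map Prod.fst) :=
    Measure.isProbabilityMeasure_map measurable_fst.aemeasurable
  have : IsProbabilityMeasure (Q.map Prod.snd) :=
    Measure.isProbabilityMeasure_map measurable_snd.aemeasurable
  have key : ∀ s t : LowerPair, Q.real (rect s \ rect t) ≤
      (Q.map Prod.fst).real ((s.1 : Set ℝ) \ t.1) +
        (Q.map Prod.snd).real ((s.2 : Set ℝ) \ t.2) := fun s t => by
    rw [map_measureReal_apply measurable_fst
      ((measurableSet_lowerSet _).diff (measurableSet_lowerSet _)),
      map_measureReal_apply measurable_snd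
      ((measurableSet_lowerSet _).diff (measurableSet_lowerSet _))]
    refine (measureReal_mono ?_).trans (measureReal_union_le _ _)
    rintro ⟨x, y⟩ ⟨⟨hx, hy⟩, hn⟩
    by_cases h : x ∈ t.1
    · exact Or.inr ⟨hy, fun hy' => hn ⟨h, hy'⟩⟩
    · exact Or.inl ⟨hx, h⟩
  rw [← real_diff_lowerSet, ← real_diff_lowerSet]
  linarith [key s t, key t s]

variable {Q}

/-- The lower bracketing rectangle with cell indices `k` at mesh `δ`. -/
def loRect (Q : Measure (ℝ × ℝ)) (δ : ℝ) (k : ℕ × ℕ) : LowerPair :=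
  (loBracket (Q.map Prod.fst) (k.1 * δ), loBracket (Q.map Prod.snd) (k.2 * δ))

/-- The upper bracketing rectangle with cell indices `k` at mesh `δ`. -/
def hiRect (Q : Measure (ℝ × ℝ)) (δ : ℝ) (k : ℕ × ℕ) : LowerPair :=
  (hiBracket (Q.map Prod.fst) ((k.1 + 1) * δ), hiBracket (Q.map Prod.snd) ((k.2 + 1) * δ))

/-- The cell indices of a pair of lower sets at mesh `δ`. -/
def cellPair (Q : Measure (ℝ × ℝ)) (δ : ℝ) (t : LowerPair) : ℕ × ℕ :=
  (cellIndex (Q.map Prod.fst) δ t.1, cellIndex (Q.map Prod.snd) δ t.2)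

lemma cellIndex_le {P : Measure ℝ} [IsProbabilityMeasure P] {N : ℕ} (hN : 0 < N) (D : LowerSet ℝ) :
    cellIndex P (1 / N) D ≤ N := by
  refine Nat.floor_le_of_le ?_
  rw [div_div_eq_mul_div, div_one]
  exact mul_le_of_le_one_left (by positivity) measureReal_le_one

lemma cellPair_mem (N : ℕ) (hN : 0 < N) (t : LowerPair) :
    cellPair Q (1 / N) t ∈ Finset.range (N + 1) ×ˢ Finset.range (N + 1) := by
  have : IsProbabilityMeasure (Q.map Prod.fst) :=
    Measure.isProbabilityMeasure_map measurable_fst.aemeasurable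
  have : IsProbabilityMeasure (Q.map Prod.snd) :=
    Measure.isProbabilityMeasure_map measurable_snd.aemeasurable
  rw [Finset.mem_product, Finset.mem_range, Finset.mem_range]
  exact ⟨Nat.lt_succ_of_le (cellIndex_le hN _), Nat.lt_succ_of_le (cellIndex_le hN _)⟩

/-- The counting part is monotone in the set and is squeezed by the brackets; only the centering
costs, namely `√n` times the gap in mass. -/
lemma emp_sandwich {S Ω : Type*} [MeasurableSpace S] {Q : Measure S} {X : ℕ → Ω → S} {n : ℕ}
    {ω : Ω} {A C B : Set S} (hAC : A ⊆ C) (hCB : C ⊆ B) [IsProbabilityMeasure Q] :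
    |emp Q X n ω C - emp Q X n ω A| ≤
      |emp Q X n ω B - emp Q X n ω A| + √(n : ℝ) * (Q.real B - Q.real A) := by
  have hs : (0 : ℝ) ≤ (√(n : ℝ))⁻¹ := by positivity
  have hns : (√(n : ℝ))⁻¹ * n = √(n : ℝ) := by
    rcases Nat.eq_zero_or_pos n with rfl | hn
    · simp
    · have hs : 0 < √(n : ℝ) := Real.sqrt_pos.2 (by exact_mod_cast hn)
      rw [inv_mul_eq_iff_eq_mul₀ hs.ne', Real.mul_self_sqrt (Nat.cast_nonneg n)]
  have hemp : ∀ D : Set S, emp Q X n ω D = (√(n : ℝ))⁻¹ *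
      (∑ i ∈ Finset.range n, D.indicator (fun _ => (1 : ℝ)) (X i ω)) - √(n : ℝ) * Q.real D :=
    fun D => by
    rw [emp, Finset.sum_sub_distrib, mul_sub]
    simp only [Finset.sum_const, Finset.card_range, nsmul_eq_mul]
    rw [← mul_assoc, hns]
  have hm : ∀ {D E : Set S}, D ⊆ E → (√(n : ℝ))⁻¹ *
      (∑ i ∈ Finset.range n, D.indicator (fun _ => (1 : ℝ)) (X i ω)) ≤ (√(n : ℝ))⁻¹ *
      (∑ i ∈ Finset.range n, E.indicator (fun _ => (1 : ℝ)) (X i ω)) := fun {D E} h =>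
    mul_le_mul_of_nonneg_left (Finset.sum_le_sum fun i _ =>
      Set.indicator_le_indicator_of_subset h (fun _ => zero_le_one) _) hs
  have h1 := hm hAC
  have h2 := hm hCB
  have h3 : √(n : ℝ) * Q.real A ≤ √(n : ℝ) * Q.real C :=
    mul_le_mul_of_nonneg_left (measureReal_mono hAC) (Real.sqrt_nonneg _)
  have h4 : √(n : ℝ) * Q.real C ≤ √(n : ℝ) * Q.real B :=
    mul_le_mul_of_nonneg_left (measureReal_mono hCB) (Real.sqrt_nonneg _)
  have h5 := le_abs_self (emp Q X n ω B - emp Q X n ω A)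
  have h6 := abs_nonneg (emp Q X n ω B - emp Q X n ω A)
  rw [abs_le]
  rw [hemp B, hemp A] at h5 h6 ⊢
  rw [hemp C]
  constructor <;> linarith

end Rectangles

/-! ### Chaining over bracketing rectangles -/

section Chaining

variable {Ω : Type*} [MeasurableSpace Ω] {μ : Measure Ω}
  [IsProbabilityMeasure μ] {Q : Measure (ℝ × ℝ)} [IsProbabilityMeasure Q] {X : ℕ → Ω → ℝ × ℝ}

/-- The mesh at level `m`. -/
def mesh (m : ℕ) : ℝ := 1 / ((4 ^ m : ℕ) : ℝ)

lemma mesh_pos (m : ℕ) : 0 < mesh m := by unfold mesh; positivity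

lemma mesh_succ_le (m : ℕ) : mesh (m + 1) ≤ mesh m := by
  unfold mesh
  exact one_div_le_one_div_of_le (by positivity)
    (by exact_mod_cast Nat.pow_le_pow_right (by norm_num) (Nat.le_succ m))

/-- The increment allowed at level `m` of the chain. -/
def linkBound (m : ℕ) : ℝ := 10 * (m + 1) * (1 / 2) ^ m

/-- The probability bound at level `m` of the chain. -/
def badBound (m : ℕ) : ℝ := 24576 * Real.exp 4 * (1 / 4) ^ m

/-- Pairs of bracketing rectangles used at level `m` of the chain. -/
def linkIndex (m : ℕ) : Finset (Fin 3 × (ℕ × ℕ) × (ℕ × ℕ)) :=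
  Finset.univ ×ˢ
    ((Finset.range (4 ^ (m + 1) + 1) ×ˢ Finset.range (4 ^ (m + 1) + 1)) ×ˢ
      (Finset.range (4 ^ (m + 1) + 1) ×ˢ Finset.range (4 ^ (m + 1) + 1)))

/-- The second rectangle of a link. -/
def linkEnd (Q : Measure (ℝ × ℝ)) (m : ℕ) (i : Fin 3) (k : ℕ × ℕ) : LowerPair :=
  if i = 0 then loRect Q (mesh (m + 1)) k else if i = 1 then hiRect Q (mesh m) k
  else loRect Q (mesh m) k

/-- The event that some short link of level `m` has a large increment. -/
def badEvent (Q : Measure (ℝ × ℝ)) (X : ℕ → Ω → ℝ × ℝ) (n m : ℕ) : Set Ω :=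
  {ω | ∃ j ∈ linkIndex m,
    Q.real (rect (loRect Q (mesh m) j.2.1) \ rect (linkEnd Q m j.1 j.2.2)) +
      Q.real (rect (linkEnd Q m j.1 j.2.2) \ rect (loRect Q (mesh m) j.2.1)) ≤ 4 * mesh m ∧
    linkBound m < |emp Q X n ω (rect (loRect Q (mesh m) j.2.1)) -
      emp Q X n ω (rect (linkEnd Q m j.1 j.2.2))|}

/-- Bernstein with `θ = 2^m` makes the variance term `4` and the linear term `10 (m + 1)`. The
resulting factor `1024^{-m}` beats the number of links, of order `256^m`, and leaves `4^{-m}`. -/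
lemma measure_badEvent_le (hX : ∀ i, Measurable (X i)) (hind : iIndepFun X μ)
    (hlaw : ∀ i, μ.map (X i) = Q) {n m : ℕ} (hn : 0 < n) (hm : 2 * (2 : ℝ) ^ m ≤ √(n : ℝ)) :
    μ (badEvent Q X n m) ≤ ENNReal.ofReal (badBound m) := by
  refine (emp_family_tail hX hind hlaw (linkIndex m)
    (A := fun j => rect (loRect Q (mesh m) j.2.1)) (B := fun j => rect (linkEnd Q m j.1 j.2.2))
    (fun _ => measurableSet_rect _) (fun _ => measurableSet_rect _) hn
    (θ := 2 ^ m) (by positivity) hm (linkBound m)).trans (ENNReal.ofReal_le_ofReal ?_)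
  -- Three kinds of links, each with four indices in a range of size `4^(m+1) + 1`, which is at most
  -- `2 · 4^(m+1)`.
  have hcard : ((linkIndex m).card : ℝ) ≤ 3 * (4096 * 256 ^ m) := by
    have h1 : (linkIndex m).card = 3 * (4 ^ (m + 1) + 1) ^ 4 := by
      simp only [linkIndex, Finset.card_product, Finset.card_univ, Fintype.card_fin,
        Finset.card_range]
      ring
    have h2 : (4 ^ (m + 1) + 1) ^ 4 ≤ (2 * 4 ^ (m + 1)) ^ 4 := by
      refine Nat.pow_le_pow_left ?_ 4
      have : 1 ≤ 4 ^ (m + 1) := Nat.one_le_pow _ _ (by norm_num)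
      omega
    have h3 : (2 * 4 ^ (m + 1)) ^ 4 = 4096 * 256 ^ m := by
      rw [show 256 = 4 ^ 4 by norm_num, ← pow_mul, mul_comm 4 m, pow_mul]
      ring
    rw [h1]
    exact_mod_cast Nat.mul_le_mul_left 3 (h2.trans h3.le)
  have hexp : Real.exp (((2 : ℝ) ^ m) ^ 2 * (4 * mesh m) - 2 ^ m * linkBound m) ≤
      Real.exp 4 * (1 / 1024) ^ m := by
    have h1 : ((2 : ℝ) ^ m) ^ 2 * (4 * mesh m) = 4 := by
      rw [mesh, ← pow_mul, mul_comm m 2, pow_mul]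
      push_cast
      norm_num
      field_simp
    have h2 : (2 : ℝ) ^ m * linkBound m = 10 * (m + 1) := by
      rw [linkBound, one_div, inv_pow]
      field_simp
    rw [h1, h2, sub_eq_add_neg, Real.exp_add]
    refine mul_le_mul_of_nonneg_left ?_ (Real.exp_nonneg _)
    have h3 : (1024 : ℝ) ≤ Real.exp 10 := by
      have h4 : (2 : ℝ) ≤ Real.exp 1 := by linarith [Real.add_one_le_exp (1 : ℝ)]
      have h5 : Real.exp 10 = Real.exp 1 ^ 10 := by
        rw [← Real.exp_nat_mul]; norm_num
      rw [h5]
      calc (1024 : ℝ) = 2 ^ 10 := by norm_num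
        _ ≤ _ := by gcongr
    calc Real.exp (-(10 * (m + 1))) ≤ Real.exp (-(m * 10)) := by
          rw [Real.exp_le_exp]; linarith
      _ = (1 / Real.exp 10) ^ m := by
          rw [Real.exp_neg, Real.exp_nat_mul, one_div, inv_pow]
      _ ≤ (1 / 1024) ^ m := by gcongr
  calc ((linkIndex m).card : ℝ) *
        (2 * Real.exp (((2 : ℝ) ^ m) ^ 2 * (4 * mesh m) - 2 ^ m * linkBound m))
      ≤ (3 * (4096 * 256 ^ m)) * (2 * (Real.exp 4 * (1 / 1024) ^ m)) := by gcongr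
    _ = badBound m := by
      have h : (256 : ℝ) ^ m * (1 / 1024) ^ m = (1 / 4) ^ m := by
        rw [← mul_pow]; norm_num
      rw [badBound, ← h]
      ring

lemma summable_linkBound : Summable linkBound := by
  have h1 : Summable fun m : ℕ => (m : ℝ) ^ 1 * (1 / 2 : ℝ) ^ m :=
    summable_pow_mul_geometric_of_norm_lt_one 1 (by norm_num)
  have h2 : Summable fun m : ℕ => (1 / 2 : ℝ) ^ m := summable_geometric_two
  refine ((h1.add h2).mul_left 10).congr fun m => ?_
  rw [linkBound]
  ring

lemma summable_badBound : Summable badBound :=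
  (summable_geometric_of_lt_one (by norm_num) (by norm_num)).mul_left _

lemma linkBound_nonneg (m : ℕ) : 0 ≤ linkBound m := by unfold linkBound; positivity

lemma badBound_nonneg (m : ℕ) : 0 ≤ badBound m := by unfold badBound; positivity

lemma sum_Ico_le_tail {f : ℕ → ℝ} (hf : Summable f) (h0 : ∀ m, 0 ≤ f m) (a b : ℕ) :
    ∑ m ∈ Finset.Ico a b, f m ≤ ∑' k, f (k + a) := by
  rw [Finset.sum_Ico_eq_sum_range]
  refine le_trans (le_of_eq ?_) (((summable_nat_add_iff a).2 hf).sum_le_tsum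
    (Finset.range (b - a)) fun k _ => h0 _)
  exact Finset.sum_congr rfl fun k _ => by rw [add_comm]

lemma mesh_eq (m : ℕ) : mesh m = ((1 / 2) ^ m) ^ 2 := by
  rw [mesh, ← pow_mul, mul_comm m 2, pow_mul]
  push_cast
  rw [one_div, ← inv_pow]
  norm_num

/-- The marginal measures of the lower bracket approximate those of the set. -/
lemma loRect_bounds {δ : ℝ} (hδ : 0 < δ) (t : LowerPair) :
    rect (loRect Q δ (cellPair Q δ t)) ⊆ rect t ∧
    rect t ⊆ rect (hiRect Q δ (cellPair Q δ t)) ∧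
    (|(Q.map Prod.fst).real ((loRect Q δ (cellPair Q δ t)).1 : Set ℝ) -
        (Q.map Prod.fst).real (t.1 : Set ℝ)| ≤ δ ∧
      |(Q.map Prod.snd).real ((loRect Q δ (cellPair Q δ t)).2 : Set ℝ) -
        (Q.map Prod.snd).real (t.2 : Set ℝ)| ≤ δ) ∧
    (|(Q.map Prod.fst).real ((loRect Q δ (cellPair Q δ t)).1 : Set ℝ) -
        (Q.map Prod.fst).real ((hiRect Q δ (cellPair Q δ t)).1 : Set ℝ)| ≤ δ ∧
      |(Q.map Prod.snd).real ((loRect Q δ (cellPair Q δ t)).2 : Set ℝ) -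
        (Q.map Prod.snd).real ((hiRect Q δ (cellPair Q δ t)).2 : Set ℝ)| ≤ δ) := by
  have : IsProbabilityMeasure (Q.map Prod.fst) :=
    Measure.isProbabilityMeasure_map measurable_fst.aemeasurable
  have : IsProbabilityMeasure (Q.map Prod.snd) :=
    Measure.isProbabilityMeasure_map measurable_snd.aemeasurable
  obtain ⟨a1, a2, a3⟩ := loBracket_bounds (P := Q.map Prod.fst) hδ t.1
  obtain ⟨b1, b2, b3⟩ := loBracket_bounds (P := Q.map Prod.snd) hδ t.2
  obtain ⟨c1, c2⟩ := hiBracket_bounds (P := Q.map Prod.fst) hδ t.1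
  obtain ⟨d1, d2⟩ := hiBracket_bounds (P := Q.map Prod.snd) hδ t.2
  have c3 := measureReal_mono (μ := Q.map Prod.fst) (LowerSet.coe_subset_coe.2 (a1.trans c1))
  have d3 := measureReal_mono (μ := Q.map Prod.snd) (LowerSet.coe_subset_coe.2 (b1.trans d1))
  refine ⟨rect_mono a1 b1, rect_mono c1 d1, ⟨?_, ?_⟩, ⟨?_, ?_⟩⟩ <;>
    simp only [loRect, hiRect, cellPair] <;> rw [abs_le] <;> constructor <;> linarith

/-- Marginal distances of at most `2 mesh m` on both axes put the pair within the range `4 mesh m`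
over which the event quantifies. -/
lemma not_badEvent {n m : ℕ} {ω : Ω} (h : ω ∉ badEvent Q X n m) (i : Fin 3) (k k' : ℕ × ℕ)
    (hk : k ∈ Finset.range (4 ^ (m + 1) + 1) ×ˢ Finset.range (4 ^ (m + 1) + 1))
    (hk' : k' ∈ Finset.range (4 ^ (m + 1) + 1) ×ˢ Finset.range (4 ^ (m + 1) + 1))
    (h1 : |(Q.map Prod.fst).real ((loRect Q (mesh m) k).1 : Set ℝ) -
      (Q.map Prod.fst).real ((linkEnd Q m i k').1 : Set ℝ)| ≤ 2 * mesh m)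
    (h2 : |(Q.map Prod.snd).real ((loRect Q (mesh m) k).2 : Set ℝ) -
      (Q.map Prod.snd).real ((linkEnd Q m i k').2 : Set ℝ)| ≤ 2 * mesh m) :
    |emp Q X n ω (rect (loRect Q (mesh m) k)) - emp Q X n ω (rect (linkEnd Q m i k'))| ≤
      linkBound m := by
  by_contra hcon
  refine h ⟨(i, k, k'), ?_, ?_, not_le.1 hcon⟩
  · simp only [linkIndex, Finset.mem_product, Finset.mem_univ, true_and]
    simp only [Finset.mem_product] at hk hk'
    exact ⟨hk, hk'⟩
  · exact (real_rect_diff_le Q _ _).trans (by linarith)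

lemma cellPair_mem_mesh (m : ℕ) (t : LowerPair) :
    cellPair Q (mesh m) t ∈
      Finset.range (4 ^ (m + 1) + 1) ×ˢ Finset.range (4 ^ (m + 1) + 1) := by
  have h := cellPair_mem (Q := Q) (4 ^ m) (by positivity) t
  have h4 : 4 ^ m ≤ 4 ^ (m + 1) := Nat.pow_le_pow_right (by norm_num) (Nat.le_succ m)
  rw [Finset.mem_product, Finset.mem_range, Finset.mem_range] at h ⊢
  unfold mesh
  omega

/-- The brackets of consecutive levels are both close in mass to `t`, within `mesh m + mesh (m + 1)
≤ 2 mesh m` of each other on each axis. -/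
lemma chain_step {n m : ℕ} {ω : Ω} (h : ω ∉ badEvent Q X n m) (t : LowerPair) :
    |emp Q X n ω (rect (loRect Q (mesh m) (cellPair Q (mesh m) t))) -
      emp Q X n ω (rect (loRect Q (mesh (m + 1)) (cellPair Q (mesh (m + 1)) t)))| ≤
      linkBound m := by
  obtain ⟨-, -, ⟨h1, h2⟩, -⟩ := loRect_bounds (Q := Q) (mesh_pos m) t
  obtain ⟨-, -, ⟨h3, h4⟩, -⟩ := loRect_bounds (Q := Q) (mesh_pos (m + 1)) t
  have hm := mesh_succ_le m
  have hmem : cellPair Q (mesh (m + 1)) t ∈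
      Finset.range (4 ^ (m + 1) + 1) ×ˢ Finset.range (4 ^ (m + 1) + 1) :=
    cellPair_mem (4 ^ (m + 1)) (by positivity) t
  refine not_badEvent h 0 _ _ (cellPair_mem_mesh m t) hmem ?_ ?_
  · simp only [linkEnd, if_true]
    rw [abs_le] at h1 h3 ⊢
    constructor <;> linarith [h1.1, h1.2, h3.1, h3.2]
  · simp only [linkEnd, if_true]
    rw [abs_le] at h2 h4 ⊢
    constructor <;> linarith [h2.1, h2.2, h4.1, h4.2]

/-- The infinitely many rectangles of a cell are squeezed between its two brackets. The link joining
these controls the random part; the centering adds `√n` times their gap. -/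
lemma chain_end {n m : ℕ} {ω : Ω} (h : ω ∉ badEvent Q X n m) (t : LowerPair) :
    |emp Q X n ω (rect t) - emp Q X n ω (rect (loRect Q (mesh m) (cellPair Q (mesh m) t)))| ≤
      linkBound m + √(n : ℝ) * (2 * mesh m) := by
  obtain ⟨hA, hB, -, ⟨h1, h2⟩⟩ := loRect_bounds (Q := Q) (mesh_pos m) t
  have hmp := mesh_pos m
  refine (emp_sandwich hA hB).trans (add_le_add ?_ ?_)
  · rw [abs_sub_comm]
    refine not_badEvent h 1 _ _ (cellPair_mem_mesh m t) (cellPair_mem_mesh m t) ?_ ?_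
    · simp only [linkEnd, if_true]
      exact h1.trans (by linarith)
    · simp only [linkEnd, if_true]
      exact h2.trans (by linarith)
  · refine mul_le_mul_of_nonneg_left ?_ (Real.sqrt_nonneg _)
    have h3 := real_rect_diff_le Q (hiRect Q (mesh m) (cellPair Q (mesh m) t))
      (loRect Q (mesh m) (cellPair Q (mesh m) t))
    rw [measureReal_sdiff (hA.trans hB) (measurableSet_rect _)] at h3
    rw [abs_sub_comm] at h1 h2
    have h4 : 0 ≤ Q.real (rect (loRect Q (mesh m) (cellPair Q (mesh m) t)) \
      rect (hiRect Q (mesh m) (cellPair Q (mesh m) t))) := measureReal_nonneg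
    linarith

lemma chain_sum {n a b : ℕ} (hab : a ≤ b) {ω : Ω}
    (h : ∀ m ∈ Finset.Ico a b, ω ∉ badEvent Q X n m) (t : LowerPair) :
    |emp Q X n ω (rect (loRect Q (mesh a) (cellPair Q (mesh a) t))) -
      emp Q X n ω (rect (loRect Q (mesh b) (cellPair Q (mesh b) t)))| ≤
      ∑ m ∈ Finset.Ico a b, linkBound m := by
  induction b, hab using Nat.le_induction with
  | base => simp
  | succ b hab ih =>
    rw [Finset.sum_Ico_succ_top hab]
    have h1 := ih fun m hm => h m (by rw [Finset.mem_Ico] at hm ⊢; omega)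
    have h2 := chain_step (h b (by rw [Finset.mem_Ico]; omega)) t
    exact (abs_sub_le _ _ _).trans (add_le_add h1 h2)

/-- The last level of the chain: the first inequality admits the Bernstein parameter `2^M`, the
second makes `√n · mesh M` of order `n^{-1/2}`. -/
lemma exists_level {n : ℕ} (hn : 2 ≤ √(n : ℝ)) :
    ∃ M : ℕ, 2 * (2 : ℝ) ^ M ≤ √(n : ℝ) ∧ √(n : ℝ) < 4 * 2 ^ M := by
  obtain ⟨M, h1, h2⟩ := exists_nat_pow_near (x := √(n : ℝ) / 2) (y := 2) (by linarith) (by norm_num)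
  refine ⟨M, by linarith, ?_⟩
  rw [pow_succ] at h2
  linarith

/-- Asymptotic equicontinuity of the empirical process indexed by lower rectangles. -/
theorem emp_equicontinuous (hX : ∀ i, Measurable (X i)) (hind : iIndepFun X μ)
    (hlaw : ∀ i, μ.map (X i) = Q) (ε η : ℝ) (hε : 0 < ε) (hη : 0 < η) :
    ∃ δ > 0, ∀ᶠ n : ℕ in atTop,
      μ {ω | ∃ s t : LowerPair,
        |(Q.map Prod.fst).real (s.1 : Set ℝ) - (Q.map Prod.fst).real (t.1 : Set ℝ)| ≤ δ ∧
        |(Q.map Prod.snd).real (s.2 : Set ℝ) - (Q.map Prod.snd).real (t.2 : Set ℝ)| ≤ δ ∧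
        ε < |emp Q X n ω (rect s) - emp Q X n ω (rect t)|} ≤ ENNReal.ofReal η := by
  have hl : Tendsto (fun a => ∑' k, linkBound (k + a)) atTop (𝓝 0) := tendsto_sum_nat_add _
  have hb : Tendsto (fun a => ∑' k, badBound (k + a)) atTop (𝓝 0) := tendsto_sum_nat_add _
  -- The starting level is chosen so that the tails of both the allowed increments and the failure
  -- probabilities are small.
  obtain ⟨a, hla, hba⟩ := ((hl.eventually (gt_mem_nhds (show 0 < ε / 8 by positivity))).and
    (hb.eventually (gt_mem_nhds hη))).exists
  refine ⟨mesh a, mesh_pos a, ?_⟩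
  have hsqrt : Tendsto (fun n : ℕ => √(n : ℝ)) atTop atTop :=
    Real.tendsto_sqrt_atTop.comp tendsto_natCast_atTop_atTop
  filter_upwards [hsqrt.eventually_ge_atTop 2, hsqrt.eventually_ge_atTop (4 * 2 ^ a),
    hsqrt.eventually_ge_atTop (256 / ε), eventually_gt_atTop 0] with n hn2 hna hnε hn0
  obtain ⟨M, hM1, hM2⟩ := exists_level hn2
  have haM : a ≤ M := by
    have h : (2 : ℝ) ^ a < 2 ^ M := by linarith
    exact ((pow_lt_pow_iff_right₀ (by norm_num)).1 h).le
  have hsub : {ω | ∃ s t : LowerPair,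
        |(Q.map Prod.fst).real (s.1 : Set ℝ) - (Q.map Prod.fst).real (t.1 : Set ℝ)| ≤ mesh a ∧
        |(Q.map Prod.snd).real (s.2 : Set ℝ) - (Q.map Prod.snd).real (t.2 : Set ℝ)| ≤ mesh a ∧
        ε < |emp Q X n ω (rect s) - emp Q X n ω (rect t)|} ⊆
      ⋃ m ∈ Finset.Ico a (M + 1), badEvent Q X n m := by
    rintro ω ⟨s, t, hst1, hst2, hω⟩
    by_contra hcon
    simp only [Set.mem_iUnion, not_exists] at hcon
    have happ : ∀ t : LowerPair, |emp Q X n ω (rect t) -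
        emp Q X n ω (rect (loRect Q (mesh a) (cellPair Q (mesh a) t)))| ≤ ε / 4 := fun t => by
      have h1 := chain_end (hcon M (by rw [Finset.mem_Ico]; omega)) t
      have h2 := chain_sum haM (fun m hm => hcon m (by rw [Finset.mem_Ico] at hm ⊢; omega)) t
      rw [abs_sub_comm] at h2
      have h3 := sum_Ico_le_tail summable_linkBound linkBound_nonneg a (M + 1)
      rw [Finset.sum_Ico_succ_top haM] at h3
      -- From `√n < 4 · 2^M`, multiplying the left side by another `√n` gives at most `32`, while
      -- `√n ε ≥ 256`.
      have h4 : √(n : ℝ) * (2 * mesh M) ≤ ε / 8 := by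
        set x : ℝ := (1 / 2) ^ M with hx
        have hxpos : 0 < x := by positivity
        have hx2 : x * 2 ^ M = 1 := by rw [hx, ← mul_pow]; norm_num
        have h5 : √(n : ℝ) * x ≤ 4 := by nlinarith
        have hsp : 0 < √(n : ℝ) := by linarith
        have h6 : 256 ≤ √(n : ℝ) * ε := by rwa [div_le_iff₀ hε] at hnε
        rw [mesh_eq, ← hx]
        have h7 : √(n : ℝ) * (√(n : ℝ) * (2 * x ^ 2)) ≤ √(n : ℝ) * (ε / 8) := by
          have : (√(n : ℝ) * x) * (√(n : ℝ) * x) ≤ 4 * 4 := by gcongr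
          nlinarith
        exact le_of_mul_le_mul_left h7 hsp
      have h8 := abs_sub_le (emp Q X n ω (rect t))
        (emp Q X n ω (rect (loRect Q (mesh M) (cellPair Q (mesh M) t))))
        (emp Q X n ω (rect (loRect Q (mesh a) (cellPair Q (mesh a) t))))
      linarith
    -- Close rectangles may lie in different cells; the third kind of link joins their lower
    -- brackets, which differ by at most `2 mesh a` on each axis.
    have hadj : |emp Q X n ω (rect (loRect Q (mesh a) (cellPair Q (mesh a) s))) -
        emp Q X n ω (rect (loRect Q (mesh a) (cellPair Q (mesh a) t)))| ≤ linkBound a := by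
      have : IsProbabilityMeasure (Q.map Prod.fst) :=
        Measure.isProbabilityMeasure_map measurable_fst.aemeasurable
      have : IsProbabilityMeasure (Q.map Prod.snd) :=
        Measure.isProbabilityMeasure_map measurable_snd.aemeasurable
      obtain ⟨-, a2, a3⟩ := loBracket_bounds (P := Q.map Prod.fst) (mesh_pos a) s.1
      obtain ⟨-, b2, b3⟩ := loBracket_bounds (P := Q.map Prod.fst) (mesh_pos a) t.1
      obtain ⟨-, c2, c3⟩ := loBracket_bounds (P := Q.map Prod.snd) (mesh_pos a) s.2
      obtain ⟨-, d2, d3⟩ := loBracket_bounds (P := Q.map Prod.snd) (mesh_pos a) t.2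
      rw [abs_le] at hst1 hst2
      have hne : ∀ k, linkEnd Q a 2 k = loRect Q (mesh a) k := fun k => rfl
      have h := not_badEvent (hcon a (by rw [Finset.mem_Ico]; omega)) 2 (cellPair Q (mesh a) s)
        (cellPair Q (mesh a) t) (cellPair_mem_mesh a s) (cellPair_mem_mesh a t)
        (by
          rw [hne]
          simp only [loRect, cellPair]
          rw [abs_le]
          constructor <;> linarith [hst1.1, hst1.2])
        (by
          rw [hne]
          simp only [loRect, cellPair]
          rw [abs_le]
          constructor <;> linarith [hst2.1, hst2.2])
      rwa [hne] at h
    have hla' : linkBound a ≤ ε / 8 := by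
      have h3 := sum_Ico_le_tail summable_linkBound linkBound_nonneg a (a + 1)
      rw [Nat.Ico_succ_singleton, Finset.sum_singleton] at h3
      linarith
    have hs := happ s
    have ht := happ t
    rw [abs_le] at hs ht hadj
    have : |emp Q X n ω (rect s) - emp Q X n ω (rect t)| ≤ ε := by
      rw [abs_le]
      constructor <;> linarith [hs.1, hs.2, ht.1, ht.2, hadj.1, hadj.2]
    linarith
  refine (measure_mono hsub).trans ((measure_biUnion_finset_le _ _).trans ?_)
  calc ∑ m ∈ Finset.Ico a (M + 1), μ (badEvent Q X n m)
      ≤ ∑ m ∈ Finset.Ico a (M + 1), ENNReal.ofReal (badBound m) := by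
        refine Finset.sum_le_sum fun m hm => measure_badEvent_le hX hind hlaw hn0 ?_
        refine le_trans ?_ hM1
        gcongr
        · norm_num
        · have := (Finset.mem_Ico.1 hm).2
          omega
    _ = ENNReal.ofReal (∑ m ∈ Finset.Ico a (M + 1), badBound m) :=
        (ENNReal.ofReal_sum_of_nonneg fun m _ => badBound_nonneg m).symm
    _ ≤ ENNReal.ofReal η := ENNReal.ofReal_le_ofReal
        ((sum_Ico_le_tail summable_badBound badBound_nonneg _ _).trans hba.le)

end Chaining

/-! ### Donsker's theorem for lower rectangles -/

section CoreDonsker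

variable {Ω : Type*} [MeasurableSpace Ω] {μ : Measure Ω}
  [IsProbabilityMeasure μ] {Q : Measure (ℝ × ℝ)} [IsProbabilityMeasure Q] {X : ℕ → Ω → ℝ × ℝ}

/-- The dyadic partitions of the pairs of lower sets according to their marginal measures. -/
def dyadicCell (Q : Measure (ℝ × ℝ)) (m : ℕ) (t : LowerPair) : ℕ × ℕ :=
  cellPair Q (1 / ((2 ^ m : ℕ) : ℝ)) t

lemma finite_range_dyadicCell (m : ℕ) : (Set.range (dyadicCell Q m)).Finite := by
  refine (Finset.finite_toSet (Finset.range (2 ^ m + 1) ×ˢ Finset.range (2 ^ m + 1))).subset ?_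
  rintro _ ⟨t, rfl⟩
  exact cellPair_mem (2 ^ m) (by positivity) t

/-- For dyadic meshes the coarse index is the integer quotient of the fine one by a power of two. -/
lemma cellIndex_nested {P : Measure ℝ} {i j : ℕ} (hij : i ≤ j) {D D' : LowerSet ℝ}
    (h : cellIndex P (1 / ((2 ^ j : ℕ) : ℝ)) D = cellIndex P (1 / ((2 ^ j : ℕ) : ℝ)) D') :
    cellIndex P (1 / ((2 ^ i : ℕ) : ℝ)) D = cellIndex P (1 / ((2 ^ i : ℕ) : ℝ)) D' := by
  have key : ∀ D : LowerSet ℝ, cellIndex P (1 / ((2 ^ i : ℕ) : ℝ)) D =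
      cellIndex P (1 / ((2 ^ j : ℕ) : ℝ)) D / 2 ^ (j - i) := fun D => by
    rw [cellIndex, cellIndex, ← Nat.floor_div_natCast]
    congr 1
    have h2 : ((2 ^ j : ℕ) : ℝ) = ((2 ^ i : ℕ) : ℝ) * ((2 ^ (j - i) : ℕ) : ℝ) := by
      rw [← Nat.cast_mul, ← pow_add, Nat.add_sub_cancel' hij]
    rw [h2]
    have h3 : (0 : ℝ) < ((2 ^ i : ℕ) : ℝ) := by positivity
    have h4 : (0 : ℝ) < ((2 ^ (j - i) : ℕ) : ℝ) := by positivity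
    field_simp
  rw [key, key, h]

lemma dyadicCell_nested (i j : ℕ) (hij : i ≤ j) (s t : LowerPair)
    (h : dyadicCell Q j s = dyadicCell Q j t) : dyadicCell Q i s = dyadicCell Q i t := by
  simp only [dyadicCell, cellPair, Prod.mk.injEq] at h ⊢
  exact ⟨cellIndex_nested hij h.1, cellIndex_nested hij h.2⟩

lemma abs_sub_le_of_cellIndex_eq {P : Measure ℝ} [IsProbabilityMeasure P] {δ : ℝ} (hδ : 0 < δ)
    {D D' : LowerSet ℝ} (h : cellIndex P δ D = cellIndex P δ D') :
    |P.real (D : Set ℝ) - P.real (D' : Set ℝ)| ≤ δ := by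
  obtain ⟨h1, h2⟩ := cellIndex_bounds (P := P) hδ D
  obtain ⟨h3, h4⟩ := cellIndex_bounds (P := P) hδ D'
  rw [h] at h1 h2
  rw [abs_le]
  constructor <;> linarith

lemma abs_sub_le_of_dyadicCell_eq {m : ℕ} {s t : LowerPair}
    (h : dyadicCell Q m s = dyadicCell Q m t) :
    |(Q.map Prod.fst).real (s.1 : Set ℝ) - (Q.map Prod.fst).real (t.1 : Set ℝ)| ≤ (1 / 2) ^ m ∧
    |(Q.map Prod.snd).real (s.2 : Set ℝ) - (Q.map Prod.snd).real (t.2 : Set ℝ)| ≤ (1 / 2) ^ m := by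
  have : IsProbabilityMeasure (Q.map Prod.fst) :=
    Measure.isProbabilityMeasure_map measurable_fst.aemeasurable
  have : IsProbabilityMeasure (Q.map Prod.snd) :=
    Measure.isProbabilityMeasure_map measurable_snd.aemeasurable
  have h2 : (1 : ℝ) / ((2 ^ m : ℕ) : ℝ) = (1 / 2) ^ m := by push_cast; rw [one_div_pow]
  simp only [dyadicCell, cellPair, Prod.mk.injEq] at h
  rw [← h2]
  exact ⟨abs_sub_le_of_cellIndex_eq (by positivity) h.1,
    abs_sub_le_of_cellIndex_eq (by positivity) h.2⟩

lemma emp_oscillation (hX : ∀ i, Measurable (X i)) (hind : iIndepFun X μ)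
    (hlaw : ∀ i, μ.map (X i) = Q) (ε η : ℝ) (hε : 0 < ε) (hη : 0 < η) :
    ∃ m, ∀ᶠ n : ℕ in atTop, μ {ω | ∃ s t : LowerPair, dyadicCell Q m s = dyadicCell Q m t ∧
      ε < |emp Q X n ω (rect s) - emp Q X n ω (rect t)|} ≤ ENNReal.ofReal η := by
  obtain ⟨δ, hδ, h⟩ := emp_equicontinuous hX hind hlaw ε η hε hη
  obtain ⟨m, hm⟩ := exists_pow_lt_of_lt_one hδ (by norm_num : (1 / 2 : ℝ) < 1)
  refine ⟨m, h.mono fun n hn => (measure_mono ?_).trans hn⟩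
  rintro ω ⟨s, t, hst, hω⟩
  obtain ⟨h1, h2⟩ := abs_sub_le_of_dyadicCell_eq hst
  exact ⟨s, t, h1.trans hm.le, h2.trans hm.le, hω⟩

/-- The empirical process indexed by lower rectangles is uniformly bounded in probability. -/
theorem emp_bounded (hX : ∀ i, Measurable (X i)) (hind : iIndepFun X μ)
    (hlaw : ∀ i, μ.map (X i) = Q) (η : ℝ) (hη : 0 < η) :
    ∃ R > 0, ∀ᶠ n : ℕ in atTop,
      μ {ω | ∃ t : LowerPair, R < |emp Q X n ω (rect t)|} ≤ ENNReal.ofReal η := by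
  obtain ⟨m, hm⟩ := emp_oscillation hX hind hlaw 1 (η / 2) one_pos (half_pos hη)
  set G := cellReps (finite_range_dyadicCell (Q := Q) m) with hG
  -- Chebyshev at each of the finitely many representatives then costs at most `η / 2` in total.
  set R : ℝ := √(2 * G.card / η) + 1 with hR
  have hRpos : 0 < R := by positivity
  have hRb : G.card * (1 / R ^ 2) ≤ η / 2 := by
    have h1 : 2 * G.card / η ≤ R ^ 2 := by
      have h2 := Real.sq_sqrt (show 0 ≤ 2 * G.card / η by positivity)
      rw [hR]
      nlinarith [Real.sqrt_nonneg (2 * G.card / η)]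
    rw [div_le_iff₀ hη] at h1
    rw [mul_one_div, div_le_iff₀ (by positivity)]
    linarith
  refine ⟨R + 1, by positivity, hm.mono fun n hn => ?_⟩
  have hsub : {ω | ∃ t : LowerPair, R + 1 < |emp Q X n ω (rect t)|} ⊆
      {ω | ∃ s t : LowerPair, dyadicCell Q m s = dyadicCell Q m t ∧
        1 < |emp Q X n ω (rect s) - emp Q X n ω (rect t)|} ∪
      ⋃ r ∈ G, {ω | R < |emp Q X n ω (rect r)|} := by
    rintro ω ⟨t, ht⟩
    by_contra hcon
    simp only [Set.mem_union, Set.mem_iUnion, Set.mem_ofPred_eq, not_or, not_exists, not_and,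
      not_lt] at hcon
    have h1 := hcon.1 t (cellRep (dyadicCell Q m) t) (cellRep_spec _ _).symm
    have h2 := hcon.2 _ (cellRep_mem (finite_range_dyadicCell (Q := Q) m) t)
    have h3 := abs_sub_abs_le_abs_sub (emp Q X n ω (rect t))
      (emp Q X n ω (rect (cellRep (dyadicCell Q m) t)))
    linarith
  refine (measure_mono hsub).trans ((measure_union_le _ _).trans ?_)
  have h2 : μ (⋃ r ∈ G, {ω | R < |emp Q X n ω (rect r)|}) ≤ ENNReal.ofReal (η / 2) := by
    refine (measure_biUnion_finset_le _ _).trans ?_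
    refine (Finset.sum_le_sum fun r _ => emp_chebyshev hX hind n hlaw (measurableSet_rect r)
      hRpos).trans ?_
    rw [Finset.sum_const, nsmul_eq_mul, ← ENNReal.ofReal_natCast,
      ← ENNReal.ofReal_mul (by positivity)]
    exact ENNReal.ofReal_le_ofReal hRb
  refine (add_le_add hn h2).trans ?_
  rw [← ENNReal.ofReal_add (by positivity) (by positivity), add_halves]

/-- The empirical process indexed by lower rectangles, with values in `ℓ^∞`. -/
def empEll (Q : Measure (ℝ × ℝ)) [IsProbabilityMeasure Q] (X : ℕ → Ω → ℝ × ℝ) (n : ℕ) (ω : Ω) :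
    EllInfty LowerPair :=
  mkEll (fun t => emp Q X n ω (rect t)) (√(n : ℝ)) fun t => abs_emp_le n ω (rect t)

/-- The covariance function of the Brownian bridge indexed by lower rectangles. -/
def rectCov (Q : Measure (ℝ × ℝ)) (s t : LowerPair) : ℝ :=
  covariance ((rect s).indicator fun _ => (1 : ℝ)) ((rect t).indicator fun _ => (1 : ℝ)) Q

/-- Donsker's theorem for lower rectangles. -/
theorem empEll_weaklyConverges (hX : ∀ i, Measurable (X i)) (hind : iIndepFun X μ)
    (hlaw : ∀ i, μ.map (X i) = Q) :
    ∃ L : Measure (EllInfty LowerPair), IsTightGaussianLaw L (rectCov Q) ∧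
      WeaklyConvergesTo μ (empEll Q X) L := by
  refine exists_tightGaussianLaw_weaklyConvergesTo (κ := dyadicCell Q) (C := 1)
    (fun s t => covariance_comm _ _) (fun n t => measurable_emp hX n (measurableSet_rect t))
    zero_le_one (fun n t R hR => emp_chebyshev hX hind n hlaw (measurableSet_rect t) hR)
    (fun I a => tendsto_cexp_emp hX hind hlaw rect measurableSet_rect I a)
    finite_range_dyadicCell dyadicCell_nested fun ε hε => ?_
  obtain ⟨m, hm⟩ := emp_oscillation hX hind hlaw ε ε hε hε
  refine ⟨m, hm.mono fun n hn => (measure_mono ?_).trans hn⟩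
  intro ω hω
  by_contra hcon
  simp only [Set.mem_ofPred_eq, not_exists, not_and, not_lt] at hcon
  exact hω fun s t hst => hcon s t hst

end CoreDonsker

/-! ### Images of tight Gaussian laws under combinations of coordinates -/

section Pushforward

variable {T Γ ι : Type*} [Fintype ι]

/-- A tight Gaussian law is mapped to a tight Gaussian law by combinations of coordinates. -/
lemma IsTightGaussianLaw.map_ellComb {L : Measure (EllInfty T)} {K : T → T → ℝ}
    (h : IsTightGaussianLaw L K) (σ : ι → Γ → T) (c : ι → Γ → ℝ) (C : ℝ)
    (hc : ∀ i γ, |c i γ| ≤ C) :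
    IsTightGaussianLaw (L.map (ellComb σ c C hc)) fun γ γ' =>
      ∑ i, ∑ j, c i γ * c j γ' * K (σ i γ) (σ j γ') := by
  classical
  have := h.isProbabilityMeasure
  set A := ellComb σ c C hc with hA
  have hAm : Measurable A := A.continuous.measurable
  have hL2 : ∀ t, MemLp (fun z : EllInfty T => (z t : ℝ)) 2 L := fun t =>
    (h.gaussian.hasGaussianLaw_eval t).memLp_two
  refine ⟨Measure.isProbabilityMeasure_map hAm.aemeasurable, ?_, ⟨fun I => ⟨?_⟩⟩, fun γ => ?_,
    fun γ γ' => ?_⟩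
  · have := h.tight.map A.continuous
    simpa only [Set.image_singleton] using this
  · have hproc : IsGaussianProcess (fun (γ : Γ) (z : EllInfty T) => (A z γ : ℝ)) L := by
      refine IsGaussianProcess.of_isGaussianProcess h.gaussian fun γ => ?_
      refine ⟨Finset.univ.image fun i => σ i γ, ∑ i, c i γ • ContinuousLinearMap.proj
        (⟨σ i γ, by simp⟩ : (Finset.univ.image fun i => σ i γ : Finset T)), fun z => ?_⟩
      rw [hA, ellComb_apply]
      simp
    have h1 := (hproc.hasGaussianLaw I).isGaussian_map
    have hm : Measurable fun z : EllInfty Γ => I.restrict (fun γ => (z γ : ℝ)) :=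
      measurable_pi_lambda _ fun t => ell_measurable_eval t.1
    rw [Measure.map_map hm hAm]
    exact h1
  · rw [integral_map hAm.aemeasurable (ell_measurable_eval γ).aestronglyMeasurable]
    have e : ∀ z : EllInfty T, (A z γ : ℝ) = ∑ i, c i γ * (z (σ i γ) : ℝ) := fun z => by
      rw [hA, ellComb_apply]
    refine (integral_congr_ae (.of_forall e)).trans ?_
    refine (integral_finsetSum Finset.univ
      fun i _ => ((hL2 (σ i γ)).integrable (by norm_num)).const_mul (c i γ)).trans ?_
    refine Finset.sum_eq_zero fun i _ => ?_
    rw [integral_const_mul, h.mean_eq_zero, mul_zero]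
  · rw [covariance_map_fun (ell_measurable_eval γ).aestronglyMeasurable
      (ell_measurable_eval γ').aestronglyMeasurable hAm.aemeasurable]
    simp only [hA, ellComb_apply]
    rw [covariance_fun_sum_fun_sum (fun i => (hL2 _).const_mul _) fun i => (hL2 _).const_mul _]
    refine Finset.sum_congr rfl fun i _ => Finset.sum_congr rfl fun j _ => ?_
    rw [covariance_const_mul_left, covariance_const_mul_right, h.cov_eq]
    ring

end Pushforward

/-! ### Finite combinations of rectangle indicators -/

section RectangleCombinations

variable {Γ ι : Type*} [Fintype ι] {Q : Measure (ℝ × ℝ)} [IsProbabilityMeasure Q]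

/-- A combination of indicators of lower rectangles. -/
def rectComb (σ : ι → LowerPair) (c : ι → ℝ) (d : ℝ) (x : ℝ × ℝ) : ℝ :=
  ∑ i, c i * (rect (σ i)).indicator (fun _ => (1 : ℝ)) x + d

lemma measurable_rect_indicator (t : LowerPair) :
    Measurable ((rect t).indicator fun _ => (1 : ℝ)) :=
  measurable_const.indicator (measurableSet_rect t)

lemma memLp_rect_indicator (t : LowerPair) :
    MemLp ((rect t).indicator fun _ => (1 : ℝ)) 2 Q :=
  memLp_indicator_const 2 (measurableSet_rect t) 1 (Or.inr (measure_ne_top _ _))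

lemma measurable_rectComb (σ : ι → LowerPair) (c : ι → ℝ) (d : ℝ) :
    Measurable (rectComb σ c d) :=
  (Finset.measurable_fun_sum _ fun _ _ => (measurable_rect_indicator _).const_mul _).add_const _

lemma memLp_rectComb (σ : ι → LowerPair) (c : ι → ℝ) (d : ℝ) : MemLp (rectComb σ c d) 2 Q :=
  (memLp_finsetSum _ fun _ _ => (memLp_rect_indicator _).const_mul _).add (memLp_const d)

lemma covariance_rectComb (σ σ' : ι → LowerPair) (c c' : ι → ℝ) (d d' : ℝ) :
    covariance (rectComb σ c d) (rectComb σ' c' d') Q =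
      ∑ i, ∑ j, c i * c' j * rectCov Q (σ i) (σ' j) := by
  have hL : ∀ (σ : ι → LowerPair) (c : ι → ℝ),
      Integrable (fun x => ∑ i, c i * (rect (σ i)).indicator (fun _ => (1 : ℝ)) x) Q :=
    fun σ c => integrable_finsetSum _ fun i _ =>
      ((memLp_rect_indicator _).integrable (by norm_num)).const_mul _
  unfold rectComb
  rw [covariance_add_const_left (hL σ c), covariance_add_const_right (hL σ' c'),
    covariance_fun_sum_fun_sum (fun i => (memLp_rect_indicator _).const_mul _)
      fun i => (memLp_rect_indicator _).const_mul _]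
  refine Finset.sum_congr rfl fun i _ => Finset.sum_congr rfl fun j _ => ?_
  rw [covariance_const_mul_left, covariance_const_mul_right, rectCov]
  ring

lemma integral_rectComb (σ : ι → LowerPair) (c : ι → ℝ) (d : ℝ) (P : Measure (ℝ × ℝ))
    [IsProbabilityMeasure P] :
    ∫ x, rectComb σ c d x ∂P = ∑ i, c i * P.real (rect (σ i)) + d := by
  unfold rectComb
  have hi : ∀ i, Integrable (fun x => c i * (rect (σ i)).indicator (fun _ => (1 : ℝ)) x) P :=
    fun i => ((memLp_rect_indicator _).integrable (by norm_num)).const_mul _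
  rw [integral_add (integrable_finsetSum _ fun i _ => hi i) (integrable_const _),
    integral_finsetSum _ fun i _ => hi i]
  simp only [integral_const_mul, integral_indicator_const _ (measurableSet_rect _), smul_eq_mul,
    mul_one, integral_const, probReal_univ, one_mul]

end RectangleCombinations

/-! ### The empirical process in terms of the empirical measure -/

section Empirical

variable {S : Type*} [MeasurableSpace S]

lemma empiricalMeasure_real (x : ℕ → S) {n : ℕ} (hn : n ≠ 0) {A : Set S} (hA : MeasurableSet A) :
    (empiricalMeasure x n).real A =
      (n : ℝ)⁻¹ * ∑ i ∈ Finset.range n, A.indicator (fun _ => (1 : ℝ)) (x i) := by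
  rw [empiricalMeasure, if_neg hn, measureReal_def, Measure.smul_apply, smul_eq_mul,
    Measure.finsetSum_apply, ENNReal.toReal_mul, ENNReal.toReal_inv, ENNReal.toReal_natCast,
    ENNReal.toReal_sum fun i _ => measure_ne_top _ _]
  congr 1
  refine Finset.sum_congr rfl fun i _ => ?_
  rw [Measure.dirac_apply' _ hA]
  by_cases h : x i ∈ A <;> simp [h]

lemma emp_eq {Ω : Type*} {X : ℕ → Ω → S} {Q : Measure S} (n : ℕ) (ω : Ω) {A : Set S}
    (hA : MeasurableSet A) :
    emp Q X n ω A =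
      √(n : ℝ) * ((empiricalMeasure (fun i => X i ω) n).real A - Q.real A) := by
  -- For `n = 0` both sides vanish through the factor `√0`, whatever the conventional empirical
  -- measure is.
  rcases eq_or_ne n 0 with rfl | hn
  · simp [emp]
  · rw [empiricalMeasure_real _ hn hA, emp, Finset.sum_sub_distrib, Finset.sum_const,
      Finset.card_range, nsmul_eq_mul]
    have hs : 0 < √(n : ℝ) := Real.sqrt_pos.2 (by exact_mod_cast Nat.pos_of_ne_zero hn)
    have hsq : (n : ℝ) = √(n : ℝ) * √(n : ℝ) := (Real.mul_self_sqrt (Nat.cast_nonneg n)).symm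
    have hn' : (n : ℝ) ≠ 0 := by exact_mod_cast hn
    rw [mul_sub, mul_sub]
    congr 1
    · rw [← mul_assoc]
      congr 1
      rw [eq_mul_inv_iff_mul_eq₀ hn', inv_mul_eq_iff_eq_mul₀ hs.ne']
      exact hsq
    · rw [← mul_assoc]
      congr 1
      rw [inv_mul_eq_iff_eq_mul₀ hs.ne']
      exact hsq

end Empirical

/-! ### Donsker's theorem for rectangle combinations -/

section CombinationDonsker

variable {Γ ι Ω : Type*} [Fintype ι] [MeasurableSpace Ω] {μ : Measure Ω}
  [IsProbabilityMeasure μ] {Q : Measure (ℝ × ℝ)} [IsProbabilityMeasure Q] {X : ℕ → Ω → ℝ × ℝ}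

/-- Weak convergence of the empirical process indexed by combinations of a fixed number of lower
rectangles with bounded coefficients. -/
theorem rectComb_weaklyConverges (hX : ∀ i, Measurable (X i)) (hind : iIndepFun X μ)
    (hlaw : ∀ i, μ.map (X i) = Q) (σ : ι → Γ → LowerPair) (c : ι → Γ → ℝ) (d : Γ → ℝ) (C : ℝ)
    (hc : ∀ i γ, |c i γ| ≤ C) :
    ∃ (L : Measure (EllInfty Γ)) (G : ℕ → Ω → EllInfty Γ),
      IsTightGaussianLaw L (fun γ γ' =>
        covariance (rectComb (fun i => σ i γ) (fun i => c i γ) (d γ))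
          (rectComb (fun i => σ i γ') (fun i => c i γ') (d γ')) Q) ∧
      (∀ n ω γ, G n ω γ = √(n : ℝ) *
        ((∫ x, rectComb (fun i => σ i γ) (fun i => c i γ) (d γ) x
            ∂(empiricalMeasure (fun i => X i ω) n)) -
          ∫ x, rectComb (fun i => σ i γ) (fun i => c i γ) (d γ) x ∂Q)) ∧
      WeaklyConvergesTo μ G L := by
  obtain ⟨L, hL, hw⟩ := empEll_weaklyConverges hX hind hlaw
  refine ⟨L.map (ellComb σ c C hc), fun n ω => ellComb σ c C hc (empEll Q X n ω), ?_, ?_,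
    hw.map (ellComb σ c C hc).continuous⟩
  · simp only [covariance_rectComb]
    exact hL.map_ellComb σ c C hc
  · intro n ω γ
    -- The additive constant cancels under centering, so `d` needs no bound.
    rw [ellComb_apply, integral_rectComb, integral_rectComb, add_sub_add_right_eq_sub,
      ← Finset.sum_sub_distrib, Finset.mul_sum]
    refine Finset.sum_congr rfl fun i _ => ?_
    rw [empEll, mkEll_apply, emp_eq n ω (measurableSet_rect _)]
    ring

end CombinationDonsker

/-! ### Rank indices and their projections as rectangle combinations -/

section RankIndicators

/-- The sublevel set of a distribution function. -/
def cdfLower (P : Measure ℝ) (s : ℝ) : LowerSet ℝ :=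
  ⟨{u | cdf P u ≤ s}, fun _ _ hba ha => (monotone_cdf P hba).trans ha⟩

@[simp] lemma mem_cdfLower {P : Measure ℝ} {s u : ℝ} : u ∈ cdfLower P s ↔ cdf P u ≤ s := Iff.rfl

/-- The rectangle of which `rankIndex γ α` is the indicator. -/
def rankPair (γ : ℝ × ℝ) (α : Marginals) : LowerPair :=
  (cdfLower α.1 γ.1, cdfLower α.2 γ.2)

/-- The rectangle of `rankIndex γ α` and the two strips that contain it. -/
def rankSides (γ : ℝ × ℝ) (α : Marginals) : Fin 3 → LowerPair :=
  ![rankPair γ α, ((rankPair γ α).1, ⊤), (⊤, (rankPair γ α).2)]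

instance instIsProbabilityMeasureProductLaw (α : Marginals) :
    IsProbabilityMeasure (productLaw α) := by
  unfold productLaw
  infer_instance

lemma productLaw_real_rect (α : Marginals) (t : LowerPair) :
    (productLaw α).real (rect t) =
      (α.1 : Measure ℝ).real (t.1 : Set ℝ) * (α.2 : Measure ℝ).real (t.2 : Set ℝ) :=
  measureReal_prod_prod _ _

lemma indicator_rect_apply (t : LowerPair) (x : ℝ × ℝ) :
    (rect t).indicator (fun _ => (1 : ℝ)) x =
      (t.1 : Set ℝ).indicator (fun _ => 1) x.1 * (t.2 : Set ℝ).indicator (fun _ => 1) x.2 := by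
  by_cases h1 : x.1 ∈ t.1 <;> by_cases h2 : x.2 ∈ t.2 <;> simp [rect, h1, h2]

lemma rankIndex_eq_indicator (γ : ℝ × ℝ) (α : Marginals) :
    rankIndex γ α = (rect (rankPair γ α)).indicator fun _ => (1 : ℝ) := by
  funext x
  by_cases h1 : cdf (α.1 : Measure ℝ) x.1 ≤ γ.1 <;>
    by_cases h2 : cdf (α.2 : Measure ℝ) x.2 ≤ γ.2 <;>
      simp [rankIndex, quadrant, rect, rankPair, h1, h2, Prod.le_def]

/-- The zero coefficients keep the same three rectangles for the index, its projection and their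
difference, so that covariances can be compared term by term. -/
lemma rankIndex_eq (γ : ℝ × ℝ) (α : Marginals) :
    rankIndex γ α = rectComb (rankSides γ α) ![1, 0, 0] 0 := by
  funext x
  simp [rankIndex_eq_indicator, rectComb, rankSides, Fin.sum_univ_three]

lemma integral_rankIndex (γ : ℝ × ℝ) (α : Marginals) (P : Measure (ℝ × ℝ)) :
    ∫ x, rankIndex γ α x ∂P = P.real (rect (rankPair γ α)) := by
  rw [rankIndex_eq_indicator, integral_indicator_const _ (measurableSet_rect _), smul_eq_mul,
    mul_one]

lemma rankProj_apply (α : Marginals) (γ x : ℝ × ℝ) :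
    rankProj α γ x =
      (α.2 : Measure ℝ).real (rankPair γ α).2 * ((rankPair γ α).1 : Set ℝ).indicator 1 x.1 +
      (α.1 : Measure ℝ).real (rankPair γ α).1 * ((rankPair γ α).2 : Set ℝ).indicator 1 x.2 -
      2 * ((α.1 : Measure ℝ).real (rankPair γ α).1 * (α.2 : Measure ℝ).real (rankPair γ α).2) := by
  have h : ∀ (P : Measure ℝ) (D : LowerSet ℝ),
      ∫ v, (D : Set ℝ).indicator (fun _ => (1 : ℝ)) v ∂P = P.real (D : Set ℝ) := fun P D => by
    rw [integral_indicator_const _ (measurableSet_lowerSet D), smul_eq_mul, mul_one]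
  rw [rankProj, integral_rankIndex, productLaw_real_rect]
  simp only [rankIndex_eq_indicator, indicator_rect_apply, integral_const_mul, integral_mul_const,
    h]
  simp only [Pi.one_def]
  ring

lemma rankProj_eq (α : Marginals) (γ : ℝ × ℝ) :
    rankProj α γ = rectComb (rankSides γ α)
      ![0, (α.2 : Measure ℝ).real (rankPair γ α).2, (α.1 : Measure ℝ).real (rankPair γ α).1]
      (-(2 * ((α.1 : Measure ℝ).real (rankPair γ α).1 *
        (α.2 : Measure ℝ).real (rankPair γ α).2))) := by
  funext x
  rw [rankProj_apply]
  simp [rectComb, rankSides, Fin.sum_univ_three, indicator_rect_apply, Pi.one_def]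
  ring

lemma rankIndex_sub_rankProj (α : Marginals) (γ : ℝ × ℝ) :
    (fun x => rankIndex γ α x - rankProj α γ x) = rectComb (rankSides γ α)
      ![1, -(α.2 : Measure ℝ).real (rankPair γ α).2, -(α.1 : Measure ℝ).real (rankPair γ α).1]
      (2 * ((α.1 : Measure ℝ).real (rankPair γ α).1 *
        (α.2 : Measure ℝ).real (rankPair γ α).2)) := by
  funext x
  rw [rankIndex_eq, rankProj_eq]
  simp [rectComb, Fin.sum_univ_three]
  ring

lemma abs_rankCoeff_le (α : Marginals) (γ : ℝ × ℝ) (i : Fin 3) :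
    |(![1, -(α.2 : Measure ℝ).real (rankPair γ α).2,
      -(α.1 : Measure ℝ).real (rankPair γ α).1] : Fin 3 → ℝ) i| ≤ 1 := by
  fin_cases i <;> simp

lemma integral_rankProj (α : Marginals) (γ : ℝ × ℝ) :
    ∫ x, rankProj α γ x ∂(productLaw α) = 0 := by
  rw [rankProj_eq, integral_rectComb]
  simp [Fin.sum_univ_three, rankSides, productLaw_real_rect]
  ring

/-- The index minus its projection is uncorrelated with the projections. -/
lemma covariance_rankResidual (α : Marginals) (γ γ' : ℝ × ℝ) :
    covariance (fun x => rankIndex γ α x - rankProj α γ x)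
        (fun x => rankIndex γ' α x - rankProj α γ' x) (productLaw α) =
      covariance (rankIndex γ α) (rankIndex γ' α) (productLaw α) -
        covariance (rankProj α γ) (rankProj α γ') (productLaw α) := by
  -- Rectangles are stable under intersection and their product mass factorizes; the claim becomes a
  -- polynomial identity in marginal masses.
  have hcov : ∀ s t : LowerPair, rectCov (productLaw α) s t =
      (α.1 : Measure ℝ).real ((s.1 ⊓ t.1 : LowerSet ℝ) : Set ℝ) *
        (α.2 : Measure ℝ).real ((s.2 ⊓ t.2 : LowerSet ℝ) : Set ℝ) -
      (α.1 : Measure ℝ).real (s.1 : Set ℝ) * (α.2 : Measure ℝ).real (s.2 : Set ℝ) *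
        ((α.1 : Measure ℝ).real (t.1 : Set ℝ) * (α.2 : Measure ℝ).real (t.2 : Set ℝ)) := by
    intro s t
    have hst : rect s ∩ rect t = rect (s ⊓ t) := by
      ext x
      simp only [rect, Set.mem_inter_iff, Set.mem_prod, SetLike.mem_coe, Prod.fst_inf,
        Prod.snd_inf, LowerSet.mem_inf_iff]
      tauto
    rw [rectCov, covariance_eq_sub (memLp_rect_indicator _) (memLp_rect_indicator _)]
    have hmul : ((rect s).indicator fun _ => (1 : ℝ)) * ((rect t).indicator fun _ => (1 : ℝ)) =
        (rect (s ⊓ t)).indicator fun _ => (1 : ℝ) := by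
      rw [← hst]
      funext x
      by_cases h1 : x ∈ rect s <;> by_cases h2 : x ∈ rect t <;> simp [h1, h2]
    rw [hmul]
    simp only [integral_indicator_const _ (measurableSet_rect _), smul_eq_mul, mul_one,
      productLaw_real_rect, Prod.fst_inf, Prod.snd_inf]
  rw [rankIndex_sub_rankProj, rankIndex_sub_rankProj, rankIndex_eq, rankIndex_eq, rankProj_eq,
    rankProj_eq, covariance_rectComb, covariance_rectComb, covariance_rectComb]
  simp only [hcov, Fin.sum_univ_three, rankSides, Matrix.cons_val_zero, Matrix.cons_val_one,
    Matrix.cons_val, inf_top_eq, top_inf_eq, LowerSet.coe_top, probReal_univ]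
  ring

theorem rankIndex_condM0 (α : Marginals) : CondM0 rankIndex (rankProj α) α := by
  intro Q hQ
  -- The Donsker property is indexed by functions rather than by `γ`: one `γ` is chosen for each
  -- function of the class.
  choose g hg using fun f : (Set.range fun γ : ℝ × ℝ => fun x : ℝ × ℝ =>
    rankIndex γ α x - rankProj α γ x) => f.2
  simp only [rankIndex_sub_rankProj] at hg
  refine ⟨?_, ?_⟩
  · rintro _ ⟨γ, rfl⟩
    change Measurable (fun x => rankIndex γ α x - rankProj α γ x) ∧
      MemLp (fun x => rankIndex γ α x - rankProj α γ x) 2 Q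
    rw [rankIndex_sub_rankProj]
    exact ⟨measurable_rectComb _ _ _, memLp_rectComb _ _ _⟩
  · have hind : iIndepFun (fun (i : ℕ) (x : ℕ → ℝ × ℝ) => x i) (Measure.infinitePi fun _ => Q) :=
      iIndepFun_infinitePi (X := fun _ ω => ω) (by fun_prop)
    obtain ⟨L, G, hL, hG, hw⟩ := rectComb_weaklyConverges (Q := Q)
      (X := fun (i : ℕ) (x : ℕ → ℝ × ℝ) => x i) (fun i => measurable_pi_apply i) hind
      (fun i => Measure.infinitePi_map_eval _ i) (fun i f => rankSides (g f) α i) _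
      (fun f => (2 * ((α.1 : Measure ℝ).real (rankPair (g f) α).1 *
        (α.2 : Measure ℝ).real (rankPair (g f) α).2))) 1 (fun i f => abs_rankCoeff_le α (g f) i)
    refine ⟨G, L, fun n x f => ?_, ?_, hw⟩
    · rw [hG, ← hg f]
    · simpa only [hg] using hL

end RankIndicators

/-! ### Sublevel sets of distribution functions -/

section CdfLevels

variable {P P' : Measure ℝ} [IsProbabilityMeasure P] [IsProbabilityMeasure P']

/-- The probability integral transform of a continuous distribution function. -/
lemma real_cdfLower (hc : Continuous (cdf P)) (s : ℝ) :
    P.real (cdfLower P s : Set ℝ) = max 0 (min s 1) := by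
  have hset : (cdfLower P s : Set ℝ) = {u | cdf P u ≤ s} := rfl
  rcases lt_or_ge s 0 with hs0 | hs0
  · have : (cdfLower P s : Set ℝ) = ∅ := by
      rw [hset, Set.eq_empty_iff_forall_notMem]
      exact fun u hu => absurd (hs0.trans_le (cdf_nonneg P u)) (not_lt.2 hu)
    rw [this, measureReal_empty, max_eq_left ((min_le_left _ _).trans hs0.le)]
  rcases le_or_gt 1 s with hs1 | hs1
  · have : (cdfLower P s : Set ℝ) = Set.univ := by
      rw [hset, Set.eq_univ_iff_forall]
      exact fun u => (cdf_le_one P u).trans hs1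
    rw [this, probReal_univ, min_eq_right hs1, max_eq_right zero_le_one]
  rw [min_eq_left hs1.le, max_eq_right hs0]
  rcases Set.eq_empty_or_nonempty (cdfLower P s : Set ℝ) with he | hne
  · rw [he, measureReal_empty]
    -- An empty sublevel set means `cdf > s` everywhere; the limit `0` at `-∞` forces `s = 0`.
    refine le_antisymm hs0 (ge_of_tendsto (tendsto_cdf_atBot P) (.of_forall fun u => ?_))
    by_contra hu
    exact Set.eq_empty_iff_forall_notMem.1 he u (not_le.1 hu).le
  · obtain ⟨v, hv⟩ := ((tendsto_cdf_atTop P).eventually (lt_mem_nhds hs1)).exists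
    have hbdd : BddAbove (cdfLower P s : Set ℝ) := ⟨v, fun u hu => by
      by_contra h
      exact absurd (hv.trans_le (monotone_cdf P (not_le.1 h).le)) (not_lt.2 hu)⟩
    have hcl : IsClosed (cdfLower P s : Set ℝ) := isClosed_le hc continuous_const
    set w := sSup (cdfLower P s : Set ℝ) with hw
    have hwm : w ∈ (cdfLower P s : Set ℝ) := hcl.csSup_mem hne hbdd
    have hIic : (cdfLower P s : Set ℝ) = Set.Iic w := Set.Subset.antisymm
      (fun u hu => le_csSup hbdd hu) fun u hu => (cdfLower P s).lower hu hwm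
    rw [hIic, ← cdf_eq_real]
    -- If `cdf w < s`, continuity would keep points to the right of `w` in the sublevel set,
    -- contradicting that `w` is its supremum.
    refine le_antisymm hwm (not_lt.1 fun hlt => ?_)
    have hev : ∀ᶠ u in 𝓝[>] w, cdf P u < s :=
      (hc.tendsto w).mono_left nhdsWithin_le_nhds (Iio_mem_nhds hlt)
    obtain ⟨u, hu, hwu⟩ := (hev.and self_mem_nhdsWithin).exists
    exact absurd (le_csSup hbdd (show u ∈ (cdfLower P s : Set ℝ) from hu.le)) (not_le.2 hwu)

/-- The sublevel set of `cdf P'` at `s` lies between those of `cdf P` at `s - Δ` and `s + Δ`, and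
the `P`-mass of the latter is the level clipped to `[0, 1]`, which is 1-Lipschitz. Continuity is
needed for `P` alone, so `P'` may be an empirical law. -/
lemma abs_real_cdfLower_sub_le (hc : Continuous (cdf P)) {Δ : ℝ}
    (h : ∀ u, |cdf P' u - cdf P u| ≤ Δ) (s : ℝ) :
    |P.real (cdfLower P' s : Set ℝ) - P.real (cdfLower P s : Set ℝ)| ≤ Δ := by
  have hΔ : 0 ≤ Δ := (abs_nonneg _).trans (h 0)
  have h1 : (cdfLower P (s - Δ) : Set ℝ) ⊆ cdfLower P' s := fun u hu => by
    have := (abs_le.1 (h u)).2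
    simp only [SetLike.mem_coe, mem_cdfLower] at hu ⊢
    linarith
  have h2 : (cdfLower P' s : Set ℝ) ⊆ cdfLower P (s + Δ) := fun u hu => by
    have := (abs_le.1 (h u)).1
    simp only [SetLike.mem_coe, mem_cdfLower] at hu ⊢
    linarith
  have h3 := measureReal_mono (μ := P) h1
  have h4 := measureReal_mono (μ := P) h2
  rw [real_cdfLower hc] at h3 h4 ⊢
  rw [abs_le]
  constructor
  · have : max 0 (min s 1) ≤ max 0 (min (s - Δ) 1) + Δ := by
      refine max_le (by positivity) ?_
      rw [max_add, min_add]
      exact le_max_of_le_right (le_min ((min_le_left _ _).trans (by linarith))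
        ((min_le_right _ _).trans (by linarith)))
    linarith
  · have : max 0 (min (s + Δ) 1) ≤ max 0 (min s 1) + Δ := by
      refine max_le (by positivity) ?_
      rw [max_add, min_add]
      exact le_max_of_le_right (le_min (min_le_left _ _)
        ((min_le_right _ _).trans (by linarith)))
    linarith

end CdfLevels

/-! ### Empirical marginals as strips of the planar process -/

section EmpiricalMarginals

lemma empiricalMeasure_fst (x : ℕ → ℝ × ℝ) {n : ℕ} (hn : n ≠ 0) (D : LowerSet ℝ) :
    (empiricalMeasure (fun i => (x i).1) n).real (D : Set ℝ) =
      (empiricalMeasure x n).real (rect (D, ⊤)) := by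
  rw [empiricalMeasure_real _ hn (measurableSet_lowerSet D),
    empiricalMeasure_real _ hn (measurableSet_rect _)]
  simp [indicator_rect_apply]

lemma empiricalMeasure_snd (x : ℕ → ℝ × ℝ) {n : ℕ} (hn : n ≠ 0) (D : LowerSet ℝ) :
    (empiricalMeasure (fun i => (x i).2) n).real (D : Set ℝ) =
      (empiricalMeasure x n).real (rect (⊤, D)) := by
  rw [empiricalMeasure_real _ hn (measurableSet_lowerSet D),
    empiricalMeasure_real _ hn (measurableSet_rect _)]
  simp [indicator_rect_apply]

lemma productLaw_fst (α : Marginals) : (productLaw α).map Prod.fst = (α.1 : Measure ℝ) := by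
  simp [productLaw, Measure.map_fst_prod]

lemma productLaw_snd (α : Marginals) : (productLaw α).map Prod.snd = (α.2 : Measure ℝ) := by
  simp [productLaw, Measure.map_snd_prod]

lemma integral_rankIndex_sub (γ : ℝ × ℝ) (α α' : Marginals) (P : Measure (ℝ × ℝ))
    [IsProbabilityMeasure P] :
    ∫ x, (rankIndex γ α x - rankIndex γ α' x) ∂P =
      P.real (rect (rankPair γ α)) - P.real (rect (rankPair γ α')) := by
  have hi : ∀ α, Integrable (rankIndex γ α) P := fun α => by
    rw [rankIndex_eq]
    exact (memLp_rectComb _ _ _).integrable (by norm_num)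
  rw [integral_sub (hi α) (hi α'), integral_rankIndex, integral_rankIndex]

variable {Ω : Type*} {X : ℕ → Ω → ℝ × ℝ} {α : Marginals} {n : ℕ} {ω : Ω}

lemma empiricalMeasure_rect (hn : n ≠ 0) (t : LowerPair) :
    (empiricalMeasure (fun i => X i ω) n).real (rect t) =
      (productLaw α).real (rect t) + emp (productLaw α) X n ω (rect t) / √(n : ℝ) := by
  have hs : √(n : ℝ) ≠ 0 := (Real.sqrt_pos.2 (by exact_mod_cast Nat.pos_of_ne_zero hn)).ne'
  rw [emp_eq n ω (measurableSet_rect t), mul_div_cancel_left₀ _ hs]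
  ring

lemma npmle_fst (hn : n ≠ 0) (D : LowerSet ℝ) :
    ((independenceNPMLE (fun i => X i ω) n).1 : Measure ℝ).real (D : Set ℝ) =
      (α.1 : Measure ℝ).real (D : Set ℝ) +
        emp (productLaw α) X n ω (rect (D, ⊤)) / √(n : ℝ) := by
  refine (empiricalMeasure_fst (fun i => X i ω) hn D).trans ?_
  rw [empiricalMeasure_rect (α := α) hn, productLaw_real_rect]
  simp

lemma npmle_snd (hn : n ≠ 0) (D : LowerSet ℝ) :
    ((independenceNPMLE (fun i => X i ω) n).2 : Measure ℝ).real (D : Set ℝ) =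
      (α.2 : Measure ℝ).real (D : Set ℝ) +
        emp (productLaw α) X n ω (rect (⊤, D)) / √(n : ℝ) := by
  refine (empiricalMeasure_snd (fun i => X i ω) hn D).trans ?_
  rw [empiricalMeasure_rect (α := α) hn, productLaw_real_rect]
  simp

/-- Half-lines correspond to strips, so the uniform bound `R` on the planar process bounds the
distance between the distribution functions by `R / √n`. -/
lemma abs_real_npmle_fst_le (hn : n ≠ 0) (hU : Continuous (cdf (α.1 : Measure ℝ))) {R : ℝ}
    (hR : ∀ t, |emp (productLaw α) X n ω (rect t)| ≤ R) (s : ℝ) :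
    |(α.1 : Measure ℝ).real
        (cdfLower (independenceNPMLE (fun i => X i ω) n).1 s : Set ℝ) -
      (α.1 : Measure ℝ).real (cdfLower α.1 s : Set ℝ)| ≤ R / √(n : ℝ) := by
  refine abs_real_cdfLower_sub_le hU (fun u => ?_) s
  rw [cdf_eq_real, cdf_eq_real, ← LowerSet.coe_Iic, npmle_fst (α := α) hn, add_sub_cancel_left,
    abs_div, abs_of_nonneg (Real.sqrt_nonneg _)]
  exact div_le_div_of_nonneg_right (hR _) (Real.sqrt_nonneg _)

lemma abs_real_npmle_snd_le (hn : n ≠ 0) (hV : Continuous (cdf (α.2 : Measure ℝ))) {R : ℝ}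
    (hR : ∀ t, |emp (productLaw α) X n ω (rect t)| ≤ R) (s : ℝ) :
    |(α.2 : Measure ℝ).real
        (cdfLower (independenceNPMLE (fun i => X i ω) n).2 s : Set ℝ) -
      (α.2 : Measure ℝ).real (cdfLower α.2 s : Set ℝ)| ≤ R / √(n : ℝ) := by
  refine abs_real_cdfLower_sub_le hV (fun u => ?_) s
  rw [cdf_eq_real, cdf_eq_real, ← LowerSet.coe_Iic, npmle_snd (α := α) hn, add_sub_cancel_left,
    abs_div, abs_of_nonneg (Real.sqrt_nonneg _)]
  exact div_le_div_of_nonneg_right (hR _) (Real.sqrt_nonneg _)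

end EmpiricalMarginals

/-! ### The remainders in (M3), (M4) and (M5) -/

section Remainders

/-- The increment of the centered empirical measure when the marginals in the index are
estimated. -/
def indexRemainder (α : Marginals) (x : ℕ → ℝ × ℝ) (n : ℕ) (γ : ℝ × ℝ) : ℝ :=
  (∫ y, (rankIndex γ (independenceNPMLE x n) y - rankIndex γ α y) ∂(empiricalMeasure x n)) -
    ∫ y, (rankIndex γ (independenceNPMLE x n) y - rankIndex γ α y) ∂(productLaw α)

/-- The increment of the centered fitted law when the marginals are estimated in the index. -/
def modelRemainder (α : Marginals) (x : ℕ → ℝ × ℝ) (n : ℕ) (γ : ℝ × ℝ) : ℝ :=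
  (∫ y, (rankIndex γ (independenceNPMLE x n) y - rankIndex γ α y)
      ∂(productLaw (independenceNPMLE x n))) -
    ∫ y, (rankIndex γ (independenceNPMLE x n) y - rankIndex γ α y) ∂(productLaw α)

/-- The error of the linearization of the fitted law by the projected empirical measure. -/
def linearRemainder (α : Marginals) (x : ℕ → ℝ × ℝ) (n : ℕ) (γ : ℝ × ℝ) : ℝ :=
  ((∫ y, rankIndex γ α y ∂(productLaw (independenceNPMLE x n))) -
      ∫ y, rankIndex γ α y ∂(productLaw α)) -
    ((∫ y, rankProj α γ y ∂(empiricalMeasure x n)) - ∫ y, rankProj α γ y ∂(productLaw α))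

variable {Ω : Type*} {X : ℕ → Ω → ℝ × ℝ} {α : Marginals} {n : ℕ} {ω : Ω} {R δ ε : ℝ}

/-- The remainder is `n^{-1/2}` times an increment of the empirical process between the estimated
and the true rectangle, whose sides differ by at most `R / √n` in mass. -/
lemma abs_indexRemainder_le (hn : n ≠ 0) (hU : Continuous (cdf (α.1 : Measure ℝ)))
    (hV : Continuous (cdf (α.2 : Measure ℝ)))
    (hR : ∀ t, |emp (productLaw α) X n ω (rect t)| ≤ R) (hδ : R / √(n : ℝ) ≤ δ)
    (hε : ∀ s t : LowerPair,
      |(α.1 : Measure ℝ).real (s.1 : Set ℝ) - (α.1 : Measure ℝ).real (t.1 : Set ℝ)| ≤ δ →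
      |(α.2 : Measure ℝ).real (s.2 : Set ℝ) - (α.2 : Measure ℝ).real (t.2 : Set ℝ)| ≤ δ →
      |emp (productLaw α) X n ω (rect s) - emp (productLaw α) X n ω (rect t)| ≤ ε)
    (γ : ℝ × ℝ) :
    |indexRemainder α (fun i => X i ω) n γ| ≤ ε * rootRate n := by
  rw [indexRemainder, integral_rankIndex_sub, integral_rankIndex_sub,
    empiricalMeasure_rect (α := α) hn, empiricalMeasure_rect (α := α) hn]
  have h := hε (rankPair γ (independenceNPMLE (fun i => X i ω) n)) (rankPair γ α)
    ((abs_real_npmle_fst_le hn hU hR _).trans hδ) ((abs_real_npmle_snd_le hn hV hR _).trans hδ)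
  calc _ = |(emp (productLaw α) X n ω
            (rect (rankPair γ (independenceNPMLE (fun i => X i ω) n))) -
          emp (productLaw α) X n ω (rect (rankPair γ α))) * (√(n : ℝ))⁻¹| := by
        congr 1
        ring
    _ ≤ _ := by
        rw [abs_mul, abs_of_nonneg (inv_nonneg.2 (Real.sqrt_nonneg _))]
        exact mul_le_mul_of_nonneg_right h (inv_nonneg.2 (Real.sqrt_nonneg _))

/-- After expanding the products of fitted marginal masses, each term contains an increment of a
strip process, a change of mass times a bounded strip process, or a product of two strip processes
divided by `√n`. -/
lemma abs_modelRemainder_le (hn : n ≠ 0) (hU : Continuous (cdf (α.1 : Measure ℝ)))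
    (hV : Continuous (cdf (α.2 : Measure ℝ)))
    (hR : ∀ t, |emp (productLaw α) X n ω (rect t)| ≤ R) (hδ : R / √(n : ℝ) ≤ δ)
    (hε : ∀ s t : LowerPair,
      |(α.1 : Measure ℝ).real (s.1 : Set ℝ) - (α.1 : Measure ℝ).real (t.1 : Set ℝ)| ≤ δ →
      |(α.2 : Measure ℝ).real (s.2 : Set ℝ) - (α.2 : Measure ℝ).real (t.2 : Set ℝ)| ≤ δ →
      |emp (productLaw α) X n ω (rect s) - emp (productLaw α) X n ω (rect t)| ≤ ε)
    (γ : ℝ × ℝ) :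
    |modelRemainder α (fun i => X i ω) n γ| ≤
      (2 * ε + 4 * (R * (R / √(n : ℝ)))) * rootRate n := by
  set β := independenceNPMLE (fun i => X i ω) n with hβ
  set A := rankPair γ α with hA
  set B := rankPair γ β with hB
  have hR0 : 0 ≤ R := (abs_nonneg _).trans (hR ⊤)
  have hs : 0 < √(n : ℝ) := Real.sqrt_pos.2 (by exact_mod_cast Nat.pos_of_ne_zero hn)
  have hΔ : 0 ≤ R / √(n : ℝ) := by positivity
  have hδ0 : 0 ≤ δ := hΔ.trans hδ
  have hp : |(α.1 : Measure ℝ).real (B.1 : Set ℝ) - (α.1 : Measure ℝ).real (A.1 : Set ℝ)| ≤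
      R / √(n : ℝ) := abs_real_npmle_fst_le hn hU hR _
  have hq : |(α.2 : Measure ℝ).real (B.2 : Set ℝ) - (α.2 : Measure ℝ).real (A.2 : Set ℝ)| ≤
      R / √(n : ℝ) := abs_real_npmle_snd_le hn hV hR _
  have he := hε (B.1, ⊤) (A.1, ⊤) (hp.trans hδ) (by simpa using hδ0)
  have hf := hε (⊤, B.2) (⊤, A.2) (by simpa using hδ0) (hq.trans hδ)
  rw [modelRemainder, integral_rankIndex_sub, integral_rankIndex_sub, ← hβ, ← hA, ← hB,
    productLaw_real_rect, productLaw_real_rect, productLaw_real_rect, productLaw_real_rect,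
    npmle_fst (α := α) hn, npmle_fst (α := α) hn, npmle_snd (α := α) hn, npmle_snd (α := α) hn]
  have hp1 : |(α.1 : Measure ℝ).real (B.1 : Set ℝ)| ≤ 1 := by
    rw [abs_of_nonneg measureReal_nonneg]; exact measureReal_le_one
  have hq1 : |(α.2 : Measure ℝ).real (B.2 : Set ℝ)| ≤ 1 := by
    rw [abs_of_nonneg measureReal_nonneg]; exact measureReal_le_one
  have e1 := hR (B.1, ⊤)
  have e2 := hR (A.1, ⊤)
  have f1 := hR (⊤, B.2)
  have f2 := hR (⊤, A.2)
  generalize emp (productLaw α) X n ω (rect (B.1, ⊤)) = E' at *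
  generalize emp (productLaw α) X n ω (rect (A.1, ⊤)) = E at *
  generalize emp (productLaw α) X n ω (rect (⊤, B.2)) = F' at *
  generalize emp (productLaw α) X n ω (rect (⊤, A.2)) = F at *
  generalize (α.1 : Measure ℝ).real (B.1 : Set ℝ) = p' at *
  generalize (α.1 : Measure ℝ).real (A.1 : Set ℝ) = p at *
  generalize (α.2 : Measure ℝ).real (B.2 : Set ℝ) = q' at *
  generalize (α.2 : Measure ℝ).real (A.2 : Set ℝ) = q at *
  -- Two increments contribute `2 ε`; the two mass changes and the two quadratic terms contribute `4
  -- R² / √n`.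
  have key : (p' + E' / √(n : ℝ)) * (q' + F' / √(n : ℝ)) -
      (p + E / √(n : ℝ)) * (q + F / √(n : ℝ)) - (p' * q' - p * q) =
      (p' * (F' - F) + (p' - p) * F + (q' * (E' - E) + (q' - q) * E) +
        (E' * (F' / √(n : ℝ)) - E * (F / √(n : ℝ)))) * rootRate n := by
    rw [rootRate]
    ring
  rw [key, abs_mul, abs_of_nonneg (show 0 ≤ rootRate n from inv_nonneg.2 hs.le)]
  refine mul_le_mul_of_nonneg_right ?_ (inv_nonneg.2 hs.le)
  have hmul : ∀ {a b c d : ℝ}, |a| ≤ c → |b| ≤ d → |a * b| ≤ c * d := fun {a b c d} h1 h2 => by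
    rw [abs_mul]
    exact mul_le_mul h1 h2 (abs_nonneg _) ((abs_nonneg _).trans h1)
  have hdiv : ∀ {a : ℝ}, |a| ≤ R → |a / √(n : ℝ)| ≤ R / √(n : ℝ) := fun {a} h => by
    rw [abs_div, abs_of_pos hs]
    exact div_le_div_of_nonneg_right h hs.le
  have t1 := abs_le.1 (hmul hp1 hf)
  have t2 := abs_le.1 (hmul hp f2)
  have t3 := abs_le.1 (hmul hq1 he)
  have t4 := abs_le.1 (hmul hq e2)
  have t5 := abs_le.1 (hmul e1 (hdiv f1))
  have t6 := abs_le.1 (hmul e2 (hdiv f2))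
  rw [abs_le]
  constructor <;> linarith [mul_comm R (R / √(n : ℝ))]

/-- The projection reproduces exactly the linear part of `(p + E/√n)(q + F/√n)`; only the quadratic
term `EF/n` remains. -/
lemma abs_linearRemainder_le (hn : n ≠ 0)
    (hR : ∀ t, |emp (productLaw α) X n ω (rect t)| ≤ R) (γ : ℝ × ℝ) :
    |linearRemainder α (fun i => X i ω) n γ| ≤ (R * (R / √(n : ℝ))) * rootRate n := by
  have hs : 0 < √(n : ℝ) := Real.sqrt_pos.2 (by exact_mod_cast Nat.pos_of_ne_zero hn)
  have hR0 : 0 ≤ R := (abs_nonneg _).trans (hR ⊤)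
  have hE := hR ((rankPair γ α).1, ⊤)
  have hF := hR (⊤, (rankPair γ α).2)
  rw [linearRemainder, integral_rankProj, integral_rankIndex, integral_rankIndex,
    productLaw_real_rect, productLaw_real_rect, npmle_fst (α := α) hn, npmle_snd (α := α) hn,
    rankProj_eq, integral_rectComb]
  simp only [Fin.sum_univ_three, rankSides, Matrix.cons_val_zero, Matrix.cons_val_one,
    Matrix.cons_val, empiricalMeasure_rect (α := α) hn, productLaw_real_rect, LowerSet.coe_top,
    probReal_univ]
  calc _ = |emp (productLaw α) X n ω (rect ((rankPair γ α).1, ⊤)) *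
        (emp (productLaw α) X n ω (rect (⊤, (rankPair γ α).2)) / √(n : ℝ)) * (√(n : ℝ))⁻¹| := by
        congr 1
        ring
    _ ≤ _ := by
        rw [abs_mul, abs_mul, abs_div, abs_of_pos hs, abs_of_pos (inv_pos.2 hs), rootRate]
        gcongr

variable [MeasurableSpace Ω] {μ : Measure Ω} [IsProbabilityMeasure μ]

/-- All three remainders are uniformly `o(n^{-1/2})` with high probability. -/
theorem remainders_eventually_small (hU : Continuous (cdf (α.1 : Measure ℝ)))
    (hV : Continuous (cdf (α.2 : Measure ℝ))) (hX : ∀ i, Measurable (X i)) (hind : iIndepFun X μ)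
    (hlaw : ∀ i, μ.map (X i) = productLaw α) (ε : ℝ) (hε : 0 < ε) (η : ℝ) (hη : 0 < η) :
    ∀ᶠ n : ℕ in atTop, n ≠ 0 ∧ μ {ω | ∃ γ,
      ε * rootRate n < |indexRemainder α (fun i => X i ω) n γ| ∨
      ε * rootRate n < |modelRemainder α (fun i => X i ω) n γ| ∨
      ε * rootRate n < |linearRemainder α (fun i => X i ω) n γ|} ≤ ENNReal.ofReal η := by
  obtain ⟨R, hR0, hR⟩ := emp_bounded hX hind hlaw (η / 2) (half_pos hη)
  -- The second remainder dictates the constants: `2 · ε/4` from the increments and `4 · ε/8` from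
  -- the terms of size `R² / √n`.
  obtain ⟨δ, hδ0, hδ⟩ := emp_equicontinuous hX hind hlaw (ε / 4) (η / 2) (by positivity)
    (half_pos hη)
  rw [productLaw_fst, productLaw_snd] at hδ
  have hlim : Tendsto (fun n : ℕ => R / √(n : ℝ)) atTop (𝓝 0) :=
    tendsto_const_nhds.div_atTop (Real.tendsto_sqrt_atTop.comp tendsto_natCast_atTop_atTop)
  have hlim2 : Tendsto (fun n : ℕ => R * (R / √(n : ℝ))) atTop (𝓝 0) := by
    simpa using hlim.const_mul R
  filter_upwards [hR, hδ, hlim.eventually (gt_mem_nhds hδ0),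
    hlim2.eventually (gt_mem_nhds (show 0 < ε / 8 by positivity)), eventually_ne_atTop 0]
    with n hRn hδn h1 h2 hn
  refine ⟨hn, ?_⟩
  calc _ ≤ μ ({ω | ∃ t : LowerPair, R < |emp (productLaw α) X n ω (rect t)|} ∪
        {ω | ∃ s t : LowerPair,
          |(α.1 : Measure ℝ).real (s.1 : Set ℝ) - (α.1 : Measure ℝ).real (t.1 : Set ℝ)| ≤ δ ∧
          |(α.2 : Measure ℝ).real (s.2 : Set ℝ) - (α.2 : Measure ℝ).real (t.2 : Set ℝ)| ≤ δ ∧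
          ε / 4 < |emp (productLaw α) X n ω (rect s) - emp (productLaw α) X n ω (rect t)|}) := by
        refine measure_mono fun ω hω => ?_
        by_contra hcon
        simp only [Set.mem_union, Set.mem_ofPred_eq, not_or, not_exists, not_and, not_lt] at hcon
        obtain ⟨hb, hc⟩ := hcon
        obtain ⟨γ, hγ⟩ := hω
        have hr : 0 ≤ rootRate n := inv_nonneg.2 (Real.sqrt_nonneg _)
        rcases hγ with h | h | h
        · refine absurd (abs_indexRemainder_le hn hU hV hb h1.le hc γ) (not_le.2 (h.trans_le' ?_))
          exact mul_le_mul_of_nonneg_right (by linarith) hr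
        · refine absurd (abs_modelRemainder_le hn hU hV hb h1.le hc γ) (not_le.2 (h.trans_le' ?_))
          exact mul_le_mul_of_nonneg_right (by linarith) hr
        · refine absurd (abs_linearRemainder_le hn hb γ) (not_le.2 (h.trans_le' ?_))
          exact mul_le_mul_of_nonneg_right (by linarith) hr
    _ ≤ ENNReal.ofReal (η / 2) + ENNReal.ofReal (η / 2) :=
        (measure_union_le _ _).trans (add_le_add hRn hδn)
    _ = ENNReal.ofReal η := by
        rw [← ENNReal.ofReal_add (by positivity) (by positivity), add_halves]

end Remainders

/-! ### Convergence of the score processes -/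

section ScoreProcesses

lemma integral_empiricalMeasure (x : ℕ → ℝ × ℝ) {n : ℕ} (hn : n ≠ 0) (f : ℝ × ℝ → ℝ) :
    ∫ y, f y ∂(empiricalMeasure x n) = (n : ℝ)⁻¹ * ∑ i ∈ Finset.range n, f (x i) := by
  rw [empiricalMeasure, if_neg hn, integral_smul_measure,
    integral_finsetSum_measure fun i _ => integrable_dirac (by simp)]
  simp

lemma integrable_rankIndex (γ : ℝ × ℝ) (α : Marginals) (P : Measure (ℝ × ℝ))
    [IsProbabilityMeasure P] : Integrable (rankIndex γ α) P := by
  rw [rankIndex_eq]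
  exact (memLp_rectComb _ _ _).integrable (by norm_num)

lemma integrable_rankProj (γ : ℝ × ℝ) (α : Marginals) (P : Measure (ℝ × ℝ))
    [IsProbabilityMeasure P] : Integrable (rankProj α γ) P := by
  rw [rankProj_eq]
  exact (memLp_rectComb _ _ _).integrable (by norm_num)

variable {Ω : Type*} {X : ℕ → Ω → ℝ × ℝ} {α : Marginals}

/-- The projection has mean zero, so centering the index alone is the same as centering the
difference. -/
lemma scoreProcess_eq (n : ℕ) (ω : Ω) (γ : ℝ × ℝ) :
    scoreProcess productLaw rankIndex (rankProj α) α X n ω γ = √(n : ℝ) *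
      ((∫ x, (rankIndex γ α x - rankProj α γ x) ∂(empiricalMeasure (fun i => X i ω) n)) -
        ∫ x, (rankIndex γ α x - rankProj α γ x) ∂(productLaw α)) := by
  rcases eq_or_ne n 0 with rfl | hn
  · simp [scoreProcess]
  have hn' : (n : ℝ) ≠ 0 := by exact_mod_cast hn
  have hs : √(n : ℝ) ≠ 0 := (Real.sqrt_pos.2 (by exact_mod_cast Nat.pos_of_ne_zero hn)).ne'
  have hsq : √(n : ℝ) * √(n : ℝ) = n := Real.mul_self_sqrt (Nat.cast_nonneg n)
  rw [integral_empiricalMeasure _ hn, integral_sub (integrable_rankIndex _ _ _)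
    (integrable_rankProj _ _ _), integral_rankProj, scoreProcess]
  have hsum : ∑ i ∈ Finset.range n, (rankIndex γ α (X i ω) - (∫ y, rankIndex γ α y ∂(productLaw α))
      - rankProj α γ (X i ω)) = ∑ i ∈ Finset.range n,
        (rankIndex γ α (X i ω) - rankProj α γ (X i ω)) -
          n * ∫ y, rankIndex γ α y ∂(productLaw α) := by
    simp only [Finset.sum_sub_distrib, Finset.sum_const, Finset.card_range, nsmul_eq_mul]
    ring
  rw [hsum, inv_mul_eq_iff_eq_mul₀ hs, ← mul_assoc, hsq]
  field_simp
  ring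

/-- An exact algebraic decomposition, by which (M3), (M4) and (M5) give the asymptotic equivalence
of the two processes. -/
lemma estimatedScoreProcess_sub_eq (n : ℕ) (ω : Ω) (γ : ℝ × ℝ) :
    estimatedScoreProcess productLaw rankIndex
        (fun n ω => empiricalMeasure (fun i => X i ω) n)
        (fun n ω => independenceNPMLE (fun i => X i ω) n) n ω γ -
      scoreProcess productLaw rankIndex (rankProj α) α X n ω γ =
    √(n : ℝ) * (indexRemainder α (fun i => X i ω) n γ - modelRemainder α (fun i => X i ω) n γ -
      linearRemainder α (fun i => X i ω) n γ) := by
  rw [scoreProcess_eq, estimatedScoreProcess, indexRemainder, modelRemainder, linearRemainder,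
    integral_sub (integrable_rankIndex _ _ _) (integrable_rankProj _ _ _),
    integral_sub (integrable_rankIndex _ _ _) (integrable_rankProj _ _ _),
    integral_sub (integrable_rankIndex _ _ _) (integrable_rankIndex _ _ _),
    integral_sub (integrable_rankIndex _ _ _) (integrable_rankIndex _ _ _),
    integral_sub (integrable_rankIndex _ _ _) (integrable_rankIndex _ _ _)]
  ring

lemma abs_estimatedScoreProcess_le (n : ℕ) (ω : Ω) (γ : ℝ × ℝ) :
    |(estimatedScoreProcess productLaw rankIndex
        (fun n ω => empiricalMeasure (fun i => X i ω) n)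
        (fun n ω => independenceNPMLE (fun i => X i ω) n) n ω γ)| ≤ √(n : ℝ) := by
  rw [estimatedScoreProcess, integral_rankIndex, integral_rankIndex, abs_mul,
    abs_of_nonneg (Real.sqrt_nonneg _)]
  refine mul_le_of_le_one_right (Real.sqrt_nonneg _) (abs_sub_le_iff.2 ⟨?_, ?_⟩)
  · exact (sub_le_self _ measureReal_nonneg).trans measureReal_le_one
  · exact (sub_le_self _ measureReal_nonneg).trans measureReal_le_one

variable [MeasurableSpace Ω] {μ : Measure Ω} [IsProbabilityMeasure μ]

theorem rankScoreProcesses_converge (hU : Continuous (cdf (α.1 : Measure ℝ)))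
    (hV : Continuous (cdf (α.2 : Measure ℝ))) (hX : ∀ i, Measurable (X i)) (hind : iIndepFun X μ)
    (hlaw : ∀ i, μ.map (X i) = productLaw α) :
    ScoreProcessesConverge μ (productLaw α) (fun γ => rankIndex γ α) (rankProj α)
      (scoreProcess productLaw rankIndex (rankProj α) α X)
      (estimatedScoreProcess productLaw rankIndex
        (fun n ω => empiricalMeasure (fun i => X i ω) n)
        (fun n ω => independenceNPMLE (fun i => X i ω) n)) := by
  obtain ⟨L, W, hL, hW, hw⟩ := rectComb_weaklyConverges hX hind hlaw
    (fun i γ => rankSides γ α i) _ (fun γ => (2 * ((α.1 : Measure ℝ).real (rankPair γ α).1 *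
        (α.2 : Measure ℝ).real (rankPair γ α).2))) 1 (fun i γ => abs_rankCoeff_le α γ i)
  simp only [← rankIndex_sub_rankProj] at hL hW
  simp only [covariance_rankResidual] at hL
  have hWZ : ∀ n ω γ, W n ω γ = scoreProcess productLaw rankIndex (rankProj α) α X n ω γ :=
    fun n ω γ => by rw [hW, scoreProcess_eq]
  have hclose : ∀ ε : ℝ, 0 < ε → ∀ η : ℝ, 0 < η → ∀ᶠ n in atTop, μ {ω | ∃ γ, ε * 1 <
      |(estimatedScoreProcess productLaw rankIndex (fun n ω => empiricalMeasure (fun i => X i ω) n)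
        (fun n ω => independenceNPMLE (fun i => X i ω) n) n ω γ) -
      scoreProcess productLaw rankIndex (rankProj α) α X n ω γ|} ≤ ENNReal.ofReal η := by
    intro ε hε η hη
    filter_upwards [remainders_eventually_small hU hV hX hind hlaw (ε / 3) (by positivity) η hη]
      with n hn
    obtain ⟨hn, hμ⟩ := hn
    refine (measure_mono ?_).trans hμ
    rintro ω ⟨γ, hγ⟩
    refine ⟨γ, ?_⟩
    by_contra hcon
    simp only [not_or, not_lt] at hcon
    obtain ⟨h1, h2, h3⟩ := hcon
    have hs : 0 < √(n : ℝ) := Real.sqrt_pos.2 (by exact_mod_cast Nat.pos_of_ne_zero hn)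
    rw [estimatedScoreProcess_sub_eq, abs_mul, abs_of_pos hs] at hγ
    have h4 : |indexRemainder α (fun i => X i ω) n γ - modelRemainder α (fun i => X i ω) n γ -
        linearRemainder α (fun i => X i ω) n γ| ≤ ε * rootRate n :=
      ((abs_sub _ _).trans (add_le_add_left (abs_sub _ _) _)).trans (by linarith)
    have h5 := mul_le_mul_of_nonneg_left h4 hs.le
    have h6 : √(n : ℝ) * (ε * rootRate n) = ε := by
      rw [rootRate]
      field_simp
    linarith
  have := hL.isProbabilityMeasure
  refine ⟨L, W, fun n ω => mkEll _ (√(n : ℝ)) (abs_estimatedScoreProcess_le (X := X) n ω), hL,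
    hWZ, fun n ω γ => rfl, hw, supLittleOP_of_eventually hclose, hw.perturb fun ε hε => ?_⟩
  filter_upwards [hclose ε hε ε hε] with n hn
  refine (measure_mono fun ω hω => ?_).trans hn
  by_contra hcon
  simp only [Set.mem_ofPred_eq, not_exists, not_lt, mul_one] at hcon hω
  refine absurd (ell_dist_le hε.le fun γ => ?_) (not_le.2 hω)
  rw [mkEll_apply, hWZ]
  exact hcon γ

end ScoreProcesses

/-! ### Derivatives of means along regular submodels -/

section ScoreDerivative

variable {S : Type*} [MeasurableSpace S]

/-- The square-root density of `P` integrates bounded functions against `P`. -/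
lemma integral_eq_integral_sqrt_density {ν P : Measure S} [SigmaFinite ν] [IsProbabilityMeasure P]
    (hPν : P ≪ ν) {s : S → ℝ} (hs : s =ᵐ[ν] fun x => √(P.rnDeriv ν x).toReal) (φ : S → ℝ) :
    ∫ x, φ x ∂P = ∫ x, s x ^ 2 * φ x ∂ν := by
  rw [← integral_rnDeriv_smul hPν]
  refine integral_congr_ae ?_
  filter_upwards [hs] with x hx
  rw [hx, Real.sq_sqrt ENNReal.toReal_nonneg, smul_eq_mul]

/-- The derivative of the mean of a bounded function along a regular submodel is its inner product
with the score. -/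
lemma IsRegularScore.hasDerivAt {M : Set (Measure S)} (hM : ∀ P ∈ M, IsProbabilityMeasure P)
    {P₀ : Measure S} {g : Lp ℝ 2 P₀} (hg : IsRegularScore M P₀ g) :
    ∃ P : ℝ → Measure S, P 0 = P₀ ∧ (∀ᶠ t in 𝓝 0, P t ∈ M) ∧
      ∀ (φ : S → ℝ) (C : ℝ), Measurable φ → (∀ x, |φ x| ≤ C) →
        HasDerivAt (fun t => ∫ x, φ x ∂(P t)) (∫ x, φ x * g x ∂P₀) 0 := by
  obtain ⟨δ, ν, P, s, s', hδ, hν, hP0, hreg, -, hgs⟩ := hg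
  have hnhds : Set.Ioo (-δ) δ ∈ 𝓝 (0 : ℝ) := Ioo_mem_nhds (by linarith) hδ
  have h0 := hreg 0 ⟨by linarith, hδ⟩
  refine ⟨P, hP0, mem_of_superset hnhds fun t ht => (hreg t ht).1, fun φ C hφ hC => ?_⟩
  have hφ' : MemLp φ ∞ ν := memLp_top_of_bound hφ.aestronglyMeasurable C (.of_forall hC)
  -- Multiplication by `φ` is a bounded operator, so `∫ φ dP_t = ⟨T s_t, s_t⟩` is a quadratic form
  -- in the differentiable curve `s_t`.
  set T : Lp ℝ 2 ν →L[ℝ] Lp ℝ 2 ν :=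
    (ContinuousLinearMap.mul ℝ ℝ).holderL ν ∞ 2 2 (hφ'.toLp φ) with hT
  have hTf : ∀ f : Lp ℝ 2 ν, T f =ᵐ[ν] fun x => φ x * f x := fun f => by
    have h1 := (ContinuousLinearMap.mul ℝ ℝ).coeFn_holder (r := 2) (hφ'.toLp φ) f
    filter_upwards [h1, hφ'.coeFn_toLp] with x hx hx'
    rw [hT, ContinuousLinearMap.holderL_apply_apply, hx, hx', ContinuousLinearMap.mul_apply']
  have hinner : ∀ f k : Lp ℝ 2 ν, inner ℝ (T f) k = ∫ x, φ x * (f x * k x) ∂ν := fun f k => by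
    rw [L2.inner_def]
    refine integral_congr_ae ?_
    filter_upwards [hTf f] with x hx
    simp only [hx, RCLike.inner_apply, conj_trivial]
    ring
  have hd : HasDerivAt (fun t => inner ℝ (T (s t)) (s t))
      (inner ℝ (T (s 0)) (s' 0) + inner ℝ (T (s' 0)) (s 0)) 0 :=
    (T.hasFDerivAt.comp_hasDerivAt 0 h0.2.2.2.1).inner ℝ h0.2.2.2.1
  have hval : inner ℝ (T (s 0)) (s' 0) + inner ℝ (T (s' 0)) (s 0) = ∫ x, φ x * g x ∂P₀ := by
    have := hM _ h0.1
    have e1 : ∫ x, φ x * g x ∂P₀ = ∫ x, φ x * (2 * s' 0 x / s 0 x) ∂P₀ :=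
      integral_congr_ae (hgs.mono fun x hx => by simp only [hx])
    rw [e1, ← hP0, integral_eq_integral_sqrt_density h0.2.1 h0.2.2.1, hinner, hinner]
    -- Where `s 0 x = 0` both sides vanish, so the quotient by zero in the score is harmless.
    have e2 : ∀ x, s 0 x ^ 2 * (φ x * (2 * s' 0 x / s 0 x)) = 2 * (φ x * (s 0 x * s' 0 x)) := by
      intro x
      by_cases hx : s 0 x = 0
      · simp [hx]
      · field_simp
    simp only [e2, integral_const_mul, mul_comm (s' 0 _) (s 0 _)]
    ring
  rw [hval] at hd
  refine hd.congr_of_eventuallyEq ?_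
  filter_upwards [hnhds] with t ht
  have := hM _ (hreg t ht).1
  rw [integral_eq_integral_sqrt_density (hreg t ht).2.1 (hreg t ht).2.2.1, hinner]
  exact integral_congr_ae (.of_forall fun x => by ring)

end ScoreDerivative

/-! ### Bounded centered functions as scores of linear paths -/

section BoundedScores

variable {S : Type*} [MeasurableSpace S] {P₀ : Measure S} [IsProbabilityMeasure P₀]

/-- The density `1 + t g`, truncated from below. -/
def linDensity (g : S → ℝ) (t : ℝ) (x : S) : ℝ := max (1 / 2) (1 + t * g x)

lemma linDensity_nonneg (g : S → ℝ) (t : ℝ) (x : S) : 0 ≤ linDensity g t x :=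
  le_trans (by norm_num) (le_max_left _ _)

lemma linDensity_eq {g : S → ℝ} (hg : ∀ x, |g x| ≤ 1) {t : ℝ}
    (ht : t ∈ Set.Ioo (-(1 / 2) : ℝ) (1 / 2))
    (x : S) : linDensity g t x = 1 + t * g x := by
  have h1 : |t * g x| ≤ 1 / 2 := by
    rw [abs_mul]
    exact (mul_le_of_le_one_right (abs_nonneg _) (hg x)).trans (abs_le.2 ⟨ht.1.le, ht.2.le⟩)
  exact max_eq_right (by linarith [(abs_le.1 h1).1])

lemma half_le_sqrt_linDensity (g : S → ℝ) (t : ℝ) (x : S) : 1 / 2 ≤ √(linDensity g t x) :=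
  Real.le_sqrt_of_sq_le (le_trans (by norm_num) (le_max_left _ _))

lemma measurable_linDensity {g : S → ℝ} (hg : Measurable g) (t : ℝ) :
    Measurable (linDensity g t) :=
  measurable_const.max ((hg.const_mul t).const_add 1)

lemma memLp_sqrt_linDensity {g : S → ℝ} (hgm : Measurable g) (hg : ∀ x, |g x| ≤ 1) (t : ℝ) :
    MemLp (fun x => √(linDensity g t x)) 2 P₀ := by
  refine MemLp.of_bound (measurable_linDensity hgm t).sqrt.aestronglyMeasurable (√(1 + |t|))
    (.of_forall fun x => ?_)
  rw [Real.norm_of_nonneg (Real.sqrt_nonneg _)]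
  refine Real.sqrt_le_sqrt (max_le (by linarith [abs_nonneg t]) ?_)
  have : |t * g x| ≤ |t| := by
    rw [abs_mul]
    exact mul_le_of_le_one_right (abs_nonneg _) (hg x)
  linarith [le_abs_self (t * g x)]

lemma memLp_sqrt_linDensity_deriv {g : S → ℝ} (hgm : Measurable g) (hg : ∀ x, |g x| ≤ 1) (t : ℝ) :
    MemLp (fun x => g x / (2 * √(linDensity g t x))) 2 P₀ := by
  refine MemLp.of_bound
    (hgm.div ((measurable_linDensity hgm t).sqrt.const_mul 2)).aestronglyMeasurable 1
    (.of_forall fun x => ?_)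
  have h := half_le_sqrt_linDensity g t x
  rw [Real.norm_eq_abs, abs_div, abs_of_pos (show 0 < 2 * √(linDensity g t x) by linarith),
    div_le_one (by linarith)]
  linarith [hg x]

lemma norm_toLp_le {f : S → ℝ} (hf : MemLp f 2 P₀) {C : ℝ} (hC : 0 ≤ C) (h : ∀ x, |f x| ≤ C) :
    ‖hf.toLp f‖ ≤ C := by
  have := Lp.norm_le_of_ae_bound (f := hf.toLp f) hC
    (hf.coeFn_toLp.mono fun x hx => by rw [hx]; exact h x)
  simpa [measureUnivNNReal] using this

/-- A bounded centered function whose linear paths of densities lie in the model belongs to the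
tangent space. -/
lemma toLp_mem_tangentSpace {M : Set (Measure S)} {g : S → ℝ} (hgm : Measurable g)
    (hg : ∀ x, |g x| ≤ 1) (hgL : MemLp g 2 P₀)
    (hM : ∀ t ∈ Set.Ioo (-(1 / 2) : ℝ) (1 / 2),
      P₀.withDensity (fun x => ENNReal.ofReal (1 + t * g x)) ∈ M) :
    hgL.toLp g ∈ tangentSpace M P₀ := by
  -- The zero function gives a path without information, which is not a regular submodel, but zero
  -- lies in every subspace.
  by_cases hz : hgL.toLp g = 0
  · rw [hz]
    exact zero_mem _
  refine Submodule.le_topologicalClosure _ (Submodule.subset_span ?_)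
  have hsub : ∀ {f k : S → ℝ} (hf : MemLp f 2 P₀) (hk : MemLp k 2 P₀) {C : ℝ}, 0 ≤ C →
      (∀ x, |f x - k x| ≤ C) → ‖hf.toLp f - hk.toLp k‖ ≤ C := fun {f k} hf hk {C} hC h => by
    rw [← MemLp.toLp_sub]
    exact norm_toLp_le (hf.sub hk) hC h
  refine ⟨1 / 2, P₀, fun t => P₀.withDensity fun x => ENNReal.ofReal (1 + t * g x),
    fun t => (memLp_sqrt_linDensity (P₀ := P₀) hgm hg t).toLp _,
    fun t => (memLp_sqrt_linDensity_deriv (P₀ := P₀) hgm hg t).toLp _,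
    by norm_num, inferInstance, by simp, fun t ht => ⟨hM t ht,
      withDensity_absolutelyContinuous _ _, ?_, ?_, ?_⟩, ?_, ?_⟩
  · have h1 := Measure.rnDeriv_withDensity P₀
      (f := fun x => ENNReal.ofReal (1 + t * g x)) (by fun_prop)
    filter_upwards [h1, (memLp_sqrt_linDensity (P₀ := P₀) hgm hg t).coeFn_toLp] with x hx hx'
    rw [hx, hx', ← linDensity_eq hg ht,
      ENNReal.toReal_ofReal (linDensity_nonneg g t x)]
  · rw [hasDerivAt_iff_isLittleO]
    refine (Asymptotics.IsBigO.of_bound 1 ?_).trans_isLittleO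
      (Asymptotics.isLittleO_pow_sub_sub t one_lt_two)
    filter_upwards [isOpen_Ioo.mem_nhds ht] with r hr
    rw [one_mul, ← MemLp.toLp_const_smul]
    have h1 := (memLp_sqrt_linDensity (P₀ := P₀) hgm hg r).sub
      (memLp_sqrt_linDensity (P₀ := P₀) hgm hg t)
    rw [← MemLp.toLp_sub, norm_pow, norm_norm, Real.norm_eq_abs]
    refine hsub h1 _ (by positivity) fun x => ?_
    have hy := half_le_sqrt_linDensity g t x
    have hy' := half_le_sqrt_linDensity g r x
    have hd : √(linDensity g r x) ^ 2 - √(linDensity g t x) ^ 2 = (r - t) * g x := by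
      rw [Real.sq_sqrt (linDensity_nonneg g r x), Real.sq_sqrt (linDensity_nonneg g t x),
        linDensity_eq hg hr, linDensity_eq hg ht]
      ring
    simp only [Pi.sub_apply, Pi.smul_apply, smul_eq_mul]
    generalize √(linDensity g r x) = y' at *
    generalize √(linDensity g t x) = y at *
    -- The Taylor remainder of the square root is computed exactly; since roots are at least `1/2`,
    -- it is at most `(r - t)²` uniformly in `x`.
    have e : y' - y - (r - t) * (g x / (2 * y)) = -((y' - y) ^ 2 / (2 * y)) := by
      rw [← mul_div_assoc, ← hd]
      field_simp
      ring
    have hle : |y' - y| ≤ |r - t| := by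
      have h2 : |y' - y| * (y' + y) ≤ |r - t| := by
        rw [← abs_of_pos (show 0 < y' + y by linarith), ← abs_mul,
          show (y' - y) * (y' + y) = (r - t) * g x by rw [← hd]; ring, abs_mul]
        exact mul_le_of_le_one_right (abs_nonneg _) (hg x)
      nlinarith [abs_nonneg (y' - y)]
    rw [e, abs_neg, abs_of_nonneg (by positivity), ← sq_abs (y' - y)]
    refine (div_le_self (by positivity) (by linarith)).trans ?_
    exact pow_le_pow_left₀ (abs_nonneg _) hle 2
  · intro h0
    refine hz ?_
    rw [Lp.eq_zero_iff_ae_eq_zero] at h0 ⊢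
    filter_upwards [h0, (memLp_sqrt_linDensity_deriv (P₀ := P₀) hgm hg t).coeFn_toLp,
      hgL.coeFn_toLp] with x hx hx' hx''
    rw [hx, eq_comm] at hx'
    have h := half_le_sqrt_linDensity g t x
    rw [hx'']
    exact (div_eq_zero_iff.1 hx').resolve_right (by linarith)
  -- The truncation in `linDensity` keeps the roots away from zero for every `t`, so the derivative
  -- is globally Lipschitz.
  · refine (LipschitzWith.of_dist_le_mul (K := 2) fun r t => ?_).continuous.continuousOn
    rw [dist_eq_norm, dist_eq_norm, Real.norm_eq_abs]
    refine hsub _ _ (by positivity) fun x => ?_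
    have hy := half_le_sqrt_linDensity g t x
    have hy' := half_le_sqrt_linDensity g r x
    have hd : |√(linDensity g r x) ^ 2 - √(linDensity g t x) ^ 2| ≤ |r - t| := by
      rw [Real.sq_sqrt (linDensity_nonneg g r x), Real.sq_sqrt (linDensity_nonneg g t x)]
      refine (abs_max_sub_max_le_max _ _ _ _).trans (max_le (by simp) ?_)
      rw [add_sub_add_left_eq_sub, ← sub_mul, abs_mul]
      exact mul_le_of_le_one_right (abs_nonneg _) (hg x)
    generalize √(linDensity g r x) = y' at *
    generalize √(linDensity g t x) = y at *
    have hle : |y' - y| ≤ |r - t| := by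
      have h2 : |y' - y| * (y' + y) ≤ |r - t| := by
        rw [← abs_of_pos (show 0 < y' + y by linarith), ← abs_mul,
          show (y' - y) * (y' + y) = y' ^ 2 - y ^ 2 by ring]
        exact hd
      nlinarith [abs_nonneg (y' - y)]
    have e : g x / (2 * y') - g x / (2 * y) = g x * (y - y') / (2 * y * y') := by
      field_simp
    have hpos : 1 / 2 ≤ 2 * y * y' := by nlinarith
    rw [e, abs_div, abs_mul, abs_of_pos (show 0 < 2 * y * y' by linarith),
      div_le_iff₀ (by linarith), abs_sub_comm y y']
    have h3 : |g x| * |y' - y| ≤ |r - t| := (mul_le_of_le_one_left (abs_nonneg _) (hg x)).trans hle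
    have h4 : |r - t| * (1 / 2) ≤ |r - t| * (2 * y * y') :=
      mul_le_mul_of_nonneg_left hpos (abs_nonneg _)
    push_cast
    nlinarith
  · filter_upwards [hgL.coeFn_toLp, (memLp_sqrt_linDensity (P₀ := P₀) hgm hg 0).coeFn_toLp,
      (memLp_sqrt_linDensity_deriv (P₀ := P₀) hgm hg 0).coeFn_toLp] with x h1 h2 h3
    rw [h1, h2, h3, linDensity_eq hg (by norm_num)]
    simp only [zero_mul, add_zero, Real.sqrt_one]
    ring

end BoundedScores

/-! ### The tangent space of the independence model and the projection -/

section IndependenceTangentSpace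

variable {α : Marginals}

lemma isProbabilityMeasure_of_mem_independenceModel {P : Measure (ℝ × ℝ)}
    (hP : P ∈ independenceModel) : IsProbabilityMeasure P := by
  obtain ⟨α, rfl⟩ := hP
  infer_instance

/-- Scores of the independence model are orthogonal to the constants and to the products of
centered functions of the coordinates. -/
lemma integral_mul_score_eq_zero {g : Lp ℝ 2 (productLaw α)}
    (hg : IsRegularScore independenceModel (productLaw α) g) :
    ∫ x, g x ∂(productLaw α) = 0 ∧
      ∀ (φ ψ : ℝ → ℝ), Measurable φ → Measurable ψ → (∀ x, |φ x| ≤ 1) → (∀ x, |ψ x| ≤ 1) →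
        ∫ u, φ u ∂(α.1 : Measure ℝ) = 0 → ∫ v, ψ v ∂(α.2 : Measure ℝ) = 0 →
          ∫ x, φ x.1 * ψ x.2 * g x ∂(productLaw α) = 0 := by
  obtain ⟨P, hP0, hPM, hd⟩ :=
    hg.hasDerivAt fun P hP => isProbabilityMeasure_of_mem_independenceModel hP
  refine ⟨?_, fun φ ψ hφ hψ hφ1 hψ1 hφ0 hψ0 => ?_⟩
  · have h1 := hd (fun _ => 1) 1 measurable_const (by simp)
    simp only [one_mul] at h1
    refine h1.unique ((hasDerivAt_const (0 : ℝ) (1 : ℝ)).congr_of_eventuallyEq ?_)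
    filter_upwards [hPM] with t ht
    have := isProbabilityMeasure_of_mem_independenceModel ht
    simp
  · have h1 := hd (fun x => φ x.1) 1 (hφ.comp measurable_fst) fun x => hφ1 _
    have h2 := hd (fun x => ψ x.2) 1 (hψ.comp measurable_snd) fun x => hψ1 _
    have h3 := hd (fun x => φ x.1 * ψ x.2) (1 * 1)
      ((hφ.comp measurable_fst).mul (hψ.comp measurable_snd)) fun x => by
        rw [abs_mul]
        exact mul_le_mul (hφ1 _) (hψ1 _) (abs_nonneg _) zero_le_one
    have e1 : ∫ x, φ x.1 ∂(P 0) = 0 := by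
      rw [hP0, productLaw, integral_fun_fst, hφ0, smul_zero]
    have e2 : ∫ x, ψ x.2 ∂(P 0) = 0 := by
      rw [hP0, productLaw, integral_fun_snd, hψ0, smul_zero]
    -- Under product laws the mean of `φψ` is the product of means; both factors vanish at `t = 0`,
    -- hence so does the derivative.
    have h4 := h1.mul h2
    rw [e1, e2, mul_zero, zero_mul, add_zero] at h4
    refine h3.unique (h4.congr_of_eventuallyEq ?_)
    filter_upwards [hPM] with t ht
    obtain ⟨β, hβ⟩ := ht
    simp only [Pi.mul_apply]
    rw [← hβ, productLaw, integral_prod_mul, integral_fun_fst, integral_fun_snd]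
    simp

lemma isProbabilityMeasure_withDensity_linear {P : Measure ℝ} [IsProbabilityMeasure P]
    {φ : ℝ → ℝ} (hφ : Measurable φ) (hφ1 : ∀ x, |φ x| ≤ 1) (hφ0 : ∫ u, φ u ∂P = 0) {t : ℝ}
    (ht : t ∈ Set.Ioo (-(1 / 2) : ℝ) (1 / 2)) :
    IsProbabilityMeasure (P.withDensity fun u => ENNReal.ofReal (1 + t * φ u)) := by
  have hi : Integrable φ P := (MemLp.of_bound (p := 1) hφ.aestronglyMeasurable 1
    (.of_forall hφ1)).integrable le_rfl
  have hi' : Integrable (fun u => 1 + t * φ u) P := (integrable_const 1).add (hi.const_mul t)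
  refine ⟨?_⟩
  rw [withDensity_apply _ .univ, Measure.restrict_univ, ← ofReal_integral_eq_lintegral_ofReal hi'
    (.of_forall fun u => ?_), integral_add (integrable_const 1) (hi.const_mul t),
    integral_const_mul, hφ0]
  · simp
  · change 0 ≤ 1 + t * φ u
    rw [← linDensity_eq hφ1 ht]
    exact linDensity_nonneg _ _ _

/-- Tilting the first marginal alone keeps the law a product. -/
lemma fst_mem_tangentSpace {φ : ℝ → ℝ} (hφ : Measurable φ) (hφ1 : ∀ x, |φ x| ≤ 1)
    (hφ0 : ∫ u, φ u ∂(α.1 : Measure ℝ) = 0)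
    (hL : MemLp (fun x : ℝ × ℝ => φ x.1) 2 (productLaw α)) :
    hL.toLp (fun x : ℝ × ℝ => φ x.1) ∈ tangentSpace independenceModel (productLaw α) := by
  refine toLp_mem_tangentSpace (hφ.comp measurable_fst) (fun x => hφ1 _) hL fun t ht => ?_
  refine ⟨(⟨_, isProbabilityMeasure_withDensity_linear hφ hφ1 hφ0 ht⟩, α.2), ?_⟩
  exact prod_withDensity_left (by fun_prop)

lemma snd_mem_tangentSpace {ψ : ℝ → ℝ} (hψ : Measurable ψ) (hψ1 : ∀ x, |ψ x| ≤ 1)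
    (hψ0 : ∫ v, ψ v ∂(α.2 : Measure ℝ) = 0)
    (hL : MemLp (fun x : ℝ × ℝ => ψ x.2) 2 (productLaw α)) :
    hL.toLp (fun x : ℝ × ℝ => ψ x.2) ∈ tangentSpace independenceModel (productLaw α) := by
  refine toLp_mem_tangentSpace (hψ.comp measurable_snd) (fun x => hψ1 _) hL fun t ht => ?_
  refine ⟨(α.1, ⟨_, isProbabilityMeasure_withDensity_linear hψ hψ1 hψ0 ht⟩), ?_⟩
  exact prod_withDensity_right (by fun_prop)

/-- The centered indicator of a lower set. -/
def centered (P : Measure ℝ) (D : LowerSet ℝ) (u : ℝ) : ℝ :=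
  (D : Set ℝ).indicator 1 u - P.real (D : Set ℝ)

variable (P : Measure ℝ) [IsProbabilityMeasure P] (D : LowerSet ℝ)

lemma measurable_centered : Measurable (centered P D) :=
  (measurable_one.indicator (measurableSet_lowerSet D)).sub_const _

lemma abs_centered_le (u : ℝ) : |centered P D u| ≤ 1 := by
  have h0 : 0 ≤ P.real (D : Set ℝ) := measureReal_nonneg
  have h1 : P.real (D : Set ℝ) ≤ 1 := measureReal_le_one
  rw [centered, abs_le]
  by_cases h : u ∈ D <;> simp [h] <;> linarith

lemma integral_centered : ∫ u, centered P D u ∂P = 0 := by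
  have hi : Integrable ((D : Set ℝ).indicator (1 : ℝ → ℝ)) P :=
    (integrable_const (1 : ℝ)).indicator (measurableSet_lowerSet D)
  unfold centered
  rw [integral_sub hi (integrable_const _), integral_indicator_one (measurableSet_lowerSet D)]
  simp

/-- With `φ`, `ψ` the centered indicators of the sides and `p`, `q` their masses, the candidate is
`qφ + pψ`, a combination of tangent vectors, and the residual is `φψ + pq`, orthogonal to every
score. -/
theorem rankProj_isProjectionVersion (α : Marginals) (γ : ℝ × ℝ) :
    IsProjectionVersion independenceModel (productLaw α) (rankIndex γ α) (rankProj α γ) := by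
  have hkm : Measurable (rankProj α γ) := by
    rw [rankProj_eq]
    exact measurable_rectComb _ _ _
  have hk : MemLp (rankProj α γ) 2 (productLaw α) := by
    rw [rankProj_eq]
    exact memLp_rectComb _ _ _
  have hh : MemLp (rankIndex γ α) 2 (productLaw α) := by
    rw [rankIndex_eq]
    exact memLp_rectComb _ _ _
  refine ⟨hkm, hh, ?_⟩
  set D := (rankPair γ α).1 with hD
  set E := (rankPair γ α).2 with hE
  set φ := centered α.1 D with hφ
  set ψ := centered α.2 E with hψ
  have hφL : MemLp (fun x : ℝ × ℝ => φ x.1) 2 (productLaw α) :=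
    MemLp.of_bound ((measurable_centered _ _).comp measurable_fst).aestronglyMeasurable 1
      (.of_forall fun x => abs_centered_le _ _ _)
  have hψL : MemLp (fun x : ℝ × ℝ => ψ x.2) 2 (productLaw α) :=
    MemLp.of_bound ((measurable_centered _ _).comp measurable_snd).aestronglyMeasurable 1
      (.of_forall fun x => abs_centered_le _ _ _)
  have hproj : rankProj α γ = (α.2 : Measure ℝ).real (E : Set ℝ) • (fun x : ℝ × ℝ => φ x.1) +
      (α.1 : Measure ℝ).real (D : Set ℝ) • (fun x : ℝ × ℝ => ψ x.2) := by
    funext x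
    simp only [rankProj_apply, Pi.add_apply, Pi.smul_apply, smul_eq_mul, hφ, hψ, centered]
    ring
  have hmem : hk.toLp _ ∈ tangentSpace independenceModel (productLaw α) := by
    have e : hk.toLp _ = (α.2 : Measure ℝ).real (E : Set ℝ) • hφL.toLp _ +
        (α.1 : Measure ℝ).real (D : Set ℝ) • hψL.toLp _ := by
      rw [← MemLp.toLp_const_smul, ← MemLp.toLp_const_smul, ← MemLp.toLp_add]
      exact MemLp.toLp_congr _ _ (.of_forall fun x => congrFun hproj x)
    rw [e]
    exact add_mem
      (Submodule.smul_mem _ _ (fst_mem_tangentSpace (measurable_centered _ _)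
        (abs_centered_le _ _) (integral_centered _ _) hφL))
      (Submodule.smul_mem _ _ (snd_mem_tangentSpace (measurable_centered _ _)
        (abs_centered_le _ _) (integral_centered _ _) hψL))
  have horth : ∀ w ∈ tangentSpace independenceModel (productLaw α),
      inner ℝ (hh.toLp _ - hk.toLp _) w = 0 := by
    -- Orthogonality to the residual is a closed linear condition, so it is enough to check it on
    -- the scores themselves.
    suffices tangentSpace independenceModel (productLaw α) ≤
        (innerSL ℝ (hh.toLp _ - hk.toLp _)).ker from fun w hw => this hw
    refine Submodule.topologicalClosure_minimal _ (Submodule.span_le.2 fun w hw => ?_)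
      (ContinuousLinearMap.isClosed_ker _)
    obtain ⟨h0, h1⟩ := integral_mul_score_eq_zero hw
    have h2 := h1 φ ψ (measurable_centered _ _) (measurable_centered _ _) (abs_centered_le _ _)
      (abs_centered_le _ _) (integral_centered _ _) (integral_centered _ _)
    have hwi : Integrable (w : ℝ × ℝ → ℝ) (productLaw α) :=
      (Lp.memLp w).integrable (by norm_num)
    have hres : ∀ x, rankIndex γ α x - rankProj α γ x = φ x.1 * ψ x.2 +
        (α.1 : Measure ℝ).real (D : Set ℝ) * (α.2 : Measure ℝ).real (E : Set ℝ) := by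
      intro x
      rw [rankProj_apply, rankIndex_eq_indicator, indicator_rect_apply]
      simp only [hφ, hψ, centered, Pi.one_def]
      ring
    have hpi : Integrable (fun x => φ x.1 * ψ x.2 * w x) (productLaw α) := by
      refine hwi.bdd_mul (c := 1) (((measurable_centered _ _).comp measurable_fst).mul
        ((measurable_centered _ _).comp measurable_snd)).aestronglyMeasurable
        (.of_forall fun x => ?_)
      rw [Real.norm_eq_abs, abs_mul]
      exact mul_le_one₀ (abs_centered_le _ _ _) (abs_nonneg _) (abs_centered_le _ _ _)
    change inner ℝ (hh.toLp _ - hk.toLp _) w = 0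
    rw [← MemLp.toLp_sub, L2.inner_def]
    calc _ = ∫ x, (φ x.1 * ψ x.2 * w x + (α.1 : Measure ℝ).real (D : Set ℝ) *
          (α.2 : Measure ℝ).real (E : Set ℝ) * w x) ∂(productLaw α) := by
          refine integral_congr_ae ?_
          filter_upwards [(hh.sub hk).coeFn_toLp] with x hx
          simp only [hx, RCLike.inner_apply, conj_trivial, Pi.sub_apply, hres]
          ring
      _ = 0 := by
          rw [integral_add hpi (hwi.const_mul _), h2, integral_const_mul, h0, mul_zero, add_zero]
  rw [Submodule.eq_starProjection_of_mem_of_inner_eq_zero hmem horth]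
  exact hk.coeFn_toLp.symm

end IndependenceTangentSpace

end ScoreTest

end

theorem proposition4p3 {Ω : Type*} [MeasurableSpace Ω] (μ : Measure Ω) [IsProbabilityMeasure μ]
    (α₀ : ScoreTest.Marginals)
    (hU : Continuous (cdf (α₀.1 : Measure ℝ))) (hV : Continuous (cdf (α₀.2 : Measure ℝ)))
    (X : ℕ → Ω → ℝ × ℝ) (hX : ∀ i, Measurable (X i)) (hindep : iIndepFun X μ)
    (hlaw : ∀ i, μ.map (X i) = ScoreTest.productLaw α₀)
    (Pn : ℕ → Ω → Measure (ℝ × ℝ))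
    (hPn : ∀ n ω, Pn n ω = ScoreTest.empiricalMeasure (fun i => X i ω) n)
    (αhat : ℕ → Ω → ScoreTest.Marginals)
    (hαhat : ∀ n ω, αhat n ω = ScoreTest.independenceNPMLE (fun i => X i ω) n) :
    (∀ γ, ScoreTest.IsProjectionVersion ScoreTest.independenceModel (ScoreTest.productLaw α₀)
      (ScoreTest.rankIndex γ α₀) (ScoreTest.rankProj α₀ γ)) ∧
    ScoreTest.CondM0 ScoreTest.rankIndex (ScoreTest.rankProj α₀) α₀ ∧
    ScoreTest.CondM3 μ ScoreTest.productLaw ScoreTest.rankIndex α₀ Pn αhat ∧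
    ScoreTest.CondM4 μ ScoreTest.productLaw ScoreTest.rankIndex α₀ αhat ∧
    ScoreTest.CondM5 μ ScoreTest.productLaw ScoreTest.rankIndex (ScoreTest.rankProj α₀) α₀
      Pn αhat ∧
    ScoreTest.ScoreProcessesConverge μ (ScoreTest.productLaw α₀)
      (fun γ => ScoreTest.rankIndex γ α₀) (ScoreTest.rankProj α₀)
      (ScoreTest.scoreProcess ScoreTest.productLaw ScoreTest.rankIndex (ScoreTest.rankProj α₀) α₀ X)
      (ScoreTest.estimatedScoreProcess ScoreTest.productLaw ScoreTest.rankIndex Pn αhat) := by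
  obtain rfl : Pn = fun n ω => ScoreTest.empiricalMeasure (fun i => X i ω) n := by
    funext n ω
    exact hPn n ω
  obtain rfl : αhat = fun n ω => ScoreTest.independenceNPMLE (fun i => X i ω) n := by
    funext n ω
    exact hαhat n ω
  have hrem := ScoreTest.remainders_eventually_small hU hV hX hindep hlaw
  refine ⟨ScoreTest.rankProj_isProjectionVersion α₀, ScoreTest.rankIndex_condM0 α₀,
    ScoreTest.supLittleOP_of_eventually fun ε hε η hη => ?_,
    ScoreTest.supLittleOP_of_eventually fun ε hε η hη => ?_,
    ScoreTest.supLittleOP_of_eventually fun ε hε η hη => ?_,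
    ScoreTest.rankScoreProcesses_converge hU hV hX hindep hlaw⟩
  · filter_upwards [hrem ε hε η hη] with n hn
    refine (measure_mono ?_).trans hn.2
    rintro ω ⟨γ, hγ⟩
    exact ⟨γ, Or.inl hγ⟩
  · filter_upwards [hrem ε hε η hη] with n hn
    refine (measure_mono ?_).trans hn.2
    rintro ω ⟨γ, hγ⟩
    exact ⟨γ, Or.inr (Or.inl hγ)⟩
  · filter_upwards [hrem ε hε η hη] with n hn
    refine (measure_mono ?_).trans hn.2
    rintro ω ⟨γ, hγ⟩
    exact ⟨γ, Or.inr (Or.inr hγ)⟩
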